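/- For $d\ge 2$, a weight $W:\mathbb{R}^d\times\mathbb{S}^{d-1}\to\mathbb{R}$ and a function $f:\mathbb{R}^d\to\mathbb{R}$, let $$R_Wf(s,\theta)=\int_{x\cdot\theta=s}W(x,\theta)f(x)\,dx,\qquad (s,\theta)\in\mathbb{R}\times\mathbb{S}^{d-1},$$ where $dx$ is Lebesgue measure on the hyperplane. Let $(e_1,\dots,e_d)$ be the canonical basis of $\mathbb{R}^d$ and $\Theta(e_1,e_2)=\{\theta\in\mathbb{S}^{d-1}:\theta\perp e_1,\ \theta\perp e_2\}$. **Theorem.** There are a weight $w_0\in C^\infty(\mathbb{R}^2\times\mathbb{S}^1)$ with $1/2\le w_0\le 1$ and a function $f_0\in C_0^\infty(\mathbb{R}^2)$, $f_0\not\equiv 0$, supported in the closed unit disc, with $$\int_{\mathbb{R}}w_0(x+t\theta,\theta)f_0(x+t\theta)\,dt=0\qquad\text{for all }x\in\mathbb{R}^2,\ \theta\in\mathbb{S}^1\text{ with }x\cdot\theta=0$$ (a counterexample of the type of J. Boman), such that the following holds for every $d\ge 3$. The set $\Theta(e_1,e_2)$ has zero surface measure on $\mathbb{S}^{d-1}$.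 There are functions $\psi\in C_0^\infty(\mathbb{R}^{d-2})$ whose support is the closed unit ball and which are positive on the open unit ball. There are maps $\alpha$ from $\mathbb{S}^{d-1}$ to the unit circle of $\mathrm{span}(e_1,e_2)$ such that $\alpha(\theta)\perp\theta$ and $\det(\alpha(\theta),\theta,e_3,\dots,e_d)>0$ for all $\theta\notin\Theta(e_1,e_2)$; the values on $\Theta(e_1,e_2)$ are arbitrary. For every such $\psi$ and $\alpha$, put $$W(x,\theta)=w_0(x_1,x_2,\alpha_1(\theta),\alpha_2(\theta)),\qquad f(x)=\psi(x_3,\dots,x_d)\,f_0(x_1,x_2).$$ Then: 1. $R_Wf\equiv 0$ on $\mathbb{R}\times\mathbb{S}^{d-1}$, and all the integrals defining $R_Wf$ converge absolutely; 2. $W$ is real valued, $W\ge c>0$ for a constant $c$, and $W\in L^\infty(\mathbb{R}^d\times\mathbb{S}^{d-1})$; 3. $f\in C_0^\infty(\mathbb{R}^d)$ and $f\not\equiv 0$; 4. $1/2\le W\le 1$, and $W$ is $C^\infty$-smooth on $\mathbb{R}^d\times(\mathbb{S}^{d-1}\setminus\Theta(e_1,e_2))$. -/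

import Mathlib

open MeasureTheory Metric
open scoped Manifold ContDiff RealInnerProductSpace

noncomputable section

/-- Euclidean space `ℝ^d`. -/
abbrev Euc (d : ℕ) : Type := EuclideanSpace ℝ (Fin d)

/-- The unit sphere `S^(d-1)` of `ℝ^d`. -/
abbrev Sph (d : ℕ) : Type := sphere (0 : Euc d) 1

/-- The integrand of the weighted Radon transform on the hyperplane `{x | x θ = s}`, which is
parametrized isometrically by `y ↦ s θ + y` with `y` in the hyperplane through the origin
orthogonal to `θ`. -/
def radonIntegrand {d : ℕ} (W : Euc d → Sph d → ℝ) (f : Euc d → ℝ) (s : ℝ) (θ : Sph d)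
    (y : (ℝ ∙ (θ : Euc d))ᗮ) : ℝ :=
  W (s • (θ : Euc d) + (y : Euc d)) θ * f (s • (θ : Euc d) + (y : Euc d))

/-- The weighted Radon transform along hyperplanes,
`R_W f (s, θ) = ∫_{x θ = s} W(x, θ) f(x) dx`, where `dx` is the Lebesgue measure of the
hyperplane. -/
def weightedRadon {d : ℕ} (W : Euc d → Sph d → ℝ) (f : Euc d → ℝ) (s : ℝ) (θ : Sph d) : ℝ :=
  ∫ y, radonIntegrand W f s θ y

/-- The weighted ray transform `P_w f (x, θ) = ∫ w(x + t θ, θ) f(x + t θ) dt`. -/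
def weightedRay {d : ℕ} (w : Euc d → Sph d → ℝ) (f : Euc d → ℝ) (x : Euc d) (θ : Sph d) : ℝ :=
  ∫ t : ℝ, w (x + t • (θ : Euc d)) θ * f (x + t • (θ : Euc d))

/-- A (real valued) weight is admissible if it is bounded from below by a positive constant and
lies in `L^∞(ℝ^d × S^(d-1))`, for the product of the Lebesgue and the surface measure. -/
def IsAdmissibleWeight {d : ℕ} (W : Euc d → Sph d → ℝ) : Prop :=
  (∃ c : ℝ, 0 < c ∧ ∀ x θ, c ≤ W x θ) ∧
    MemLp (Function.uncurry W) ⊤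
      ((volume : Measure (Euc d)).prod (volume : Measure (Euc d)).toSphere)

/-- `Θ(v₁, v₂)`: the unit vectors orthogonal to `v₁` and `v₂`. -/
def orthSphere {d : ℕ} (v₁ v₂ : Euc d) : Set (Sph d) :=
  {θ | ⟪(θ : Euc d), v₁⟫ = 0 ∧ ⟪(θ : Euc d), v₂⟫ = 0}

/-- `stdVec i` is the `i`-th vector of the canonical basis, indexed from `0`. -/
def stdVec {d : ℕ} (i : Fin d) : Euc d := EuclideanSpace.single i 1

/-- A planar counterexample of Boman's type: a smooth weight `w₀` with `1/2 ≤ w₀ ≤ 1` and a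
nonzero smooth function `f₀` supported in the closed unit disc, such that the weighted ray
transform of `f₀` vanishes on all oriented lines of the plane. -/
structure IsBomanPair (w₀ : Euc 2 → Sph 2 → ℝ) (f₀ : Euc 2 → ℝ) : Prop where
  bounds : ∀ x θ, 1 / 2 ≤ w₀ x θ ∧ w₀ x θ ≤ 1
  smooth_weight :
    ContMDiff (𝓘(ℝ, Euc 2).prod (𝓡 1)) 𝓘(ℝ, ℝ) ∞ (Function.uncurry w₀)
  smooth_fun : ContDiff ℝ ∞ f₀
  ne_zero : f₀ ≠ 0
  support_subset : tsupport f₀ ⊆ closedBall 0 1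
  ray_eq_zero : ∀ (x : Euc 2) (θ : Sph 2), ⟪x, (θ : Euc 2)⟫ = 0 → weightedRay w₀ f₀ x θ = 0

/-- A function `ψ ∈ C_0^∞(ℝ^n)` with support the closed unit ball, positive on the open ball. -/
structure IsCutoff {n : ℕ} (ψ : Euc n → ℝ) : Prop where
  smooth : ContDiff ℝ ∞ ψ
  support_eq : tsupport ψ = closedBall 0 1
  pos : ∀ x ∈ ball (0 : Euc n) 1, 0 < ψ x

/-- `(x₁, x₂)` for `x = (x₁, …, x_d)`, with `d = n + 2`. -/
def headPart {n : ℕ} (x : Euc (n + 2)) : Euc 2 := !₂[x 0, x 1]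

/-- `(x₃, …, x_d)` for `x = (x₁, …, x_d)`, with `d = n + 2`. -/
def tailPart {n : ℕ} (x : Euc (n + 2)) : Euc n := WithLp.toLp 2 fun i => x i.succ.succ

/-- `(a₁, a₂, 0, …, 0)` for `a = (a₁, a₂)`; this identifies `ℝ²` with `span (e₁, e₂)`. -/
def planeVec {n : ℕ} (a : Euc 2) : Euc (n + 2) := a 0 • stdVec 0 + a 1 • stdVec 1

/-- The determinant `det (u, v, e₃, …, e_d)` of column vectors, with `d = n + 2`. -/
def frameDet {n : ℕ} (u v : Euc (n + 2)) : ℝ :=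
  Matrix.det (Matrix.of fun i j : Fin (n + 2) =>
    (Fin.cons u (Fin.cons v fun k : Fin n => stdVec k.succ.succ) : Fin (n + 2) → Euc (n + 2)) j i)

/-- `α` assigns to `θ` a unit vector `α(θ)` of `span (e₁, e₂)`, given through its two
coordinates, which for `θ ∉ Θ(e₁, e₂)` is the direction of the line in which `span (e₁, e₂)`
meets the hyperplanes orthogonal to `θ`, oriented by `det (α(θ), θ, e₃, …, e_d) > 0`.
For `θ ∈ Θ(e₁, e₂)` the unit vector is arbitrary. -/
def IsDirectionMap {n : ℕ} (α : Sph (n + 2) → Sph 2) : Prop :=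
  ∀ θ : Sph (n + 2), θ ∉ orthSphere (stdVec 0) (stdVec 1) →
    ⟪planeVec (α θ : Euc 2), (θ : Euc (n + 2))⟫ = 0 ∧
      0 < frameDet (planeVec (α θ : Euc 2)) (θ : Euc (n + 2))

/-- The weight `W(x, θ) = w₀(x₁, x₂, α(θ))`. -/
def liftedWeight {n : ℕ} (w₀ : Euc 2 → Sph 2 → ℝ) (α : Sph (n + 2) → Sph 2) :
    Euc (n + 2) → Sph (n + 2) → ℝ :=
  fun x θ => w₀ (headPart x) (α θ)

/-- The function `f(x) = ψ(x₃, …, x_d) f₀(x₁, x₂)`. -/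
def liftedFun {n : ℕ} (ψ : Euc n → ℝ) (f₀ : Euc 2 → ℝ) : Euc (n + 2) → ℝ :=
  fun x => ψ (tailPart x) * f₀ (headPart x)

end

/-!
The planar function is `f₀ = ∑ B ^ (-k²) ringPiece k`, whose `k`-th piece lives in the annulus
`1 ≤ 2 ^ (k + 1) (1 - r²) ≤ 2` and oscillates: piece `0` is a radial chirp, while piece `k` rotates
with an angular frequency of order `N 4 ^ k`. Consider a line at distance `p` from the origin with
`1 - p²` of order `2 ^ (-k)`. The integral of `(ringPiece k)²` over it is comparable to `2 ^ (-k)`,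
whereas repeated integration by parts makes the integral of `f₀` itself, rescaled by `B ^ k²`, at
most a small multiple of `2 ^ (-k)`. Subtracting from the weight `1` the ratio of the second
integral to the first, times `ringPiece k`, therefore annihilates the ray transform on such lines
and moves the weight by at most `1/3`; a dyadic partition of unity in `1 - p²` combines the
scales. The weight is smooth up to the unit circle because the `k`-th correction decays faster than
any geometric sequence in the sup norm, while its derivatives grow at most geometrically: by
interpolation, all its derivatives decay rapidly too.

In dimension `d`, the hyperplanes orthogonal to `θ` are swept out by lines of direction
`α(θ) ∈ span (e₁, e₂)`. Along such a line `(x₃, …, x_d)` is constant and `(x₁, x₂)` runs over a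
line of the plane, so by Fubini's theorem the Radon transform reduces to the planar ray transform.
-/

section SmoothFamilies

universe u

variable {E G H : Type*} [NormedAddCommGroup E] [NormedSpace ℝ E]
  [NormedAddCommGroup G] [NormedSpace ℝ G] [NormedAddCommGroup H] [NormedSpace ℝ H]

/-- A sequence of smooth functions each of whose derivatives grows at most geometrically in the
index, uniformly on `S`. Smoothness is required everywhere, the bounds only on `S`. -/
structure GeomBounded (S : Set E) (F : ℕ → E → G) : Prop where
  smooth : ∀ k, ContDiff ℝ ∞ (F k)
  bound : ∀ m : ℕ, ∃ R : ℝ, 1 ≤ R ∧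
    ∀ k, ∀ x ∈ S, ‖iteratedFDeriv ℝ m (F k) x‖ ≤ R ^ (k + 1)

/-- A sequence of functions which tends to zero uniformly, faster than any geometric sequence. -/
def RapidDecay (F : ℕ → E → G) : Prop :=
  ∀ r : ℝ, 0 < r → ∃ C : ℝ, 0 ≤ C ∧ ∀ k x, ‖F k x‖ ≤ C * r ^ k

theorem le_pow_succ_of_le {a R : ℝ} (hR : 1 ≤ R) (h : a ≤ R) (k : ℕ) : a ≤ R ^ (k + 1) :=
  h.trans (le_self_pow₀ hR k.succ_ne_zero)

theorem exists_bound_iteratedFDeriv_of_isCompact {S : Set E} (hS : IsCompact S) {F : E → G}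
    (hF : ContDiff ℝ ∞ F) (m : ℕ) : ∃ C, ∀ x ∈ S, ‖iteratedFDeriv ℝ m F x‖ ≤ C :=
  hS.exists_bound_of_continuousOn
    ((contDiff_infty.1 hF m).continuous_iteratedFDeriv le_rfl).continuousOn

theorem exists_bound_iteratedFDeriv_of_hasCompactSupport {F : E → G} (hF : ContDiff ℝ ∞ F)
    (hs : HasCompactSupport F) (m : ℕ) : ∃ C, ∀ x, ‖iteratedFDeriv ℝ m F x‖ ≤ C :=
  (hs.iteratedFDeriv (𝕜 := ℝ) m).exists_bound_of_continuous
    ((contDiff_infty.1 hF m).continuous_iteratedFDeriv le_rfl)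

theorem norm_iteratedFDeriv_const_mul {F : E → ℝ} (hF : ContDiff ℝ ∞ F) (c : ℝ) (m : ℕ) (x : E) :
    ‖iteratedFDeriv ℝ m (fun x => c * F x) x‖ = |c| * ‖iteratedFDeriv ℝ m F x‖ := by
  change ‖iteratedFDeriv ℝ m (c • F) x‖ = _
  rw [iteratedFDeriv_const_smul_apply (contDiff_infty.1 hF m).contDiffAt, norm_smul,
    Real.norm_eq_abs]

theorem norm_iteratedFDeriv_pow_le {𝕜 : Type*} [RCLike 𝕜] (m n : ℕ) {w : 𝕜} (hw : ‖w‖ ≤ 1) :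
    ‖iteratedFDeriv ℝ m (fun w : 𝕜 => w ^ n) w‖ ≤ (n : ℝ) ^ m := by
  have hsmooth : ContDiffAt 𝕜 m (fun w : 𝕜 => w ^ n) w := contDiffAt_id.pow n
  rw [← hsmooth.restrictScalars_iteratedFDeriv (𝕜 := ℝ), Function.comp_apply,
    ContinuousMultilinearMap.norm_restrictScalars, norm_iteratedFDeriv_eq_norm_iteratedDeriv,
    iteratedDeriv_pow, norm_mul, norm_pow]
  calc ‖(n.descFactorial m : 𝕜)‖ * ‖w‖ ^ (n - m)
      ≤ (n.descFactorial m : ℝ) * 1 := by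
        rw [RCLike.norm_natCast]
        gcongr
        exact pow_le_one₀ (norm_nonneg w) hw
    _ ≤ (n : ℝ) ^ m := by
        rw [mul_one]
        exact_mod_cast n.descFactorial_le_pow m

namespace GeomBounded

theorem exists_uniform_bound {S : Set E} {F : ℕ → E → G} (hF : GeomBounded S F) (n : ℕ) :
    ∃ R : ℝ, 1 ≤ R ∧ ∀ m ≤ n, ∀ k, ∀ x ∈ S, ‖iteratedFDeriv ℝ m (F k) x‖ ≤ R ^ (k + 1) := by
  choose R hR hb using hF.bound
  have hR0 : ∀ m, 0 ≤ R m := fun m => zero_le_one.trans (hR m)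
  have hle : ∀ m ≤ n, R m ≤ ∑ m ∈ Finset.range (n + 1), R m := fun m hm =>
    Finset.single_le_sum (fun i _ => hR0 i) (Finset.mem_range_succ_iff.2 hm)
  refine ⟨_, (hR n).trans (hle n le_rfl), fun m hm k x hx => (hb m k x hx).trans ?_⟩
  exact pow_le_pow_left₀ (hR0 m) (hle m hm) _

theorem const_of_bound {S : Set E} {F : E → G} (hF : ContDiff ℝ ∞ F)
    (hb : ∀ m : ℕ, ∃ C, ∀ x ∈ S, ‖iteratedFDeriv ℝ m F x‖ ≤ C) :
    GeomBounded S (fun _ => F) := by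
  refine ⟨fun _ => hF, fun m => ?_⟩
  obtain ⟨C, hC⟩ := hb m
  exact ⟨max C 1, le_max_right _ _, fun k x hx =>
    le_pow_succ_of_le (le_max_right _ _) ((hC x hx).trans (le_max_left _ _)) k⟩

theorem const {S : Set E} (hS : IsCompact S) {F : E → G} (hF : ContDiff ℝ ∞ F) :
    GeomBounded S (fun _ => F) :=
  .const_of_bound hF (exists_bound_iteratedFDeriv_of_isCompact hS hF)

theorem const_of_hasCompactSupport {F : E → G} (hF : ContDiff ℝ ∞ F) (hs : HasCompactSupport F) :
    GeomBounded Set.univ (fun _ => F) :=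
  .const_of_bound hF fun m =>
    (exists_bound_iteratedFDeriv_of_hasCompactSupport hF hs m).imp fun _ hC x _ => hC x

theorem of_succ {S : Set E} (hS : IsCompact S) {F : ℕ → E → G}
    (h0 : ContDiff ℝ ∞ (F 0)) (h : GeomBounded S (fun k => F (k + 1))) : GeomBounded S F := by
  refine ⟨fun k => k.casesOn h0 h.smooth, fun m => ?_⟩
  obtain ⟨C, hC⟩ := exists_bound_iteratedFDeriv_of_isCompact hS h0 m
  obtain ⟨R, hR, hb⟩ := h.bound m
  have h1 : 1 ≤ max C R := hR.trans (le_max_right _ _)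
  refine ⟨max C R, h1, fun k x hx => ?_⟩
  cases k with
  | zero => exact le_pow_succ_of_le h1 ((hC x hx).trans (le_max_left _ _)) 0
  | succ k =>
    calc _ ≤ R ^ (k + 1) := hb k x hx
      _ ≤ (max C R) ^ (k + 1) := by gcongr; exact le_max_right _ _
      _ ≤ _ := pow_le_pow_right₀ h1 (k + 1).le_succ

theorem mul {S : Set E} {F F' : ℕ → E → ℝ} (hF : GeomBounded S F)
    (hF' : GeomBounded S F') : GeomBounded S (fun k x => F k x * F' k x) := by
  refine ⟨fun k => (hF.smooth k).mul (hF'.smooth k), fun n => ?_⟩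
  obtain ⟨R, hR, hb⟩ := hF.exists_uniform_bound n
  obtain ⟨R', hR', hb'⟩ := hF'.exists_uniform_bound n
  have h2 : (1 : ℝ) ≤ 2 ^ n := one_le_pow₀ one_le_two
  refine ⟨2 ^ n * (R * R'), one_le_mul_of_one_le_of_one_le h2
    (one_le_mul_of_one_le_of_one_le hR hR'), fun k x hx => ?_⟩
  calc ‖iteratedFDeriv ℝ n (fun x => F k x * F' k x) x‖
      ≤ ∑ i ∈ Finset.range (n + 1), (n.choose i : ℝ) * ‖iteratedFDeriv ℝ i (F k) x‖ *
          ‖iteratedFDeriv ℝ (n - i) (F' k) x‖ :=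
        norm_iteratedFDeriv_mul_le (contDiff_infty.1 (hF.smooth k) n)
          (contDiff_infty.1 (hF'.smooth k) n) x le_rfl
    _ ≤ ∑ i ∈ Finset.range (n + 1), (n.choose i : ℝ) * (R ^ (k + 1) * R' ^ (k + 1)) := by
        refine Finset.sum_le_sum fun i hi => ?_
        rw [mul_assoc]
        gcongr
        · exact hb i (Finset.mem_range_succ_iff.1 hi) k x hx
        · exact hb' (n - i) (n.sub_le i) k x hx
    _ = 2 ^ n * (R * R') ^ (k + 1) := by
        rw [← Finset.sum_mul, mul_pow]
        congr 1
        exact_mod_cast Nat.sum_range_choose n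
    _ ≤ (2 ^ n * (R * R')) ^ (k + 1) := by
        rw [mul_pow (2 ^ n : ℝ)]
        gcongr
        exact le_self_pow₀ h2 k.succ_ne_zero

theorem const_mul {S : Set E} {F : ℕ → E → ℝ} (hF : GeomBounded S F) {a : ℕ → ℝ} {r : ℝ}
    (hr : 1 ≤ r) (ha : ∀ k, |a k| ≤ r ^ (k + 1)) : GeomBounded S (fun k x => a k * F k x) := by
  refine ⟨fun k => contDiff_const.mul (hF.smooth k), fun n => ?_⟩
  obtain ⟨R, hR, hb⟩ := hF.bound n
  refine ⟨r * R, one_le_mul_of_one_le_of_one_le hr hR, fun k x hx => ?_⟩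
  rw [norm_iteratedFDeriv_const_mul (hF.smooth k), mul_pow]
  exact mul_le_mul (ha k) (hb k x hx) (norm_nonneg _) (by positivity)

theorem comp {S : Set E} {T : Set G} {g : ℕ → G → H} {f : ℕ → E → G}
    (hg : GeomBounded T g) (hf : GeomBounded S f) (hST : ∀ k, Set.MapsTo (f k) S T) :
    GeomBounded S (fun k x => g k (f k x)) := by
  refine ⟨fun k => (hg.smooth k).comp (hf.smooth k), fun n => ?_⟩
  obtain ⟨R, hR, hb⟩ := hg.exists_uniform_bound n
  obtain ⟨R', hR', hb'⟩ := hf.exists_uniform_bound n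
  have hfact : (1 : ℝ) ≤ n.factorial := by exact_mod_cast n.factorial_pos
  refine ⟨n.factorial * (R * R' ^ n), one_le_mul_of_one_le_of_one_le hfact
    (one_le_mul_of_one_le_of_one_le hR (one_le_pow₀ hR')), fun k x hx => ?_⟩
  calc ‖iteratedFDeriv ℝ n (g k ∘ f k) x‖
      ≤ n.factorial * R ^ (k + 1) * (R' ^ (k + 1)) ^ n :=
        norm_iteratedFDeriv_comp_le (contDiff_infty.1 (hg.smooth k) n)
          (contDiff_infty.1 (hf.smooth k) n) le_rfl x
          (fun i hi => hb i hi k _ (hST k hx))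
          (fun i hi hi' => (hb' i hi' k x hx).trans
            (le_self_pow₀ (one_le_pow₀ hR') (Nat.one_le_iff_ne_zero.1 hi)))
    _ = n.factorial * (R * R' ^ n) ^ (k + 1) := by ring
    _ ≤ (n.factorial * (R * R' ^ n)) ^ (k + 1) := by
        rw [mul_pow (n.factorial : ℝ)]
        gcongr
        exact le_self_pow₀ hfact k.succ_ne_zero

theorem clm_comp {S : Set E} {f : ℕ → E → G} (hf : GeomBounded S f) (L : G →L[ℝ] H) :
    GeomBounded S (fun k x => L (f k x)) := by
  refine ⟨fun k => L.contDiff.comp (hf.smooth k), fun n => ?_⟩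
  obtain ⟨R, hR, hb⟩ := hf.bound n
  have h1 : 1 ≤ max ‖L‖ 1 := le_max_right _ _
  refine ⟨max ‖L‖ 1 * R, one_le_mul_of_one_le_of_one_le h1 hR, fun k x hx => ?_⟩
  calc ‖iteratedFDeriv ℝ n (L ∘ f k) x‖ ≤ ‖L‖ * ‖iteratedFDeriv ℝ n (f k) x‖ :=
        L.norm_iteratedFDeriv_comp_left (contDiff_infty.1 (hf.smooth k) n).contDiffAt le_rfl
    _ ≤ (max ‖L‖ 1) ^ (k + 1) * R ^ (k + 1) := by
        gcongr
        · exact le_pow_succ_of_le h1 (le_max_left _ _) k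
        · exact hb k x hx
    _ = _ := (mul_pow _ _ _).symm

theorem of_eventuallyEq_zero {S : Set E} {F : ℕ → E → G} (hF : GeomBounded S F)
    (h0 : ∀ k, ∀ x ∉ S, F k =ᶠ[nhds x] 0) : GeomBounded Set.univ F := by
  refine ⟨hF.smooth, fun n => ?_⟩
  obtain ⟨R, hR, hb⟩ := hF.bound n
  refine ⟨R, hR, fun k x _ => ?_⟩
  by_cases hx : x ∈ S
  · exact hb k x hx
  · rw [((h0 k x hx).iteratedFDeriv ℝ n).eq_of_nhds, iteratedFDeriv_zero, Pi.zero_apply, norm_zero]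
    positivity

theorem fderiv {S : Set E} {F : ℕ → E → G} (hF : GeomBounded S F) :
    GeomBounded S (fun k => fderiv ℝ (F k)) := by
  refine ⟨fun k => (hF.smooth k).fderiv_right (m := ∞) le_rfl, fun m => ?_⟩
  obtain ⟨R, hR, hb⟩ := hF.bound (m + 1)
  exact ⟨R, hR, fun k x hx => norm_iteratedFDeriv_fderiv.trans_le (hb k x hx)⟩

theorem pow {n : ℕ → ℕ} {r : ℝ} (hr : 1 ≤ r) (hn : ∀ k, (n k : ℝ) ≤ r ^ (k + 1)) :
    GeomBounded (closedBall (0 : ℂ) 1) (fun k (w : ℂ) => w ^ n k) := by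
  refine ⟨fun k => contDiff_id.pow _, fun m => ⟨r ^ m, one_le_pow₀ hr, fun k x hx => ?_⟩⟩
  calc _ ≤ (n k : ℝ) ^ m := norm_iteratedFDeriv_pow_le m (n k) (mem_closedBall_zero_iff.1 hx)
    _ ≤ (r ^ (k + 1)) ^ m := by gcongr; exact hn k
    _ = (r ^ m) ^ (k + 1) := pow_right_comm _ _ _

theorem tsum_mul {F : ℕ → E → ℝ} (hF : GeomBounded Set.univ F) {c : ℕ → ℕ → ℝ}
    (hc : ∀ r : ℝ, 1 ≤ r → ∃ R : ℝ, 1 ≤ R ∧ ∀ k j, |c k j| * r ^ (j + 1) ≤ R ^ (k + 1)) :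
    GeomBounded Set.univ (fun k x => ∑' j, c k j * F j x) := by
  have hterm : ∀ m : ℕ, ∃ R : ℝ, 1 ≤ R ∧ ∀ k j x,
      ‖iteratedFDeriv ℝ m (fun x => c k j * F j x) x‖ ≤ R ^ (k + 1) * (1 / 2) ^ (j + 1) := by
    intro m
    obtain ⟨r, hr, hb⟩ := hF.bound m
    obtain ⟨R, hR, hR'⟩ := hc (2 * r) (by linarith)
    refine ⟨R, hR, fun k j x => ?_⟩
    calc ‖iteratedFDeriv ℝ m (fun x => c k j * F j x) x‖ ≤ |c k j| * r ^ (j + 1) := by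
          rw [norm_iteratedFDeriv_const_mul (hF.smooth j)]
          gcongr
          exact hb j x (Set.mem_univ x)
      _ = |c k j| * (2 * r) ^ (j + 1) * (1 / 2) ^ (j + 1) := by
          rw [mul_assoc, ← mul_pow]; congr 2; ring
      _ ≤ _ := by gcongr; exact hR' k j
  choose R hR hb using hterm
  have hsum : ∀ a : ℝ, HasSum (fun j : ℕ => a * (1 / 2 : ℝ) ^ (j + 1)) a := fun a => by
    simpa [pow_succ', ← mul_assoc] using hasSum_geometric_two.mul_left (a * (1 / 2))
  have hsmooth : ∀ k j, ContDiff ℝ ((⊤ : ℕ∞) : WithTop ℕ∞) (fun x => c k j * F j x) :=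
    fun k j => contDiff_const.mul (hF.smooth j)
  have hsummable (k : ℕ) (m : ℕ) (_ : (m : ℕ∞) ≤ ⊤) := (hsum (R m ^ (k + 1))).summable
  refine ⟨fun k => contDiff_tsum (hsmooth k) (hsummable k) fun m j x _ => hb m k j x,
    fun m => ⟨R m, hR m, fun k x _ => ?_⟩⟩
  rw [iteratedFDeriv_tsum_apply (hsmooth k) (hsummable k) (fun m j x _ => hb m k j x) le_top]
  exact tsum_of_norm_bounded (hsum _) fun j => hb m k j x

end GeomBounded

theorem norm_fderiv_apply_le_of_bounds {f : E → G} (hf : ContDiff ℝ 2 f) {a b : ℝ}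
    (ha : ∀ x, ‖f x‖ ≤ a) (hb : ∀ x, ‖fderiv ℝ (fderiv ℝ f) x‖ ≤ b) (x v : E) :
    ‖fderiv ℝ f x v‖ ≤ 2 * a + b * ‖v‖ ^ 2 := by
  have hb0 : 0 ≤ b := (ContinuousLinearMap.opNorm_nonneg _).trans (hb x)
  have hd : Differentiable ℝ f := hf.differentiable two_ne_zero
  have hd' : Differentiable ℝ (fderiv ℝ f) :=
    (hf.fderiv_right (m := 1) (by norm_num)).differentiable one_ne_zero
  have hlip : ∀ y, ‖fderiv ℝ f y - fderiv ℝ f x‖ ≤ b * ‖y - x‖ := fun y =>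
    convex_univ.norm_image_sub_le_of_norm_fderiv_le (fun z _ => hd' z) (fun z _ => hb z)
      (Set.mem_univ x) (Set.mem_univ y)
  have htaylor : ‖f (x + v) - f x - fderiv ℝ f x v‖ ≤ b * ‖v‖ * ‖v‖ := by
    have := (convex_closedBall x ‖v‖).norm_image_sub_le_of_norm_fderiv_le' (𝕜 := ℝ)
      (φ := fderiv ℝ f x) (C := b * ‖v‖) (fun z _ => hd z)
      (fun z hz => (hlip z).trans (by gcongr; exact mem_closedBall_iff_norm.1 hz))
      (mem_closedBall_self (norm_nonneg v)) (y := x + v) (by simp)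
    simpa only [add_sub_cancel_left] using this
  calc ‖fderiv ℝ f x v‖ = ‖(f (x + v) - f x) - (f (x + v) - f x - fderiv ℝ f x v)‖ := by
        rw [sub_sub_cancel]
    _ ≤ (‖f (x + v)‖ + ‖f x‖) + ‖f (x + v) - f x - fderiv ℝ f x v‖ :=
        (norm_sub_le _ _).trans (add_le_add_left (norm_sub_le _ _) _)
    _ ≤ (a + a) + b * ‖v‖ * ‖v‖ := by gcongr <;> apply ha
    _ = _ := by ring

theorem norm_fderiv_le_of_bounds {f : E → G} (hf : ContDiff ℝ 2 f) {a b h : ℝ} (hh : 0 < h)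
    (ha : ∀ x, ‖f x‖ ≤ a) (hb : ∀ x, ‖fderiv ℝ (fderiv ℝ f) x‖ ≤ b) (x : E) :
    ‖fderiv ℝ f x‖ ≤ 2 * a / h + b * h := by
  have ha0 : 0 ≤ a := (norm_nonneg _).trans (ha x)
  have hb0 : 0 ≤ b := (ContinuousLinearMap.opNorm_nonneg _).trans (hb x)
  refine ContinuousLinearMap.opNorm_le_of_unit_norm (by positivity) fun v hv => ?_
  have := norm_fderiv_apply_le_of_bounds hf ha hb x (h • v)
  rw [map_smul, norm_smul, norm_smul, hv, Real.norm_of_nonneg hh.le, mul_one] at this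
  calc ‖fderiv ℝ f x v‖ = h * ‖fderiv ℝ f x v‖ / h := by field_simp
    _ ≤ (2 * a + b * h ^ 2) / h := by gcongr
    _ = _ := by field_simp

-- Interpolation between the rapidly decaying sup norms and the geometrically growing second
-- derivatives, with step `(r / R) ^ k`.
theorem RapidDecay.fderiv {F : ℕ → E → G} (h0 : RapidDecay F)
    (hF : GeomBounded Set.univ F) : RapidDecay (fun k x => fderiv ℝ (F k) x) := by
  intro r hr
  obtain ⟨R, hR, hb⟩ := hF.fderiv.fderiv.bound 0
  have : 0 < R := one_pos.trans_le hR
  obtain ⟨C, hC, h⟩ := h0 (r * (r / R)) (by positivity)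
  refine ⟨2 * C + R, by positivity, fun k x => ?_⟩
  calc _ ≤ 2 * (C * (r * (r / R)) ^ k) / (r / R) ^ k + R ^ (k + 1) * (r / R) ^ k :=
        norm_fderiv_le_of_bounds (contDiff_infty.1 (hF.smooth k) 2) (by positivity) (h k)
          (fun x => by simpa only [norm_iteratedFDeriv_zero] using hb k x (Set.mem_univ x)) x
    _ = _ := by
        rw [mul_pow, div_pow]
        field_simp
        ring

theorem RapidDecay.iteratedFDeriv {E G : Type u} [NormedAddCommGroup E] [NormedSpace ℝ E]
    [NormedAddCommGroup G] [NormedSpace ℝ G] {F : ℕ → E → G} (h0 : RapidDecay F)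
    (hF : GeomBounded Set.univ F) (m : ℕ) :
    RapidDecay (fun k x => iteratedFDeriv ℝ m (F k) x) := by
  induction m generalizing G with
  | zero =>
    intro r hr
    obtain ⟨C, hC, h⟩ := h0 r hr
    exact ⟨C, hC, fun k x => by simpa only [norm_iteratedFDeriv_zero] using h k x⟩
  | succ m ih =>
    intro r hr
    obtain ⟨C, hC, h⟩ := ih (h0.fderiv hF) hF.fderiv r hr
    exact ⟨C, hC, fun k x => norm_iteratedFDeriv_fderiv.symm.trans_le (h k x)⟩

theorem GeomBounded.contDiff_tsum {E G : Type u} [NormedAddCommGroup E] [NormedSpace ℝ E]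
    [NormedAddCommGroup G] [NormedSpace ℝ G] [CompleteSpace G] {F : ℕ → E → G}
    (hF : GeomBounded Set.univ F) (h0 : RapidDecay F) : ContDiff ℝ ∞ (fun x => ∑' k, F k x) := by
  choose C _ hb using fun m : ℕ => h0.iteratedFDeriv hF m (1 / 2) one_half_pos
  exact _root_.contDiff_tsum (N := ⊤) hF.smooth
    (fun m _ => summable_geometric_two.mul_left (C m)) (fun m k x _ => hb m k x)

end SmoothFamilies

section ParametricIntegrals

variable {E G : Type*} [NormedAddCommGroup E] [NormedSpace ℝ E]
  [NormedAddCommGroup G] [NormedSpace ℝ G]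

theorem norm_iteratedFDeriv_fderiv_comp_inl_le {F : E × ℝ → G} (hF : ContDiff ℝ ∞ F) (m : ℕ)
    (y : E × ℝ) :
    ‖iteratedFDeriv ℝ m (fun y => (fderiv ℝ F y).comp (.inl ℝ E ℝ)) y‖ ≤
      ‖iteratedFDeriv ℝ (m + 1) F y‖ := by
  let L : ((E × ℝ) →L[ℝ] G) →L[ℝ] (E →L[ℝ] G) :=
    (ContinuousLinearMap.compL ℝ E (E × ℝ) G).flip (.inl ℝ E ℝ)
  have hL : ‖L‖ ≤ 1 := L.opNorm_le_bound zero_le_one fun f => by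
    rw [one_mul]
    exact (f.opNorm_comp_le _).trans
      (mul_le_of_le_one_right (norm_nonneg _) (ContinuousLinearMap.norm_inl_le_one ℝ E ℝ))
  have hF' : ContDiff ℝ ∞ (fderiv ℝ F) := hF.fderiv_right (m := ∞) le_rfl
  calc ‖iteratedFDeriv ℝ m (L ∘ fderiv ℝ F) y‖
      ≤ ‖L‖ * ‖iteratedFDeriv ℝ m (fderiv ℝ F) y‖ :=
        L.norm_iteratedFDeriv_comp_left (contDiff_infty.1 hF' m).contDiffAt le_rfl
    _ ≤ 1 * ‖iteratedFDeriv ℝ m (fderiv ℝ F) y‖ := by gcongr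
    _ = _ := by rw [one_mul, norm_iteratedFDeriv_fderiv]

theorem hasFDerivAt_intervalIntegral_of_contDiff [FiniteDimensional ℝ E] {F : E × ℝ → G}
    (hF : ContDiff ℝ 1 F) (a b : ℝ) (x₀ : E) :
    HasFDerivAt (fun x => ∫ t in a..b, F (x, t))
      (∫ t in a..b, (fderiv ℝ F (x₀, t)).comp (.inl ℝ E ℝ)) x₀ := by
  have : ProperSpace E := FiniteDimensional.proper ℝ E
  have hF' : Continuous fun y : E × ℝ => (fderiv ℝ F y).comp (.inl ℝ E ℝ) :=
    (hF.continuous_fderiv one_ne_zero).clm_comp continuous_const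
  obtain ⟨C, hC⟩ := ((isCompact_closedBall x₀ 1).prod (isCompact_uIcc (a := a) (b := b))
    ).exists_bound_of_continuousOn hF'.continuousOn
  have hF_slice (x : E) : Continuous fun t => F (x, t) := hF.continuous.comp (by fun_prop)
  have hF'_slice : Continuous fun t => (fderiv ℝ F (x₀, t)).comp (.inl ℝ E ℝ) :=
    hF'.comp (by fun_prop : Continuous fun t : ℝ => (x₀, t))
  refine (intervalIntegral.hasFDerivAt_integral_of_dominated_of_fderiv_le (𝕜 := ℝ)
    (F := fun x t => F (x, t)) (F' := fun x t => (fderiv ℝ F (x, t)).comp (.inl ℝ E ℝ))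
    (bound := fun _ => C) (closedBall_mem_nhds x₀ one_pos)
    (.of_forall fun x => (hF_slice x).aestronglyMeasurable) ((hF_slice x₀).intervalIntegrable _ _)
    hF'_slice.aestronglyMeasurable
    (.of_forall fun t ht x hx => hC (x, t) ⟨hx, Set.uIoc_subset_uIcc ht⟩)
    intervalIntegrable_const (.of_forall fun t _ x _ => ?_))
  exact (hF.differentiable one_ne_zero (x, t)).hasFDerivAt.comp x (hasFDerivAt_prodMk_left x t)

end ParametricIntegrals

section SmoothParametricIntegrals

universe u

variable {E G : Type u} [NormedAddCommGroup E] [NormedSpace ℝ E] [FiniteDimensional ℝ E]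
  [NormedAddCommGroup G] [NormedSpace ℝ G] [CompleteSpace G]

theorem contDiff_intervalIntegral {F : E × ℝ → G} (hF : ContDiff ℝ ∞ F) (a b : ℝ) :
    ContDiff ℝ ∞ (fun x => ∫ t in a..b, F (x, t)) := by
  refine contDiff_infty.2 fun n => ?_
  induction n generalizing G with
  | zero =>
    exact contDiff_zero.2 (intervalIntegral.continuous_parametric_intervalIntegral_of_continuous'
      (f := fun x t => F (x, t)) hF.continuous a b)
  | succ n ih =>
    have h := hasFDerivAt_intervalIntegral_of_contDiff (contDiff_infty.1 hF 1) a b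
    refine (contDiff_succ_iff_fderiv (n := n)).2 ⟨fun x => (h x).differentiableAt, by simp, ?_⟩
    rw [funext fun x => (h x).fderiv]
    exact ih ((hF.fderiv_right (m := ∞) le_rfl).clm_comp contDiff_const)

theorem norm_iteratedFDeriv_intervalIntegral_le {F : E × ℝ → G} (hF : ContDiff ℝ ∞ F) {a b : ℝ}
    {C : ℝ} (m : ℕ) (x : E) (hC : ∀ t ∈ Set.uIcc a b, ‖iteratedFDeriv ℝ m F (x, t)‖ ≤ C) :
    ‖iteratedFDeriv ℝ m (fun x => ∫ t in a..b, F (x, t)) x‖ ≤ C * |b - a| := by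
  induction m generalizing G with
  | zero =>
    simp only [norm_iteratedFDeriv_zero] at hC ⊢
    exact intervalIntegral.norm_integral_le_of_norm_le_const
      fun t ht => hC t (Set.uIoc_subset_uIcc ht)
  | succ m ih =>
    have h := hasFDerivAt_intervalIntegral_of_contDiff (contDiff_infty.1 hF 1) a b
    rw [← norm_iteratedFDeriv_fderiv, funext fun x => (h x).fderiv]
    have hF' : ContDiff ℝ ∞ fun y => (fderiv ℝ F y).comp (.inl ℝ E ℝ) :=
      (hF.fderiv_right (m := ∞) le_rfl).clm_comp contDiff_const
    have hle := @ih (E →L[ℝ] G) _ _ _ _ hF' fun t ht =>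
      (norm_iteratedFDeriv_fderiv_comp_inl_le hF m (x, t)).trans (hC t ht)
    exact hle

theorem GeomBounded.intervalIntegral {S : Set E} {a b : ℝ} {F : ℕ → E × ℝ → G}
    (hF : GeomBounded (S ×ˢ Set.uIcc a b) F) :
    GeomBounded S (fun k x => ∫ t in a..b, F k (x, t)) := by
  refine ⟨fun k => contDiff_intervalIntegral (hF.smooth k) a b, fun m => ?_⟩
  obtain ⟨R, hR, hb⟩ := hF.bound m
  have h1 : 1 ≤ max |b - a| 1 := le_max_right _ _
  refine ⟨R * max |b - a| 1, one_le_mul_of_one_le_of_one_le hR h1, fun k x hx => ?_⟩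
  calc _ ≤ R ^ (k + 1) * |b - a| :=
        norm_iteratedFDeriv_intervalIntegral_le (hF.smooth k) m x fun t ht => hb k (x, t) ⟨hx, ht⟩
    _ ≤ R ^ (k + 1) * max |b - a| 1 ^ (k + 1) := by
        gcongr
        exact le_pow_succ_of_le h1 (le_max_left _ _) k
    _ = _ := (mul_pow _ _ _).symm

end SmoothParametricIntegrals

section IntegrationByParts

theorem integral_mul_deriv_eq_neg_of_hasCompactSupport {A : Type*} [NormedRing A]
    [NormedAlgebra ℝ A] {u v u' v' : ℝ → A} (hu : ∀ t, HasDerivAt u (u' t) t)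
    (hv : ∀ t, HasDerivAt v (v' t) t) (hu' : Continuous u') (hv' : Continuous v')
    (hs : HasCompactSupport u) : ∫ t, u t * v' t = -∫ t, u' t * v t := by
  have huc : Continuous u := continuous_iff_continuousAt.2 fun t => (hu t).continuousAt
  have hvc : Continuous v := continuous_iff_continuousAt.2 fun t => (hv t).continuousAt
  have hs' : HasCompactSupport u' := (funext fun t => (hu t).deriv : deriv u = u') ▸ hs.deriv
  exact integral_mul_deriv_eq_deriv_mul_of_integrable (fun t _ => hu t) (fun t _ => hv t)
    ((huc.mul hv').integrable_of_hasCompactSupport hs.mul_right)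
    ((hu'.mul hvc).integrable_of_hasCompactSupport hs'.mul_right)
    ((huc.mul hvc).integrable_of_hasCompactSupport hs.mul_right)

theorem norm_integral_le_of_eq_zero_outside_Icc {G : Type*} [NormedAddCommGroup G]
    [NormedSpace ℝ G] {g : ℝ → G} {a b C : ℝ} (hab : a ≤ b) (h0 : ∀ t ∉ Set.Icc a b, g t = 0)
    (hC : ∀ t ∈ Set.Icc a b, ‖g t‖ ≤ C) : ‖∫ t, g t‖ ≤ C * (b - a) := by
  rw [← setIntegral_eq_integral_of_forall_compl_eq_zero h0, ← Real.volume_real_Icc_of_le hab]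
  exact norm_setIntegral_le_of_norm_le_const measure_Icc_lt_top hC

end IntegrationByParts

section Symbols

variable {ι : Type*} {q p : ι → ℝ}

/-- A family of smooth functions on `[-1, 1]` whose `m`-th derivatives are of size `q ^ (l + m)`,
uniformly in the index: every derivative costs a factor `q`. -/
structure SymbolBounded (q : ι → ℝ) (l : ℕ) (a : ι → ℝ → ℝ) : Prop where
  smooth : ∀ i, ContDiff ℝ ∞ (a i)
  bound : ∀ m : ℕ, ∃ C : ℝ, ∀ i, ∀ t ∈ Set.Icc (-1 : ℝ) 1,
    ‖iteratedFDeriv ℝ m (a i) t‖ ≤ C * q i ^ (l + m)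

namespace SymbolBounded

theorem mul {l l' : ℕ} {a a' : ι → ℝ → ℝ} (ha : SymbolBounded q l a)
    (ha' : SymbolBounded q l' a') : SymbolBounded q (l + l') (fun i t => a i t * a' i t) := by
  refine ⟨fun i => (ha.smooth i).mul (ha'.smooth i), fun m => ?_⟩
  choose C hC using ha.bound
  choose D hD using ha'.bound
  refine ⟨∑ j ∈ Finset.range (m + 1), (m.choose j : ℝ) * C j * D (m - j), fun i t ht => ?_⟩
  calc ‖iteratedFDeriv ℝ m (fun t => a i t * a' i t) t‖
      ≤ ∑ j ∈ Finset.range (m + 1), (m.choose j : ℝ) * ‖iteratedFDeriv ℝ j (a i) t‖ *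
          ‖iteratedFDeriv ℝ (m - j) (a' i) t‖ :=
        norm_iteratedFDeriv_mul_le (contDiff_infty.1 (ha.smooth i) m)
          (contDiff_infty.1 (ha'.smooth i) m) t le_rfl
    _ ≤ ∑ j ∈ Finset.range (m + 1), (m.choose j : ℝ) * C j * D (m - j) *
          q i ^ (l + l' + m) := by
        refine Finset.sum_le_sum fun j hj => ?_
        have hle : j ≤ m := Finset.mem_range_succ_iff.1 hj
        have hC0 := (norm_nonneg _).trans (hC j i t ht)
        calc _ ≤ (m.choose j : ℝ) * (C j * q i ^ (l + j)) * (D (m - j) * q i ^ (l' + (m - j))) := by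
              gcongr
              · exact hC j i t ht
              · exact hD (m - j) i t ht
          _ = (m.choose j : ℝ) * C j * D (m - j) * q i ^ (l + j + (l' + (m - j))) := by ring
          _ = _ := by congr 2; omega
    _ = _ := (Finset.sum_mul _ _ _).symm

theorem deriv {l : ℕ} {a : ι → ℝ → ℝ} (ha : SymbolBounded q l a) :
    SymbolBounded q (l + 1) (fun i => deriv (a i)) := by
  refine ⟨fun i => (contDiff_infty_iff_deriv.1 (ha.smooth i)).2, fun m => ?_⟩
  obtain ⟨C, hC⟩ := ha.bound (m + 1)
  refine ⟨C, fun i t ht => ?_⟩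
  rw [norm_iteratedFDeriv_eq_norm_iteratedDeriv, ← iteratedDeriv_succ',
    ← norm_iteratedFDeriv_eq_norm_iteratedDeriv, add_assoc, add_comm 1 m]
  exact hC i t ht

theorem sq_add_sq (hq : ∀ i, 1 ≤ q i) (hp : ∀ i, |p i| ≤ 1) :
    SymbolBounded q 0 (fun i t => t ^ 2 + p i ^ 2) := by
  refine ⟨fun i => (contDiff_id.pow 2).add contDiff_const, fun m => ⟨2 ^ m + 1, fun i t ht => ?_⟩⟩
  have hpow : ‖iteratedFDeriv ℝ m (fun t : ℝ => t ^ 2) t‖ ≤ 2 ^ m := by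
    exact_mod_cast norm_iteratedFDeriv_pow_le (𝕜 := ℝ) m 2 (abs_le.2 ht)
  have hsq : ContDiff ℝ m fun t : ℝ => t ^ 2 := contDiff_id.pow 2
  have hconst : ‖iteratedFDeriv ℝ m (fun _ : ℝ => p i ^ 2) t‖ ≤ 1 := by
    cases m with
    | zero => simpa only [norm_iteratedFDeriv_zero, norm_pow, Real.norm_eq_abs] using
        pow_le_one₀ (abs_nonneg _) (hp i)
    | succ m => simp [iteratedFDeriv_const_of_ne]
  calc ‖iteratedFDeriv ℝ m ((fun t : ℝ => t ^ 2) + fun _ => p i ^ 2) t‖ ≤ 2 ^ m + 1 := by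
        rw [iteratedFDeriv_add_apply hsq.contDiffAt contDiffAt_const]
        exact (norm_add_le _ _).trans (add_le_add hpow hconst)
    _ ≤ (2 ^ m + 1) * q i ^ (0 + m) :=
        le_mul_of_one_le_right (by positivity) (one_le_pow₀ (hq i))

end SymbolBounded

/-- The transpose, up to sign, of the operator `(t² + p²) d/dt`, of which every power of
`lineAngle p` is an eigenfunction. -/
noncomputable def transport (p : ℝ) (a : ℝ → ℝ) : ℝ → ℝ := deriv fun t => a t * (t ^ 2 + p ^ 2)

theorem contDiff_transport (p : ℝ) {a : ℝ → ℝ} (ha : ContDiff ℝ ∞ a) :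
    ContDiff ℝ ∞ (transport p a) :=
  (contDiff_infty_iff_deriv.1 (ha.mul ((contDiff_id.pow 2).add contDiff_const))).2

theorem tsupport_transport_subset (p : ℝ) (a : ℝ → ℝ) : tsupport (transport p a) ⊆ tsupport a :=
  tsupport_deriv_subset.trans tsupport_mul_subset_left

theorem tsupport_iterate_transport_subset (p : ℝ) (a : ℝ → ℝ) (M : ℕ) :
    tsupport ((transport p)^[M] a) ⊆ tsupport a := by
  induction M with
  | zero => rfl
  | succ M ih =>
    rw [Function.iterate_succ_apply']
    exact (tsupport_transport_subset p _).trans ih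

theorem SymbolBounded.iterate_transport {l : ℕ} {a : ι → ℝ → ℝ} (ha : SymbolBounded q l a)
    (hq : ∀ i, 1 ≤ q i) (hp : ∀ i, |p i| ≤ 1) (M : ℕ) :
    SymbolBounded q (l + M) (fun i => (transport (p i))^[M] (a i)) := by
  induction M with
  | zero => exact ha
  | succ M ih =>
    simp only [Function.iterate_succ_apply']
    exact (ih.mul (.sq_add_sq hq hp)).deriv

/-- The profile `Ψ`, scaled by `q`, in the variable `1 - r²`, along the line at height `p`. -/
def scaledProfile (Ψ : ℝ → ℝ) (q p t : ℝ) : ℝ := Ψ (q * (1 - p ^ 2 - t ^ 2))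

variable {Ψ : ℝ → ℝ}

theorem contDiff_scaledProfile (hΨ : ContDiff ℝ ∞ Ψ) (q p : ℝ) :
    ContDiff ℝ ∞ (scaledProfile Ψ q p) :=
  hΨ.comp (contDiff_const.mul (contDiff_const.sub (contDiff_id.pow 2)))

theorem scaledProfile_eq_zero (hs : Function.support Ψ ⊆ Set.Ioo 1 2) {q p t : ℝ} (hq : 0 ≤ q)
    (ht : 1 ≤ p ^ 2 + t ^ 2) : scaledProfile Ψ q p t = 0 := by
  refine Function.notMem_support.1 fun h => (hs h).1.not_ge ?_
  exact (mul_nonpos_of_nonneg_of_nonpos hq (by linarith)).trans zero_le_one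

theorem tsupport_scaledProfile_subset (hs : Function.support Ψ ⊆ Set.Ioo 1 2) {q : ℝ} (hq : 0 ≤ q)
    (p : ℝ) : tsupport (scaledProfile Ψ q p) ⊆ Set.Icc (-1) 1 := by
  refine closure_minimal (fun t ht => abs_le.1 ?_) isClosed_Icc
  by_contra! h
  refine ht (scaledProfile_eq_zero hs hq ?_)
  linarith [sq_nonneg p, (one_lt_sq_iff_one_lt_abs t).2 h]

theorem hasCompactSupport_scaledProfile (hs : Function.support Ψ ⊆ Set.Ioo 1 2) {q : ℝ}
    (hq : 0 ≤ q) (p : ℝ) : HasCompactSupport (scaledProfile Ψ q p) :=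
  isCompact_Icc.of_isClosed_subset (isClosed_tsupport _) (tsupport_scaledProfile_subset hs hq p)

theorem norm_iteratedFDeriv_mul_sub_sq_le {q t : ℝ} (hq : 1 ≤ q) (ht : |t| ≤ 1) (c : ℝ) {m : ℕ}
    (hm : 1 ≤ m) : ‖iteratedFDeriv ℝ m (fun t => q * (c - t ^ 2)) t‖ ≤ (2 * q) ^ m := by
  have hpow : ‖iteratedFDeriv ℝ m (fun t : ℝ => t ^ 2) t‖ ≤ 2 ^ m := by
    exact_mod_cast norm_iteratedFDeriv_pow_le (𝕜 := ℝ) m 2 ht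
  have hsub : ContDiff ℝ ∞ fun t : ℝ => c - t ^ 2 := contDiff_const.sub (contDiff_id.pow 2)
  rw [norm_iteratedFDeriv_const_mul hsub,
    norm_iteratedFDeriv_eq_norm_iteratedDeriv, iteratedDeriv_const_sub hm, iteratedDeriv_neg,
    norm_neg, ← norm_iteratedFDeriv_eq_norm_iteratedDeriv, abs_of_nonneg (zero_le_one.trans hq),
    mul_pow, mul_comm]
  gcongr
  exact le_self_pow₀ hq (Nat.one_le_iff_ne_zero.1 hm)

theorem SymbolBounded.scaledProfile (hΨ : ContDiff ℝ ∞ Ψ) (hs : HasCompactSupport Ψ)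
    (hq : ∀ i, 1 ≤ q i) (p : ι → ℝ) :
    SymbolBounded q 0 (fun i => scaledProfile Ψ (q i) (p i)) := by
  refine ⟨fun i => contDiff_scaledProfile hΨ _ _, fun m => ?_⟩
  obtain ⟨R, -, hR⟩ := (GeomBounded.const_of_hasCompactSupport hΨ hs).exists_uniform_bound m
  refine ⟨m.factorial * R * 2 ^ m, fun i t ht => ?_⟩
  calc ‖iteratedFDeriv ℝ m (Ψ ∘ fun t => q i * (1 - p i ^ 2 - t ^ 2)) t‖
      ≤ m.factorial * R ^ (0 + 1) * (2 * q i) ^ m :=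
        norm_iteratedFDeriv_comp_le (contDiff_infty.1 hΨ m)
          (contDiff_const.mul (contDiff_const.sub (contDiff_id.pow 2))) le_rfl t
          (fun j hj => hR j hj 0 _ (Set.mem_univ _))
          fun j hj _ => norm_iteratedFDeriv_mul_sub_sq_le (hq i) (abs_le.2 ht) _ hj
    _ = _ := by ring

end Symbols

section LineAngle

/-- The unimodular function `e^{2iφ}`, where `φ` is the polar angle, along the horizontal line at
height `p`. -/
noncomputable def lineAngle (p t : ℝ) : ℂ := (t + p * Complex.I) / (t - p * Complex.I)

theorem sub_mul_I_ne_zero {p : ℝ} (hp : p ≠ 0) (t : ℝ) : (t : ℂ) - p * Complex.I ≠ 0 :=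
  fun h => hp (by simpa using congrArg Complex.im h)

theorem norm_lineAngle {p : ℝ} (hp : p ≠ 0) (t : ℝ) : ‖lineAngle p t‖ = 1 := by
  have h : (t : ℂ) + p * Complex.I = (starRingEnd ℂ) (t - p * Complex.I) := by
    apply Complex.ext <;> simp
  rw [lineAngle, norm_div, h, Complex.norm_conj,
    div_self (norm_ne_zero_iff.2 (sub_mul_I_ne_zero hp t))]

theorem add_mul_I_mul_sub (p t : ℝ) :
    ((t : ℂ) + p * Complex.I) * (t - p * Complex.I) = (t ^ 2 + p ^ 2 : ℝ) := by
  push_cast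
  linear_combination (-(p : ℂ) ^ 2) * Complex.I_sq

theorem hasDerivAt_lineAngle_pow {p : ℝ} (hp : p ≠ 0) (n : ℕ) (t : ℝ) :
    HasDerivAt (fun t => lineAngle p t ^ n)
      (-(2 * n * p * Complex.I) * lineAngle p t ^ n / (t ^ 2 + p ^ 2 : ℝ)) t := by
  have hne := sub_mul_I_ne_zero hp t
  have hne' : (t : ℂ) + p * Complex.I ≠ 0 := by
    simpa using sub_mul_I_ne_zero (neg_ne_zero.2 hp) t
  have hid : HasDerivAt (fun t : ℝ => (t : ℂ)) 1 t := Complex.ofRealCLM.hasDerivAt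
  have hquot : HasDerivAt (lineAngle p) _ t :=
    (hid.add_const (p * Complex.I)).div (hid.sub_const (p * Complex.I)) hne
  rw [← add_mul_I_mul_sub]
  refine (hquot.pow n).congr_deriv ?_
  cases n with
  | zero => simp
  | succ n =>
    simp only [lineAngle, Nat.add_sub_cancel, pow_succ]
    field_simp
    ring

theorem continuous_lineAngle_pow {p : ℝ} (hp : p ≠ 0) (n : ℕ) :
    Continuous fun t => lineAngle p t ^ n :=
  continuous_iff_continuousAt.2 fun t => (hasDerivAt_lineAngle_pow hp n t).continuousAt

theorem integral_mul_lineAngle_pow {p : ℝ} (hp : p ≠ 0) (n : ℕ) {a : ℝ → ℝ}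
    (ha : ContDiff ℝ ∞ a) (hs : HasCompactSupport a) :
    2 * n * p * Complex.I * ∫ t, (a t : ℂ) * lineAngle p t ^ n =
      ∫ t, (transport p a t : ℂ) * lineAngle p t ^ n := by
  have hpos (t : ℝ) : ((t ^ 2 + p ^ 2 : ℝ) : ℂ) ≠ 0 := by
    exact_mod_cast (by positivity : t ^ 2 + p ^ 2 ≠ 0)
  have hc := continuous_lineAngle_pow hp n
  have hsmooth : ContDiff ℝ ∞ fun t => a t * (t ^ 2 + p ^ 2) :=
    ha.mul ((contDiff_id.pow 2).add contDiff_const)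
  have hparts := integral_mul_deriv_eq_neg_of_hasCompactSupport
    (fun t => (hsmooth.differentiable (by simp) t).hasDerivAt.ofReal_comp)
    (hasDerivAt_lineAngle_pow hp n)
    (Complex.continuous_ofReal.comp (contDiff_transport p ha).continuous)
    ((continuous_const.mul hc).div (by fun_prop) hpos)
    ((hs.mul_right (f' := fun t => t ^ 2 + p ^ 2)).comp_left Complex.ofReal_zero)
  rw [← neg_inj]
  refine Eq.trans ?_ hparts
  rw [← integral_const_mul, ← integral_neg]
  congr 1 with t
  have := hpos t
  push_cast at this ⊢
  field_simp

theorem norm_integral_mul_lineAngle_pow_le {p : ℝ} (hp : 1 / 2 ≤ |p|) {n : ℕ} (hn : 1 ≤ n)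
    {a : ℝ → ℝ} (ha : ContDiff ℝ ∞ a) (hs : HasCompactSupport a) :
    ‖∫ t, (a t : ℂ) * lineAngle p t ^ n‖ ≤
      (1 / n) * ‖∫ t, (transport p a t : ℂ) * lineAngle p t ^ n‖ := by
  have : (0 : ℝ) < n := by exact_mod_cast hn
  have hp0 : p ≠ 0 := abs_pos.1 (by linarith)
  rw [← integral_mul_lineAngle_pow hp0 n ha hs]
  simp only [norm_mul, Complex.norm_I, mul_one, Complex.norm_ofNat, Complex.norm_natCast,
    Complex.norm_real, Real.norm_eq_abs]
  rw [← mul_assoc]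
  refine le_mul_of_one_le_left (norm_nonneg _) ?_
  rw [show 1 / (n : ℝ) * (2 * n * |p|) = 2 * |p| by field_simp]
  linarith

theorem norm_integral_mul_lineAngle_pow_le_iterate {p : ℝ} (hp : 1 / 2 ≤ |p|) {n : ℕ} (hn : 1 ≤ n)
    (M : ℕ) {a : ℝ → ℝ} (ha : ContDiff ℝ ∞ a) (hs : HasCompactSupport a) :
    ‖∫ t, (a t : ℂ) * lineAngle p t ^ n‖ ≤
      (1 / n) ^ M * ‖∫ t, ((transport p)^[M] a t : ℂ) * lineAngle p t ^ n‖ := by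
  induction M generalizing a with
  | zero => simp
  | succ M ih =>
    have hs' : HasCompactSupport (transport p a) :=
      hs.of_isClosed_subset (isClosed_tsupport _) (tsupport_transport_subset p a)
    rw [Function.iterate_succ_apply, pow_succ', mul_assoc]
    exact (norm_integral_mul_lineAngle_pow_le hp hn ha hs).trans
      (by gcongr; exact ih (contDiff_transport p ha) hs')

theorem exists_norm_integral_scaledProfile_lineAngle_le {Ψ : ℝ → ℝ} (hΨ : ContDiff ℝ ∞ Ψ)
    (hs : Function.support Ψ ⊆ Set.Ioo 1 2) (M : ℕ) :
    ∃ C : ℝ, 0 ≤ C ∧ ∀ (q p : ℝ) (n : ℕ), 1 ≤ q → 1 / 2 ≤ |p| → 1 ≤ n →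
      ‖∫ t, (scaledProfile Ψ q p t : ℂ) * lineAngle p t ^ n‖ ≤ C * (q / n) ^ M := by
  have hcs : HasCompactSupport Ψ := .of_support_subset_isCompact isCompact_Icc
    (hs.trans Set.Ioo_subset_Icc_self)
  obtain ⟨C, hC⟩ := ((SymbolBounded.scaledProfile hΨ hcs (q := fun i : {x : ℝ × ℝ //
    1 ≤ x.1 ∧ |x.2| ≤ 1} => i.1.1) (fun i => i.2.1) fun i => i.1.2).iterate_transport
      (fun i => i.2.1) (fun i => i.2.2) M).bound 0
  refine ⟨|C| * 2, by positivity, fun q p n hq hp hn => ?_⟩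
  have hq0 : 0 ≤ q := zero_le_one.trans hq
  rcases le_or_gt |p| 1 with hp1 | hp1
  · have hp0 : p ≠ 0 := abs_pos.1 (by linarith)
    have hsub := (tsupport_iterate_transport_subset p _ M).trans
      (tsupport_scaledProfile_subset hs hq0 p)
    have hint : ‖∫ t, ((transport p)^[M] (scaledProfile Ψ q p) t : ℂ) * lineAngle p t ^ n‖ ≤
        |C| * q ^ M * (1 - -1) := by
      refine norm_integral_le_of_eq_zero_outside_Icc (by norm_num) (fun t ht => ?_) fun t ht => ?_
      · rw [image_eq_zero_of_notMem_tsupport fun h => ht (hsub h), Complex.ofReal_zero, zero_mul]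
      · rw [norm_mul, norm_pow, norm_lineAngle hp0, one_pow, mul_one, Complex.norm_real,
          ← norm_iteratedFDeriv_zero (𝕜 := ℝ)]
        refine (hC ⟨(q, p), hq, hp1⟩ t ht).trans ?_
        simp only [zero_add, add_zero]
        gcongr
        exact le_abs_self C
    calc _ ≤ (1 / n : ℝ) ^ M * (|C| * q ^ M * (1 - -1)) :=
          (norm_integral_mul_lineAngle_pow_le_iterate hp hn M (contDiff_scaledProfile hΨ q p)
            (hasCompactSupport_scaledProfile hs hq0 p)).trans (by gcongr)
      _ = _ := by rw [div_pow, div_pow, one_pow]; ring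
  · have hzero (t : ℝ) : scaledProfile Ψ q p t = 0 := scaledProfile_eq_zero hs hq0
      (by linarith [sq_nonneg t, (one_lt_sq_iff_one_lt_abs p).2 hp1])
    simp only [hzero, Complex.ofReal_zero, zero_mul, integral_zero, norm_zero]
    positivity

end LineAngle

section Chirp

/-- The chirp `e^{iKt²}`. -/
noncomputable def chirp (K t : ℝ) : ℂ := Complex.exp ((K * t ^ 2 : ℝ) * Complex.I)

/-- The factor `D = 1 + 2iKt²` in `(t e^{iKt²})' = D e^{iKt²}`. Integrating by parts after dividing
by `D`, which has no zeros, does not lose anything at the stationary point `t = 0`. -/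
noncomputable def chirpFactor (K t : ℝ) : ℂ := 1 + (2 * K * t ^ 2 : ℝ) * Complex.I

theorem norm_chirp (K t : ℝ) : ‖chirp K t‖ = 1 := Complex.norm_exp_ofReal_mul_I _

theorem norm_sq_chirpFactor (K t : ℝ) : ‖chirpFactor K t‖ ^ 2 = 1 + (2 * K * t ^ 2) ^ 2 := by
  rw [← Complex.normSq_eq_norm_sq, Complex.normSq_apply, chirpFactor]
  simp only [Complex.add_re, Complex.add_im, Complex.one_re, Complex.one_im, Complex.re_ofReal_mul,
    Complex.im_ofReal_mul, Complex.I_re, Complex.I_im]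
  ring

theorem chirpFactor_ne_zero (K t : ℝ) : chirpFactor K t ≠ 0 :=
  norm_ne_zero_iff.1 fun h => by nlinarith [norm_sq_chirpFactor K t]

theorem hasDerivAt_ofReal_mul_sq (c t : ℝ) :
    HasDerivAt (fun t : ℝ => ((c * t ^ 2 : ℝ) : ℂ) * Complex.I)
      ((2 * c * t : ℝ) * Complex.I) t := by
  have h : HasDerivAt (fun t : ℝ => c * t ^ 2) (2 * c * t) t :=
    ((hasDerivAt_pow 2 t).const_mul c).congr_deriv (by push_cast; ring)
  exact h.ofReal_comp.mul_const _

theorem hasDerivAt_mul_chirp (K t : ℝ) :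
    HasDerivAt (fun t : ℝ => (t : ℂ) * chirp K t) (chirpFactor K t * chirp K t) t := by
  have hid : HasDerivAt (fun t : ℝ => (t : ℂ)) 1 t := Complex.ofRealCLM.hasDerivAt
  refine (hid.mul (hasDerivAt_ofReal_mul_sq K t).cexp).congr_deriv ?_
  simp only [chirp, chirpFactor]
  push_cast
  ring

theorem hasDerivAt_div_chirpFactor (K : ℝ) {a : ℝ → ℝ} {a' t : ℝ} (ha : HasDerivAt a a' t) :
    HasDerivAt (fun t => (a t : ℂ) / chirpFactor K t)
      (a' / chirpFactor K t - a t * (4 * K * t : ℝ) * Complex.I / chirpFactor K t ^ 2) t := by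
  have hne := chirpFactor_ne_zero K t
  have hD : HasDerivAt (chirpFactor K) _ t := (hasDerivAt_ofReal_mul_sq (2 * K) t).const_add 1
  refine (ha.ofReal_comp.div hD hne).congr_deriv ?_
  push_cast
  field_simp
  ring

theorem continuous_chirpFactor (K : ℝ) : Continuous (chirpFactor K) := by
  unfold chirpFactor
  fun_prop

theorem continuous_chirp (K : ℝ) : Continuous (chirp K) := by
  unfold chirp
  fun_prop

theorem integral_mul_chirp {a : ℝ → ℝ} (ha : ContDiff ℝ ∞ a) (hs : HasCompactSupport a) (K : ℝ) :
    ∫ t, (a t : ℂ) * chirp K t =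
      -∫ t, (deriv a t / chirpFactor K t -
        a t * (4 * K * t : ℝ) * Complex.I / chirpFactor K t ^ 2) * (t * chirp K t) := by
  have hD := continuous_chirpFactor K
  have hne := chirpFactor_ne_zero K
  have ha' : Continuous (deriv a) := ha.continuous_deriv (by simp)
  have hac := ha.continuous
  have hu' : Continuous fun t => (deriv a t / chirpFactor K t -
      a t * (4 * K * t : ℝ) * Complex.I / chirpFactor K t ^ 2 : ℂ) :=
    (Continuous.div (by fun_prop) hD hne).sub
      (Continuous.div (by fun_prop) (by fun_prop) fun t => pow_ne_zero 2 (hne t))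
  have hus : HasCompactSupport fun t => (a t / chirpFactor K t : ℂ) :=
    hs.mono fun t ht h0 => ht (by simp [h0])
  rw [← integral_mul_deriv_eq_neg_of_hasCompactSupport
    (fun t => hasDerivAt_div_chirpFactor K (ha.differentiable (by simp) t).hasDerivAt)
    (hasDerivAt_mul_chirp K) hu' (hD.mul (continuous_chirp K)) hus]
  congr 1 with t
  rw [← mul_assoc, div_mul_cancel₀ _ (hne t)]

theorem norm_mul_chirp_remainder_le {K A A' a a' t : ℝ} (hK : 0 < K) (ha : |a| ≤ A)
    (ha' : |a'| ≤ A') :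
    ‖(a' / chirpFactor K t - a * (4 * K * t : ℝ) * Complex.I / chirpFactor K t ^ 2) *
        (t * chirp K t)‖ ≤ A' / (2 * √K) + 4 * A * (1 + (√(2 * K) * t) ^ 2)⁻¹ := by
  have hD0 : 0 < ‖chirpFactor K t‖ := norm_pos_iff.2 (chirpFactor_ne_zero K t)
  have hD := norm_sq_chirpFactor K t
  have hA0 : 0 ≤ A := (abs_nonneg a).trans ha
  have := Real.sqrt_pos.2 hK
  have hfirst : ‖a' / chirpFactor K t * (t * chirp K t)‖ ≤ A' / (2 * √K) := by
    have hDt : 2 * √K * |t| ≤ ‖chirpFactor K t‖ := by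
      refine le_of_sq_le_sq ?_ hD0.le
      rw [hD, mul_pow, mul_pow, Real.sq_sqrt hK.le, sq_abs]
      linarith [sq_nonneg (1 - 2 * K * t ^ 2)]
    rw [norm_mul, norm_mul, norm_div, norm_chirp, mul_one, Complex.norm_real, Complex.norm_real,
      Real.norm_eq_abs, Real.norm_eq_abs, div_mul_eq_mul_div, div_le_div_iff₀ hD0 (by positivity)]
    calc |a'| * |t| * (2 * √K) = |a'| * (2 * √K * |t|) := by ring
      _ ≤ A' * ‖chirpFactor K t‖ := by gcongr; exact (abs_nonneg _).trans ha'
  have hsecond : ‖a * (4 * K * t : ℝ) * Complex.I / chirpFactor K t ^ 2 * (t * chirp K t)‖ ≤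
      4 * A * (1 + (√(2 * K) * t) ^ 2)⁻¹ := by
    have hy : 0 ≤ 2 * K * t ^ 2 := by positivity
    have heq : ‖a * (4 * K * t : ℝ) * Complex.I / chirpFactor K t ^ 2 * (t * chirp K t)‖ =
        |a| * (2 * (2 * K * t ^ 2)) / (1 + (2 * K * t ^ 2) ^ 2) := by
      simp only [norm_mul, norm_div, norm_pow, norm_chirp, Complex.norm_real, Complex.norm_I,
        Real.norm_eq_abs, hD, abs_of_pos hK, Nat.abs_ofNat]
      rw [← sq_abs t]
      ring
    rw [heq, mul_pow _ t, Real.sq_sqrt (by positivity), ← div_eq_mul_inv,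
      div_le_div_iff₀ (by positivity) (by positivity)]
    generalize 2 * K * t ^ 2 = y at hy
    calc |a| * (2 * y) * (1 + y) ≤ A * (2 * y) * (1 + y) := by gcongr
      _ ≤ 4 * A * (1 + y ^ 2) := by nlinarith [mul_nonneg hA0 (sq_nonneg (y - 1))]
  rw [sub_mul]
  exact (norm_sub_le _ _).trans (add_le_add hfirst hsecond)

theorem integral_inv_one_add_mul_sq {k : ℝ} (hk : 0 < k) :
    ∫ t : ℝ, (1 + (k * t) ^ 2)⁻¹ = Real.pi / k := by
  rw [Measure.integral_comp_mul_left (fun t : ℝ => (1 + t ^ 2)⁻¹), integral_univ_inv_one_add_sq,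
    abs_of_pos (inv_pos.2 hk), smul_eq_mul, inv_mul_eq_div]

theorem norm_integral_mul_chirp_le {a : ℝ → ℝ} (ha : ContDiff ℝ ∞ a)
    (hs : tsupport a ⊆ Set.Icc (-1) 1) {A A' K : ℝ} (hK : 0 < K)
    (hA : ∀ t ∈ Set.Icc (-1 : ℝ) 1, |a t| ≤ A) (hA' : ∀ t ∈ Set.Icc (-1 : ℝ) 1, |deriv a t| ≤ A') :
    ‖∫ t, (a t : ℂ) * chirp K t‖ ≤ (A' + 4 * A * Real.pi) / √K := by
  have hcs : HasCompactSupport a := isCompact_Icc.of_isClosed_subset (isClosed_tsupport _) hs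
  have hA0 : 0 ≤ A := (abs_nonneg _).trans (hA 0 (by norm_num))
  have hk : 0 < √(2 * K) := Real.sqrt_pos.2 (by positivity)
  have hKk : √K ≤ √(2 * K) := Real.sqrt_le_sqrt (by linarith)
  have hint : Integrable fun t : ℝ => 4 * A * (1 + (√(2 * K) * t) ^ 2)⁻¹ :=
    (integrable_inv_one_add_sq.comp_mul_left' hk.ne').const_mul _
  rw [integral_mul_chirp ha hcs, norm_neg,
    ← setIntegral_eq_integral_of_forall_compl_eq_zero (s := Set.Icc (-1) 1)]
  · calc _ ≤ ∫ t in Set.Icc (-1 : ℝ) 1, (A' / (2 * √K) + 4 * A * (1 + (√(2 * K) * t) ^ 2)⁻¹) :=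
          norm_integral_le_of_norm_le ((integrable_const _).add hint.integrableOn)
            ((ae_restrict_mem measurableSet_Icc).mono fun t ht =>
              norm_mul_chirp_remainder_le hK (hA t ht) (hA' t ht))
      _ ≤ A' / √K + ∫ t, 4 * A * (1 + (√(2 * K) * t) ^ 2)⁻¹ := by
          rw [integral_add (integrable_const _) hint.integrableOn]
          refine add_le_add (le_of_eq ?_)
            (setIntegral_le_integral hint (.of_forall fun t => by positivity))
          rw [setIntegral_const, Real.volume_real_Icc_of_le (by norm_num), smul_eq_mul]
          field_simp
          ring
      _ ≤ A' / √K + 4 * A * Real.pi / √K := by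
          rw [integral_const_mul, integral_inv_one_add_mul_sq hk, ← mul_div_assoc]
          gcongr
      _ = _ := (add_div _ _ _).symm
  · intro t ht
    have hz : a t = 0 := image_eq_zero_of_notMem_tsupport fun h => ht (hs h)
    have hz' : deriv a t = 0 :=
      image_eq_zero_of_notMem_tsupport fun h => ht (hs (tsupport_deriv_subset h))
    simp [hz, hz']

theorem exists_norm_integral_scaledProfile_chirp_le {Ψ : ℝ → ℝ} (hΨ : ContDiff ℝ ∞ Ψ)
    (hs : Function.support Ψ ⊆ Set.Ioo 1 2) :
    ∃ C : ℝ, ∀ K p : ℝ, 0 < K → ‖∫ t, (scaledProfile Ψ 2 p t : ℂ) * chirp K t‖ ≤ C / √K := by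
  have hcs : HasCompactSupport Ψ := .of_support_subset_isCompact isCompact_Icc
    (hs.trans Set.Ioo_subset_Icc_self)
  have hsymb : SymbolBounded (fun _ : ℝ => 2) 0 fun p => scaledProfile Ψ 2 p :=
    .scaledProfile hΨ hcs (fun _ => one_le_two) id
  obtain ⟨A, hA⟩ := hsymb.bound 0
  obtain ⟨A', hA'⟩ := hsymb.bound 1
  refine ⟨A' * 2 ^ (0 + 1) + 4 * (A * 2 ^ (0 + 0)) * Real.pi, fun K p hK =>
    norm_integral_mul_chirp_le (contDiff_scaledProfile hΨ 2 p)
      (tsupport_scaledProfile_subset hs zero_le_two p) hK (fun t ht => ?_) fun t ht => ?_⟩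
  · simpa only [norm_iteratedFDeriv_zero, Real.norm_eq_abs] using hA p t ht
  · simpa only [norm_iteratedFDeriv_one, ← norm_deriv_eq_norm_fderiv, Real.norm_eq_abs] using
      hA' p t ht

end Chirp

section LowerBound

theorem integral_scaledProfile (Ψ : ℝ → ℝ) {q : ℝ} (hq : 0 ≤ q) (p : ℝ) :
    ∫ t, scaledProfile Ψ q p t = (√q)⁻¹ * ∫ u, Ψ (q * (1 - p ^ 2) - u ^ 2) := by
  have hscale (t : ℝ) :
      scaledProfile Ψ q p t = (fun u => Ψ (q * (1 - p ^ 2) - u ^ 2)) (√q * t) := by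
    simp only [scaledProfile, mul_pow, Real.sq_sqrt hq]
    congr 1
    ring
  simp_rw [hscale]
  rw [Measure.integral_comp_mul_left fun u => Ψ (q * (1 - p ^ 2) - u ^ 2),
    abs_of_nonneg (inv_nonneg.2 (Real.sqrt_nonneg q)), smul_eq_mul]

theorem integral_comp_sub_sq {Ψ : ℝ → ℝ} (hs : Function.support Ψ ⊆ Set.Ioo 1 2) {s : ℝ}
    (h3 : s ≤ 3) : ∫ u, Ψ (s - u ^ 2) = ∫ u in (-2 : ℝ)..2, Ψ (s - u ^ 2) := by
  rw [intervalIntegral.integral_of_le (by norm_num),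
    setIntegral_eq_integral_of_forall_compl_eq_zero]
  intro u hu
  refine Function.notMem_support.1 fun h => hu ?_
  obtain ⟨h1, h2⟩ := abs_lt.1 <| abs_lt_of_sq_lt_sq
    (by linarith [(hs h).1] : u ^ 2 < 2 ^ 2) (by norm_num)
  exact ⟨h1, h2.le⟩

theorem exists_integral_comp_sub_sq_ge {Ψ : ℝ → ℝ} (hΨ : Continuous Ψ)
    (hs : Function.support Ψ = Set.Ioo 1 2) (h0 : ∀ s, 0 ≤ Ψ s) :
    ∃ c : ℝ, 0 < c ∧ ∀ s ∈ Set.Icc (5 / 4 : ℝ) 3, c ≤ ∫ u, Ψ (s - u ^ 2) := by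
  have hcont : Continuous fun s : ℝ => ∫ u in (-2 : ℝ)..2, Ψ (s - u ^ 2) :=
    intervalIntegral.continuous_parametric_intervalIntegral_of_continuous'
      (f := fun s u => Ψ (s - u ^ 2)) (by fun_prop) _ _
  have hpos : ∀ s ∈ Set.Icc (5 / 4 : ℝ) 3, 0 < ∫ u in (-2 : ℝ)..2, Ψ (s - u ^ 2) := by
    intro s hs'
    refine intervalIntegral.integral_pos (by norm_num) (by fun_prop) (fun u _ => h0 _)
      ⟨√(s - 9 / 8), ⟨by linarith [Real.sqrt_nonneg (s - 9 / 8)], ?_⟩, ?_⟩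
    · rw [Real.sqrt_le_left (by norm_num)]
      linarith [hs'.2]
    · rw [Real.sq_sqrt (by linarith [hs'.1])]
      exact (h0 _).lt_of_ne' (Function.mem_support.1 (hs ▸ ⟨by linarith, by linarith⟩))
  obtain ⟨s₀, hs₀, hmin⟩ := (isCompact_Icc (a := (5 / 4 : ℝ)) (b := 3)).exists_isMinOn
    ⟨2, by norm_num, by norm_num⟩ hcont.continuousOn
  refine ⟨_, hpos s₀ hs₀, fun s hs' => ?_⟩
  rw [integral_comp_sub_sq hs.subset hs'.2]
  exact hmin hs'

theorem exists_integral_scaledProfile_ge {Ψ : ℝ → ℝ} (hΨ : Continuous Ψ)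
    (hs : Function.support Ψ = Set.Ioo 1 2) (h0 : ∀ s, 0 ≤ Ψ s) :
    ∃ c : ℝ, 0 < c ∧ ∀ q p : ℝ, 1 ≤ q → q * (1 - p ^ 2) ∈ Set.Icc (5 / 4 : ℝ) 3 →
      c / q ≤ ∫ t, scaledProfile Ψ q p t := by
  obtain ⟨c, hc, hle⟩ := exists_integral_comp_sub_sq_ge hΨ hs h0
  refine ⟨c, hc, fun q p hq hqp => ?_⟩
  rw [integral_scaledProfile Ψ (zero_le_one.trans hq), inv_mul_eq_div]
  exact div_le_div₀ (hc.le.trans (hle _ hqp)) (hle _ hqp) (by positivity)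
    (Real.sqrt_le_self_iff.2 (.inr hq))

end LowerBound

section RingBump

/-- A smooth bump function, positive exactly on `(1, 2)`. -/
noncomputable def ringBump (s : ℝ) : ℝ := expNegInvGlue (s - 1) * expNegInvGlue (2 - s)

theorem contDiff_ringBump : ContDiff ℝ ∞ ringBump :=
  (expNegInvGlue.contDiff.comp (contDiff_id.sub contDiff_const)).mul
    (expNegInvGlue.contDiff.comp (contDiff_const.sub contDiff_id))

theorem support_ringBump : Function.support ringBump = Set.Ioo 1 2 := by
  ext s
  simp only [ringBump, Function.mem_support, mul_ne_zero_iff, ne_eq, expNegInvGlue.zero_iff_nonpos,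
    not_le, sub_pos, Set.mem_Ioo]

theorem ringBump_nonneg (s : ℝ) : 0 ≤ ringBump s :=
  mul_nonneg (expNegInvGlue.nonneg _) (expNegInvGlue.nonneg _)

theorem expNegInvGlue_le_one (x : ℝ) : expNegInvGlue x ≤ 1 := by
  rcases le_or_gt x 0 with h | h
  · rw [expNegInvGlue.zero_of_nonpos h]
    exact zero_le_one
  · rw [expNegInvGlue, if_neg (not_le.2 h), Real.exp_le_one_iff, neg_nonpos]
    positivity

theorem ringBump_le_one (s : ℝ) : ringBump s ≤ 1 :=
  mul_le_one₀ (expNegInvGlue_le_one _) (expNegInvGlue.nonneg _) (expNegInvGlue_le_one _)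

end RingBump

section PlanePolar

/-- A smooth function on the line which equals `1 / x` for `1 ≤ x`. -/
noncomputable def invCut (x : ℝ) : ℝ := Real.smoothTransition (2 * x - 1) / x

theorem mul_invCut (x : ℝ) : x * invCut x = Real.smoothTransition (2 * x - 1) := by
  rcases eq_or_ne x 0 with rfl | hx
  · rw [zero_mul, Real.smoothTransition.zero_of_nonpos (by norm_num)]
  · rw [invCut, mul_div_cancel₀ _ hx]

theorem invCut_of_one_le {x : ℝ} (hx : 1 ≤ x) : invCut x = x⁻¹ := by
  rw [invCut, Real.smoothTransition.one_of_one_le (by linarith), one_div]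

theorem invCut_of_le_half {x : ℝ} (hx : x ≤ 1 / 2) : invCut x = 0 := by
  rw [invCut, Real.smoothTransition.zero_of_nonpos (by linarith), zero_div]

theorem contDiff_invCut : ContDiff ℝ ∞ invCut := by
  have h : ContDiff ℝ ∞ fun x : ℝ => Real.smoothTransition (2 * x - 1) :=
    Real.smoothTransition.contDiff.comp ((contDiff_const.mul contDiff_id).sub contDiff_const)
  refine contDiff_iff_contDiffAt.2 fun x => ?_
  rcases eq_or_ne x 0 with rfl | hx
  · refine contDiffAt_const (c := (0 : ℝ)).congr_of_eventuallyEq ?_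
    filter_upwards [Iio_mem_nhds (by norm_num : (0 : ℝ) < 1 / 2)] with y hy
    exact invCut_of_le_half hy.le
  · exact h.contDiffAt.div contDiffAt_id hx

theorem norm_iteratedDeriv_inv_le {x : ℝ} (hx : 1 ≤ x) (m : ℕ) :
    ‖iteratedDeriv m (fun y : ℝ => y⁻¹) x‖ ≤ m.factorial := by
  rw [iteratedDeriv_eq_iterate, iter_deriv_inv, norm_mul, norm_mul, norm_pow, norm_neg, norm_one,
    one_pow, one_mul, Real.norm_natCast, norm_zpow, Real.norm_of_nonneg (by linarith)]
  exact mul_le_of_le_one_right (by positivity) (zpow_le_one_of_nonpos₀ hx (by omega))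

theorem exists_bound_iteratedFDeriv_invCut (m : ℕ) :
    ∃ C, ∀ x, ‖iteratedFDeriv ℝ m invCut x‖ ≤ C := by
  obtain ⟨C, hC⟩ := exists_bound_iteratedFDeriv_of_isCompact (isCompact_Icc (a := (0 : ℝ)) (b := 2))
    contDiff_invCut m
  have hC0 : 0 ≤ C := (norm_nonneg _).trans (hC 0 (by norm_num))
  refine ⟨C + m.factorial, fun x => ?_⟩
  by_cases h : x ∈ Set.Icc (0 : ℝ) 2
  · exact (hC x h).trans (le_add_of_nonneg_right (Nat.cast_nonneg _))
  rw [Set.mem_Icc, not_and_or, not_le, not_le] at h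
  rw [norm_iteratedFDeriv_eq_norm_iteratedDeriv]
  rcases h with h | h
  · have hzero : invCut =ᶠ[nhds x] fun _ => 0 := by
      filter_upwards [Iio_mem_nhds h] with y hy
      exact invCut_of_le_half (by linarith [Set.mem_Iio.1 hy])
    rw [hzero.iteratedDeriv_eq, iteratedDeriv_const, ite_self, norm_zero]
    positivity
  · have hinv : invCut =ᶠ[nhds x] fun y => y⁻¹ := by
      filter_upwards [Ioi_mem_nhds (by linarith : (1 : ℝ) < x)] with y hy
      exact invCut_of_one_le (Set.mem_Ioi.1 hy).le
    rw [hinv.iteratedDeriv_eq]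
    exact (norm_iteratedDeriv_inv_le (by linarith) m).trans (le_add_of_nonneg_left hC0)

/-- A smooth function on the plane which equals `e^{2iφ}`, in polar coordinates, for `1/2 ≤ r²`. -/
noncomputable def angleSq (z : ℂ) : ℂ := ((2 * invCut (2 * ‖z‖ ^ 2) : ℝ) : ℂ) * z ^ 2

theorem contDiff_angleSq : ContDiff ℝ ∞ angleSq := by
  have h : ContDiff ℝ ∞ fun z : ℂ => 2 * invCut (2 * ‖z‖ ^ 2) :=
    contDiff_const.mul (contDiff_invCut.comp (contDiff_const.mul (contDiff_norm_sq ℝ)))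
  exact (Complex.ofRealCLM.contDiff.comp h).mul (contDiff_id.pow 2)

theorem norm_angleSq (z : ℂ) : ‖angleSq z‖ = Real.smoothTransition (2 * (2 * ‖z‖ ^ 2) - 1) := by
  rw [angleSq, norm_mul, Complex.norm_real, Real.norm_eq_abs, norm_pow, ← abs_sq ‖z‖, ← abs_mul,
    mul_right_comm, abs_sq, mul_invCut, abs_of_nonneg (Real.smoothTransition.nonneg _)]

theorem norm_angleSq_le (z : ℂ) : ‖angleSq z‖ ≤ 1 :=
  (norm_angleSq z).trans_le (Real.smoothTransition.le_one _)

theorem norm_angleSq_of_one_le {z : ℂ} (h : 1 ≤ 2 * ‖z‖ ^ 2) : ‖angleSq z‖ = 1 := by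
  rw [norm_angleSq, Real.smoothTransition.one_of_one_le (by linarith)]

/-- The parametrization of the oriented line with direction `e^{iφ}` at signed distance `p` from
the origin. -/
noncomputable def linePt (φ p t : ℝ) : ℂ := Complex.exp (φ * Complex.I) * (t + p * Complex.I)

theorem norm_sq_linePt (φ p t : ℝ) : ‖linePt φ p t‖ ^ 2 = p ^ 2 + t ^ 2 := by
  rw [linePt, norm_mul, Complex.norm_exp_ofReal_mul_I, one_mul, Complex.sq_norm,
    Complex.normSq_add_mul_I, add_comm]

theorem continuous_linePt (φ p : ℝ) : Continuous (linePt φ p) := by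
  unfold linePt
  fun_prop

theorem angleSq_linePt {φ p t : ℝ} (hp : p ≠ 0) (h : 1 ≤ 2 * (p ^ 2 + t ^ 2)) :
    angleSq (linePt φ p t) = Complex.exp (φ * Complex.I) ^ 2 * lineAngle p t := by
  have hinv : ((2 * (2 * (p ^ 2 + t ^ 2))⁻¹ : ℝ) : ℂ) =
      (((t : ℂ) + p * Complex.I) * (t - p * Complex.I))⁻¹ := by
    rw [add_mul_I_mul_sub, ← Complex.ofReal_inv, add_comm (t ^ 2), mul_inv,
      mul_inv_cancel_left₀ two_ne_zero]
  have : (t : ℂ) - p * Complex.I ≠ 0 := sub_mul_I_ne_zero hp t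
  have : (t : ℂ) + p * Complex.I ≠ 0 := by
    simpa using sub_mul_I_ne_zero (neg_ne_zero.2 hp) t
  rw [angleSq, norm_sq_linePt, invCut_of_one_le h, hinv, linePt, lineAngle]
  field_simp

/-- The integral of a function over a line. -/
noncomputable def lineInt (h : ℂ → ℝ) (φ p : ℝ) : ℝ := ∫ t, h (linePt φ p t)

theorem one_le_norm_linePt (φ : ℝ) {p t : ℝ} (h : 1 ≤ p ^ 2 + t ^ 2) : 1 ≤ ‖linePt φ p t‖ := by
  rwa [← one_le_sq_iff₀ (norm_nonneg _), norm_sq_linePt]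

theorem one_le_norm_linePt_of_notMem_Icc (φ p : ℝ) {t : ℝ} (ht : t ∉ Set.Icc (-1 : ℝ) 1) :
    1 ≤ ‖linePt φ p t‖ := by
  rw [Set.mem_Icc, ← abs_le, not_le, ← one_lt_sq_iff_one_lt_abs] at ht
  exact one_le_norm_linePt φ (by linarith [sq_nonneg p])

theorem integrable_comp_linePt {h : ℂ → ℝ} (hc : Continuous h) (h0 : ∀ z, 1 ≤ ‖z‖ → h z = 0)
    (φ p : ℝ) : Integrable fun t => h (linePt φ p t) :=
  (hc.comp (continuous_linePt φ p)).integrable_of_hasCompactSupport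
    (.intro isCompact_Icc fun _ ht => h0 _ (one_le_norm_linePt_of_notMem_Icc φ p ht))

end PlanePolar

section Waves

variable {N : ℕ} {K : ℝ}

/-- The oscillating factor of the building blocks: a radial chirp for `k = 0`, and a rapidly
rotating function of the polar angle for `k > 0`. -/
noncomputable def ringWave (N : ℕ) (K : ℝ) : ℕ → ℂ → ℂ
  | 0, z => chirp K ‖z‖
  | k + 1, z => angleSq z ^ (N * 4 ^ (k + 1))

theorem contDiff_ringWave : ∀ k, ContDiff ℝ ∞ (ringWave N K k)
  | 0 => ((Complex.ofRealCLM.contDiff.comp (contDiff_const.mul (contDiff_norm_sq ℝ))).mul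
      contDiff_const).cexp
  | k + 1 => contDiff_angleSq.pow (N * 4 ^ (k + 1))

theorem norm_ringWave_le : ∀ (k : ℕ) (z : ℂ), ‖ringWave N K k z‖ ≤ 1
  | 0, z => (norm_chirp K ‖z‖).le
  | k + 1, z => by
    rw [ringWave, norm_pow]
    exact pow_le_one₀ (norm_nonneg _) (norm_angleSq_le z)

theorem one_le_two_mul_of_mul_one_sub_le {k : ℕ} {s : ℝ} (h : 2 ^ (k + 1 + 1) * (1 - s) ≤ 2) :
    1 ≤ 2 * s := by
  have hpow : (2 : ℝ) ^ 2 ≤ 2 ^ (k + 1 + 1) := pow_le_pow_right₀ one_le_two (by omega)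
  nlinarith

theorem norm_ringWave_of_le {k : ℕ} {z : ℂ} (h : 2 ^ (k + 1) * (1 - ‖z‖ ^ 2) ≤ 2) :
    ‖ringWave N K k z‖ = 1 := by
  cases k with
  | zero => exact norm_chirp K ‖z‖
  | succ k =>
    rw [ringWave, norm_pow, norm_angleSq_of_one_le (one_le_two_mul_of_mul_one_sub_le h), one_pow]

theorem ringWave_sq (k : ℕ) (z : ℂ) : ringWave N K k z ^ 2 = ringWave (2 * N) (2 * K) k z := by
  cases k with
  | zero =>
    rw [ringWave, ringWave, chirp, chirp, ← Complex.exp_nat_mul]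
    push_cast
    ring_nf
  | succ k => rw [ringWave, ringWave, ← pow_mul, mul_right_comm, mul_comm 2 N]

theorem ringWave_zero_linePt (φ p t : ℝ) :
    ringWave N K 0 (linePt φ p t) = chirp K p * chirp K t := by
  rw [ringWave, chirp, norm_sq_linePt, chirp, chirp, ← Complex.exp_add]
  push_cast
  ring_nf

theorem scaledProfile_mul_ringWave_succ_linePt {Ψ : ℝ → ℝ} (hs : Function.support Ψ ⊆ Set.Ioo 1 2)
    {p : ℝ} (hp : p ≠ 0) (k : ℕ) (φ t : ℝ) :
    (scaledProfile Ψ (2 ^ (k + 1 + 1)) p t : ℂ) * ringWave N K (k + 1) (linePt φ p t) =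
      Complex.exp (φ * Complex.I) ^ (2 * (N * 4 ^ (k + 1))) *
        ((scaledProfile Ψ (2 ^ (k + 1 + 1)) p t : ℂ) * lineAngle p t ^ (N * 4 ^ (k + 1))) := by
  by_cases h : scaledProfile Ψ (2 ^ (k + 1 + 1)) p t = 0
  · rw [h, Complex.ofReal_zero, zero_mul, zero_mul, mul_zero]
  · have hle : 1 ≤ 2 * (p ^ 2 + t ^ 2) := by
      refine one_le_two_mul_of_mul_one_sub_le (k := k) ?_
      rw [← sub_sub]
      exact (hs h).2.le
    rw [ringWave, angleSq_linePt hp hle, mul_pow, ← pow_mul, mul_left_comm]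

theorem exists_norm_integral_ringWave_zero_le {Ψ : ℝ → ℝ} (hΨ : ContDiff ℝ ∞ Ψ)
    (hs : Function.support Ψ ⊆ Set.Ioo 1 2) :
    ∃ C : ℝ, ∀ (N : ℕ) (K φ p : ℝ), 0 < K →
      ‖∫ t, (scaledProfile Ψ (2 ^ (0 + 1)) p t : ℂ) * ringWave N K 0 (linePt φ p t)‖ ≤
        C / √K := by
  obtain ⟨C, hC⟩ := exists_norm_integral_scaledProfile_chirp_le hΨ hs
  refine ⟨C, fun N K φ p hK => ?_⟩
  simp_rw [ringWave_zero_linePt, mul_left_comm _ (chirp K p), zero_add, pow_one]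
  rw [integral_const_mul, norm_mul, norm_chirp, one_mul]
  exact hC K p hK

theorem exists_norm_integral_ringWave_succ_le {Ψ : ℝ → ℝ} (hΨ : ContDiff ℝ ∞ Ψ)
    (hs : Function.support Ψ ⊆ Set.Ioo 1 2) (M : ℕ) :
    ∃ C : ℝ, 0 ≤ C ∧ ∀ (N k : ℕ) (K φ p : ℝ), 1 ≤ N → 1 / 2 ≤ |p| →
      ‖∫ t, (scaledProfile Ψ (2 ^ (k + 1 + 1)) p t : ℂ) *
        ringWave N K (k + 1) (linePt φ p t)‖ ≤ C * (2 * (1 / 2) ^ (k + 1) / N) ^ M := by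
  obtain ⟨C, hC, h⟩ := exists_norm_integral_scaledProfile_lineAngle_le hΨ hs M
  refine ⟨C, hC, fun N k K φ p hN hp => ?_⟩
  have hp0 : p ≠ 0 := abs_pos.1 (by linarith)
  have hratio : (2 : ℝ) ^ (k + 1 + 1) / ((N * 4 ^ (k + 1) : ℕ) : ℝ) =
      2 * (1 / 2) ^ (k + 1) / N := by
    push_cast
    rw [show (4 : ℝ) = 2 * 2 by norm_num, mul_pow, one_div, inv_pow, pow_succ 2 (k + 1)]
    field_simp
  simp_rw [scaledProfile_mul_ringWave_succ_linePt hs hp0]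
  rw [integral_const_mul, norm_mul, norm_pow, Complex.norm_exp_ofReal_mul_I, one_pow, one_mul,
    ← hratio]
  exact h _ p _ (one_le_pow₀ one_le_two) hp (Nat.one_le_iff_ne_zero.2 (by positivity))

theorem integrable_scaledProfile_mul_ringWave {Ψ : ℝ → ℝ} (hΨ : ContDiff ℝ ∞ Ψ)
    (hs : Function.support Ψ ⊆ Set.Ioo 1 2) (k : ℕ) (φ p : ℝ) :
    Integrable fun t =>
      (scaledProfile Ψ (2 ^ (k + 1)) p t : ℂ) * ringWave N K k (linePt φ p t) :=
  ((Complex.continuous_ofReal.comp (contDiff_scaledProfile hΨ _ p).continuous).mul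
    ((contDiff_ringWave k).continuous.comp
      (continuous_linePt φ p))).integrable_of_hasCompactSupport
    (((hasCompactSupport_scaledProfile hs (by positivity) p).comp_left
      Complex.ofReal_zero).mul_right)

theorem integral_mul_re {a : ℝ → ℝ} {u : ℝ → ℂ} (h : Integrable fun t => (a t : ℂ) * u t) :
    ∫ t, a t * (u t).re = (∫ t, (a t : ℂ) * u t).re := by
  refine Eq.trans ?_ (integral_re h)
  simp only [RCLike.re_to_complex, Complex.re_ofReal_mul]

end Waves

section Pieces

variable {N : ℕ} {K : ℝ}

/-- The building blocks: smooth functions supported in the dyadic annuli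
`2 ^ (k + 1) (1 - r²) ∈ [1, 2]`, modulated by `ringWave`. -/
noncomputable def ringPiece (N : ℕ) (K : ℝ) (k : ℕ) (z : ℂ) : ℝ :=
  ringBump (2 ^ (k + 1) * (1 - ‖z‖ ^ 2)) * (ringWave N K k z).re

theorem abs_ringPiece_le_ringBump (k : ℕ) (z : ℂ) :
    |ringPiece N K k z| ≤ ringBump (2 ^ (k + 1) * (1 - ‖z‖ ^ 2)) := by
  rw [ringPiece, abs_mul, abs_of_nonneg (ringBump_nonneg _)]
  exact mul_le_of_le_one_right (ringBump_nonneg _)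
    ((Complex.abs_re_le_norm _).trans (norm_ringWave_le k z))

theorem abs_ringPiece_le_one (k : ℕ) (z : ℂ) : |ringPiece N K k z| ≤ 1 :=
  (abs_ringPiece_le_ringBump k z).trans (ringBump_le_one _)

theorem mem_Ioo_of_ringBump_ne_zero {s : ℝ} (h : ringBump s ≠ 0) : s ∈ Set.Ioo (1 : ℝ) 2 :=
  support_ringBump ▸ h

theorem mem_Ioo_of_ringPiece_ne_zero {k : ℕ} {z : ℂ} (h : ringPiece N K k z ≠ 0) :
    2 ^ (k + 1) * (1 - ‖z‖ ^ 2) ∈ Set.Ioo (1 : ℝ) 2 :=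
  mem_Ioo_of_ringBump_ne_zero (left_ne_zero_of_mul h)

theorem norm_lt_one_of_ringPiece_ne_zero {k : ℕ} {z : ℂ} (h : ringPiece N K k z ≠ 0) :
    ‖z‖ < 1 := by
  have hpos : 0 < 1 - ‖z‖ ^ 2 :=
    pos_of_mul_pos_right (zero_lt_one.trans (mem_Ioo_of_ringPiece_ne_zero h).1) (by positivity)
  exact (sq_lt_one_iff₀ (norm_nonneg z)).1 (by linarith)

theorem ringPiece_eq_zero_of_one_le_norm (k : ℕ) {z : ℂ} (h : 1 ≤ ‖z‖) :
    ringPiece N K k z = 0 :=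
  by_contra fun hne => h.not_gt (norm_lt_one_of_ringPiece_ne_zero hne)

theorem eq_of_ringPiece_ne_zero {k j : ℕ} {z : ℂ} (hk : ringPiece N K k z ≠ 0)
    (hj : ringPiece N K j z ≠ 0) : k = j := by
  by_contra hkj
  wlog hlt : k < j generalizing k j
  · exact this hj hk (Ne.symm hkj) (by omega)
  obtain ⟨hk1, hk2⟩ := mem_Ioo_of_ringPiece_ne_zero hk
  obtain ⟨-, hj2⟩ := mem_Ioo_of_ringPiece_ne_zero hj
  have hpos : 0 < 1 - ‖z‖ ^ 2 := pos_of_mul_pos_right (zero_lt_one.trans hk1) (by positivity)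
  have hpow : (2 : ℝ) ^ (k + 1 + 1) ≤ 2 ^ (j + 1) := pow_le_pow_right₀ one_le_two (by omega)
  rw [pow_succ] at hpow
  nlinarith

theorem geomBounded_ringWave (N : ℕ) (K : ℝ) :
    GeomBounded (closedBall (0 : ℂ) 2) (ringWave N K) := by
  have hS : IsCompact (closedBall (0 : ℂ) 2) := isCompact_closedBall _ _
  refine .of_succ hS (contDiff_ringWave 0) ?_
  have hpow : GeomBounded (closedBall (0 : ℂ) 1) fun k (w : ℂ) => w ^ (N * 4 ^ (k + 1)) := by
    refine .pow (r := (N + 1) * 4) (by linarith [(Nat.cast_nonneg N : (0 : ℝ) ≤ N)]) fun k => ?_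
    push_cast
    rw [mul_pow]
    gcongr
    exact le_pow_succ_of_le (le_add_of_nonneg_left N.cast_nonneg) (by linarith) k
  exact hpow.comp (.const hS contDiff_angleSq) fun _ z _ => by simpa using norm_angleSq_le z

theorem geomBounded_ringBump_annulus :
    GeomBounded (closedBall (0 : ℂ) 2) fun k z => ringBump (2 ^ (k + 1) * (1 - ‖z‖ ^ 2)) := by
  have hS : IsCompact (closedBall (0 : ℂ) 2) := isCompact_closedBall _ _
  have hsq : ContDiff ℝ ∞ fun z : ℂ => 1 - ‖z‖ ^ 2 := contDiff_const.sub (contDiff_norm_sq ℝ)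
  have harg : GeomBounded (closedBall (0 : ℂ) 2) fun k z => (2 : ℝ) ^ (k + 1) * (1 - ‖z‖ ^ 2) :=
    (GeomBounded.const hS hsq).const_mul (r := 2) (by norm_num) fun k => by
      rw [abs_of_nonneg (by positivity)]
  have hcs : HasCompactSupport ringBump := .of_support_subset_isCompact isCompact_Icc
    (support_ringBump.subset.trans Set.Ioo_subset_Icc_self)
  exact (GeomBounded.const_of_hasCompactSupport contDiff_ringBump hcs).comp harg
    fun _ => Set.mapsTo_univ _ _

theorem geomBounded_ringPiece (N : ℕ) (K : ℝ) : GeomBounded Set.univ (ringPiece N K) := by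
  refine (geomBounded_ringBump_annulus.mul
    ((geomBounded_ringWave N K).clm_comp Complex.reCLM)).of_eventuallyEq_zero fun k z hz => ?_
  have hfar : {w : ℂ | 1 < ‖w‖} ∈ nhds z :=
    (isOpen_lt continuous_const continuous_norm).mem_nhds (by
      rw [mem_closedBall, dist_zero_right, not_le] at hz
      exact one_lt_two.trans hz)
  filter_upwards [hfar] with w hw
  exact ringPiece_eq_zero_of_one_le_norm k hw.le

theorem contDiff_ringPiece (k : ℕ) : ContDiff ℝ ∞ (ringPiece N K k) :=
  (geomBounded_ringPiece N K).smooth k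

theorem ringPiece_linePt (k : ℕ) (φ p t : ℝ) :
    ringPiece N K k (linePt φ p t) =
      scaledProfile ringBump (2 ^ (k + 1)) p t * (ringWave N K k (linePt φ p t)).re := by
  rw [ringPiece, norm_sq_linePt, scaledProfile, sub_sub]

theorem integrable_ringPiece_linePt (k : ℕ) (φ p : ℝ) :
    Integrable fun t => ringPiece N K k (linePt φ p t) :=
  integrable_comp_linePt (contDiff_ringPiece k).continuous
    (fun _ => ringPiece_eq_zero_of_one_le_norm k) φ p

theorem integral_norm_ringPiece_le (k : ℕ) (φ p : ℝ) :
    ∫ t, ‖ringPiece N K k (linePt φ p t)‖ ≤ 2 := by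
  refine (Real.le_norm_self _).trans ((norm_integral_le_of_eq_zero_outside_Icc (C := 1)
    (neg_le_self zero_le_one)
    (fun t ht => ?_) fun t _ => ?_).trans_eq (by norm_num))
  · rw [ringPiece_eq_zero_of_one_le_norm k (one_le_norm_linePt_of_notMem_Icc φ p ht),
      norm_zero]
  · rw [norm_norm]
    exact abs_ringPiece_le_one k _

theorem lineInt_ringPiece (k : ℕ) (φ p : ℝ) :
    lineInt (ringPiece N K k) φ p =
      (∫ t, (scaledProfile ringBump (2 ^ (k + 1)) p t : ℂ) *
        ringWave N K k (linePt φ p t)).re := by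
  simp_rw [lineInt, ringPiece_linePt]
  exact integral_mul_re
    (integrable_scaledProfile_mul_ringWave contDiff_ringBump support_ringBump.subset k φ p)

theorem exists_abs_lineInt_zero_le :
    ∃ C : ℝ, ∀ (N : ℕ) (K φ p : ℝ), 0 < K → |lineInt (ringPiece N K 0) φ p| ≤ C / √K := by
  obtain ⟨C, h⟩ := exists_norm_integral_ringWave_zero_le contDiff_ringBump support_ringBump.subset
  refine ⟨C, fun N K φ p hK => ?_⟩
  rw [lineInt_ringPiece]
  exact (Complex.abs_re_le_norm _).trans (h N K φ p hK)

theorem exists_abs_lineInt_succ_le (M : ℕ) :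
    ∃ C : ℝ, 0 ≤ C ∧ ∀ (N k : ℕ) (K φ p : ℝ), 1 ≤ N → 1 / 2 ≤ |p| →
      |lineInt (ringPiece N K (k + 1)) φ p| ≤ C * (2 * (1 / 2) ^ (k + 1) / N) ^ M := by
  obtain ⟨C, hC, h⟩ :=
    exists_norm_integral_ringWave_succ_le contDiff_ringBump support_ringBump.subset M
  refine ⟨C, hC, fun N k K φ p hN hp => ?_⟩
  rw [lineInt_ringPiece]
  exact (Complex.abs_re_le_norm _).trans (h N k K φ p hN hp)

theorem sq_re_of_norm_eq_one {w : ℂ} (hw : ‖w‖ = 1) : w.re ^ 2 = 1 / 2 + 1 / 2 * (w ^ 2).re := by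
  have h : w.re ^ 2 + w.im ^ 2 = 1 := by
    rw [← Complex.normSq_add_mul_I, Complex.re_add_im, Complex.normSq_eq_norm_sq, hw, one_pow]
  rw [pow_two w, Complex.mul_re]
  linarith

theorem ringPiece_sq (k : ℕ) (z : ℂ) :
    ringPiece N K k z ^ 2 = 1 / 2 * ringBump (2 ^ (k + 1) * (1 - ‖z‖ ^ 2)) ^ 2 +
      1 / 2 * (ringBump (2 ^ (k + 1) * (1 - ‖z‖ ^ 2)) ^ 2 *
        (ringWave (2 * N) (2 * K) k z).re) := by
  rw [ringPiece, mul_pow]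
  by_cases h : ringBump (2 ^ (k + 1) * (1 - ‖z‖ ^ 2)) = 0
  · simp [h]
  · rw [sq_re_of_norm_eq_one (norm_ringWave_of_le (mem_Ioo_of_ringBump_ne_zero h).2.le),
      ringWave_sq]
    ring

theorem contDiff_ringBump_sq : ContDiff ℝ ∞ fun s => ringBump s ^ 2 := contDiff_ringBump.pow 2

theorem support_ringBump_sq : Function.support (fun s => ringBump s ^ 2) = Set.Ioo 1 2 :=
  (Function.support_pow _ two_ne_zero).trans support_ringBump

theorem lineInt_ringPiece_sq (k : ℕ) (φ p : ℝ) :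
    lineInt (fun z => ringPiece N K k z ^ 2) φ p =
      1 / 2 * ((∫ t, scaledProfile (fun s => ringBump s ^ 2) (2 ^ (k + 1)) p t) +
        (∫ t, (scaledProfile (fun s => ringBump s ^ 2) (2 ^ (k + 1)) p t : ℂ) *
          ringWave (2 * N) (2 * K) k (linePt φ p t)).re) := by
  have hwave := integrable_scaledProfile_mul_ringWave (N := 2 * N) (K := 2 * K)
    contDiff_ringBump_sq support_ringBump_sq.subset k φ p
  have hprofile : Integrable (scaledProfile (fun s => ringBump s ^ 2) (2 ^ (k + 1)) p) :=
    (contDiff_scaledProfile contDiff_ringBump_sq _ p).continuous.integrable_of_hasCompactSupport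
      (hasCompactSupport_scaledProfile support_ringBump_sq.subset (by positivity) p)
  have hre : Integrable fun t => scaledProfile (fun s => ringBump s ^ 2) (2 ^ (k + 1)) p t *
      (ringWave (2 * N) (2 * K) k (linePt φ p t)).re := by
    simpa only [RCLike.re_to_complex, Complex.re_ofReal_mul] using hwave.re
  rw [← integral_mul_re hwave, ← integral_add hprofile hre, ← integral_const_mul]
  refine integral_congr_ae (.of_forall fun t => ?_)
  simp only [ringPiece_sq, scaledProfile, norm_sq_linePt, sub_sub]
  ring

/-- The signed distances from the origin of the lines of scale `k`: they meet the `k`-th annulus in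
segments of length comparable to `2 ^ (-k)`, and miss the annuli `j` with `j + 1 < k`. -/
def scaleRange (k : ℕ) : Set ℝ := {p | 2 ^ (k + 1) * (1 - p ^ 2) ∈ Set.Icc (5 / 4 : ℝ) 3}

theorem half_le_abs_of_mem_scaleRange {k : ℕ} {p : ℝ} (h : p ∈ scaleRange (k + 1)) :
    1 / 2 ≤ |p| := by
  have hpow : (2 : ℝ) ^ 2 ≤ 2 ^ (k + 1 + 1) := pow_le_pow_right₀ one_le_two (by omega)
  rw [← abs_of_pos (one_half_pos (α := ℝ)), ← sq_le_sq]
  nlinarith [h.2]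

theorem exists_norm_integral_ringWave_le {Ψ : ℝ → ℝ} (hΨ : ContDiff ℝ ∞ Ψ)
    (hs : Function.support Ψ ⊆ Set.Ioo 1 2) {ε : ℝ} (hε : 0 < ε) :
    ∃ N₀ : ℕ, ∃ K₀ : ℝ, ∀ (N k : ℕ) (K φ : ℝ), N₀ ≤ N → K₀ ≤ K → ∀ p ∈ scaleRange k,
      ‖∫ t, (scaledProfile Ψ (2 ^ (k + 1)) p t : ℂ) * ringWave N K k (linePt φ p t)‖ ≤
        ε / 2 ^ (k + 1) := by
  obtain ⟨C₀, h₀⟩ := exists_norm_integral_ringWave_zero_le hΨ hs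
  obtain ⟨C₁, _, h₁⟩ := exists_norm_integral_ringWave_succ_le hΨ hs 1
  have hlim : Filter.Tendsto (fun K => C₀ / √K) Filter.atTop (nhds 0) :=
    tendsto_const_nhds.div_atTop Real.tendsto_sqrt_atTop
  obtain ⟨K₀, hK₀⟩ := Filter.eventually_atTop.1
    ((hlim.eventually_le_const (by positivity : 0 < ε / 2 ^ (0 + 1))).and
      (Filter.eventually_gt_atTop 0))
  obtain ⟨N₀, hN₀⟩ := exists_nat_ge (4 * C₁ / ε)
  refine ⟨N₀ + 1, K₀, fun N k K φ hN hK p hp => ?_⟩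
  cases k with
  | zero => exact (h₀ N K φ p (hK₀ K hK).2).trans (hK₀ K hK).1
  | succ k =>
    have hNpos : (0 : ℝ) < N := by exact_mod_cast (by omega : 0 < N)
    have hN' : 4 * C₁ / ε ≤ N := hN₀.trans (by exact_mod_cast (by omega : N₀ ≤ N))
    rw [div_le_iff₀ hε, mul_comm] at hN'
    refine (h₁ N k K φ p (by omega) (half_le_abs_of_mem_scaleRange hp)).trans ?_
    rw [pow_one, one_div, inv_pow, pow_succ _ (k + 1), ← div_eq_mul_inv, div_div,
      ← mul_div_assoc, div_le_div_iff₀ (by positivity) (by positivity)]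
    have : 0 < (2 : ℝ) ^ (k + 1) := by positivity
    nlinarith

/-- Boundedness from below of the integrals of the squares of the pieces along the lines of the
same scale, the normalization being the length of the chords. -/
def RingLowerBound (N : ℕ) (K c : ℝ) : Prop :=
  ∀ (k : ℕ) (φ : ℝ), ∀ p ∈ scaleRange k,
    c / 2 ^ (k + 1) ≤ lineInt (fun z => ringPiece N K k z ^ 2) φ p

theorem exists_ringLowerBound :
    ∃ c : ℝ, 0 < c ∧ ∃ N₀ : ℕ, ∃ K₀ : ℝ, ∀ (N : ℕ) (K : ℝ), N₀ ≤ N → K₀ ≤ K →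
      RingLowerBound N K c := by
  obtain ⟨c, hc, hlow⟩ := exists_integral_scaledProfile_ge contDiff_ringBump_sq.continuous
    support_ringBump_sq fun s => sq_nonneg (ringBump s)
  obtain ⟨N₀, K₀, hosc⟩ := exists_norm_integral_ringWave_le contDiff_ringBump_sq
    support_ringBump_sq.subset (half_pos hc)
  refine ⟨c / 4, by positivity, N₀, max K₀ 0, fun N K hN hK k φ p hp => ?_⟩
  rw [max_le_iff] at hK
  have hmain := hlow (2 ^ (k + 1)) p (one_le_pow₀ one_le_two) hp
  have hre := neg_le_of_abs_le ((Complex.abs_re_le_norm _).trans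
    (hosc (2 * N) k (2 * K) φ (by omega) (by linarith) p hp))
  rw [lineInt_ringPiece_sq, div_right_comm]
  rw [div_right_comm] at hre
  linarith

end Pieces

section Tails

/-- The coefficients `B ^ (k² - j²)` for `k - 1 ≤ j`. -/
noncomputable def tailCoeff (B : ℝ) (k j : ℕ) : ℝ :=
  if k ≤ j + 1 then B ^ k ^ 2 / B ^ j ^ 2 else 0

variable {B : ℝ} {N : ℕ} {K : ℝ}

theorem tailCoeff_nonneg (hB : 1 ≤ B) (k j : ℕ) : 0 ≤ tailCoeff B k j := by
  unfold tailCoeff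
  split_ifs <;> positivity

theorem tailCoeff_le (hB : 1 ≤ B) (k j : ℕ) : tailCoeff B k j ≤ B ^ (2 * k) := by
  unfold tailCoeff
  split_ifs with h
  · rw [div_le_iff₀ (by positivity), ← pow_add]
    refine pow_le_pow_right₀ hB ?_
    cases k with
    | zero => simp
    | succ k =>
      have := Nat.pow_le_pow_left (Nat.le_of_succ_le_succ h) 2
      rw [add_sq]
      omega
  · positivity

theorem tailCoeff_le_geometric (hB : 1 ≤ B) (k j : ℕ) :
    tailCoeff B k j ≤ B ^ k ^ 2 * (1 / B) ^ j := by
  unfold tailCoeff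
  split_ifs
  · rw [div_eq_mul_inv, one_div, inv_pow]
    gcongr
    exact Nat.le_self_pow two_ne_zero j
  · positivity

theorem summable_tailCoeff (hB : 1 < B) (k : ℕ) : Summable (tailCoeff B k) :=
  Summable.of_nonneg_of_le (tailCoeff_nonneg hB.le k) (tailCoeff_le_geometric hB.le k)
    ((summable_geometric_of_lt_one (by positivity)
      ((div_lt_one (by linarith)).2 hB)).mul_left _)

theorem exists_pow_le_mul_pow_sq (hB : 1 < B) {y : ℝ} (hy : 0 ≤ y) :
    ∃ D : ℝ, 1 ≤ D ∧ ∀ i : ℕ, y ^ i ≤ D * B ^ i ^ 2 := by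
  obtain ⟨m, hm⟩ := pow_unbounded_of_one_lt y hB
  refine ⟨B ^ m ^ 2, one_le_pow₀ hB.le, fun i => ?_⟩
  calc y ^ i ≤ (B ^ m) ^ i := by gcongr
    _ = B ^ (m * i) := (pow_mul B m i).symm
    _ ≤ B ^ (m ^ 2 + i ^ 2) :=
        pow_le_pow_right₀ hB.le (by nlinarith [two_mul_le_add_sq m i, Nat.zero_le (m * i)])
    _ = B ^ m ^ 2 * B ^ i ^ 2 := pow_add B _ _

theorem exists_tailCoeff_mul_pow_le (hB : 1 < B) {r : ℝ} (hr : 1 ≤ r) :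
    ∃ R : ℝ, 1 ≤ R ∧ ∀ k j, |tailCoeff B k j| * r ^ (j + 1) ≤ R ^ (k + 1) := by
  have hBr : 1 ≤ B ^ 2 * r := one_le_mul_of_one_le_of_one_le (one_le_pow₀ hB.le) hr
  obtain ⟨D, hD, hpow⟩ := exists_pow_le_mul_pow_sq hB (zero_le_one.trans hBr)
  refine ⟨B ^ 2 * r * D, one_le_mul_of_one_le_of_one_le hBr hD, fun k j => ?_⟩
  rw [abs_of_nonneg (tailCoeff_nonneg hB.le k j)]
  unfold tailCoeff
  split_ifs with h
  swap
  · rw [zero_mul]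
    positivity
  obtain ⟨i, hi⟩ := Nat.exists_eq_add_of_le h
  have hexp : k ^ 2 + i ^ 2 ≤ j ^ 2 + 2 * k + 2 * i := by
    zify at hi ⊢
    rw [show (j : ℤ) = k + i - 1 by omega]
    nlinarith
  rw [div_mul_eq_mul_div, div_le_iff₀ (by positivity)]
  refine le_of_mul_le_mul_right ?_ (by positivity : 0 < B ^ i ^ 2)
  calc B ^ k ^ 2 * r ^ (j + 1) * B ^ i ^ 2 = B ^ (k ^ 2 + i ^ 2) * r ^ (k + i) := by
        rw [hi]
        ring
    _ ≤ B ^ (j ^ 2 + 2 * k + 2 * i) * r ^ (k + i) := by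
        gcongr
        exact hB.le
    _ = (B ^ 2 * r) ^ k * B ^ j ^ 2 * (B ^ 2 * r) ^ i := by ring
    _ ≤ (B ^ 2 * r) ^ k * B ^ j ^ 2 * (D * B ^ i ^ 2) := by
        gcongr
        exact hpow i
    _ = (B ^ 2 * r) ^ k * D * B ^ j ^ 2 * B ^ i ^ 2 := by ring
    _ ≤ (B ^ 2 * r * D) ^ (k + 1) * B ^ j ^ 2 * B ^ i ^ 2 := by
        rw [mul_pow (B ^ 2 * r)]
        gcongr
        · exact k.le_succ
        · exact le_self_pow₀ hD k.succ_ne_zero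

/-- The tails of the series `∑ B ^ (-j²) ringPiece j`, rescaled so that the `k`-th piece has
coefficient one. The tail `k = 0` is the full series. -/
noncomputable def ringTail (B : ℝ) (N : ℕ) (K : ℝ) (k : ℕ) (z : ℂ) : ℝ :=
  ∑' j, tailCoeff B k j * ringPiece N K j z

theorem geomBounded_ringTail (hB : 1 < B) : GeomBounded Set.univ (ringTail B N K) :=
  (geomBounded_ringPiece N K).tsum_mul fun _ hr => exists_tailCoeff_mul_pow_le hB hr

theorem ringTail_eq_zero_of_one_le_norm (k : ℕ) {z : ℂ} (h : 1 ≤ ‖z‖) :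
    ringTail B N K k z = 0 := by
  simp [ringTail, ringPiece_eq_zero_of_one_le_norm _ h]

theorem ringPiece_mul_ringTail_zero (k : ℕ) (z : ℂ) :
    ringPiece N K k z * ringTail B N K 0 z = ringPiece N K k z ^ 2 / B ^ k ^ 2 := by
  by_cases h : ringPiece N K k z = 0
  · simp [h]
  · have hsingle : ringTail B N K 0 z = tailCoeff B 0 k * ringPiece N K k z :=
      tsum_eq_single k fun j hj => mul_eq_zero_of_right _ <| by_contra fun hne =>
        hj (eq_of_ringPiece_ne_zero hne h)
    rw [hsingle, tailCoeff, if_pos (Nat.zero_le _)]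
    ring

theorem ringTail_eq {k : ℕ} {z : ℂ} (h : 2 ^ (k + 1) * (1 - ‖z‖ ^ 2) ≤ 3) :
    ringTail B N K k z = B ^ k ^ 2 * ringTail B N K 0 z := by
  rw [ringTail, ringTail, ← tsum_mul_left]
  refine tsum_congr fun j => ?_
  rw [tailCoeff, tailCoeff, if_pos (Nat.zero_le _)]
  split_ifs with hkj
  · ring
  · have hzero : ringPiece N K j z = 0 := by
      by_contra hne
      have hj := (mem_Ioo_of_ringPiece_ne_zero hne).1
      have hpow : (2 : ℝ) ^ (j + 1 + 2) ≤ 2 ^ (k + 1) := pow_le_pow_right₀ one_le_two (by omega)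
      have hpos : 0 < 1 - ‖z‖ ^ 2 := pos_of_mul_pos_right (zero_lt_one.trans hj) (by positivity)
      rw [pow_add] at hpow
      nlinarith
    rw [hzero, mul_zero, mul_zero, mul_zero]

theorem lineInt_ringTail (hB : 1 < B) (k : ℕ) (φ p : ℝ) :
    lineInt (ringTail B N K k) φ p = ∑' j, tailCoeff B k j * lineInt (ringPiece N K j) φ p := by
  unfold lineInt ringTail
  rw [← integral_tsum_of_summable_integral_norm
    (fun j => (integrable_ringPiece_linePt j φ p).const_mul _)]
  · simp_rw [integral_const_mul]
  · refine Summable.of_nonneg_of_le (fun j => integral_nonneg fun t => norm_nonneg _)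
      (fun j => ?_) ((summable_tailCoeff hB k).mul_right 2)
    simp_rw [norm_mul]
    rw [integral_const_mul, Real.norm_of_nonneg (tailCoeff_nonneg hB.le k j)]
    exact mul_le_mul_of_nonneg_left (integral_norm_ringPiece_le j φ p)
      (tailCoeff_nonneg hB.le k j)

theorem lineInt_ringTail_eq {k : ℕ} {p : ℝ} (hp : p ∈ scaleRange k) (φ : ℝ) :
    lineInt (ringTail B N K k) φ p = B ^ k ^ 2 * lineInt (ringTail B N K 0) φ p := by
  rw [lineInt, lineInt, ← integral_const_mul]
  refine integral_congr_ae (.of_forall fun t => ringTail_eq (le_trans ?_ hp.2))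
  rw [norm_sq_linePt]
  gcongr
  exact le_add_of_nonneg_right (sq_nonneg t)

theorem abs_lineInt_ringTail_le_of_forall (hB : 1 < B) {k : ℕ} {φ p A : ℝ}
    (h : ∀ j, tailCoeff B k j * |lineInt (ringPiece N K j) φ p| ≤ A / 2 / 2 ^ j) :
    |lineInt (ringTail B N K k) φ p| ≤ A := by
  rw [lineInt_ringTail hB, ← Real.norm_eq_abs]
  refine tsum_of_norm_bounded (hasSum_geometric_two' A) fun j => ?_
  rw [norm_mul, Real.norm_of_nonneg (tailCoeff_nonneg hB.le _ _), Real.norm_eq_abs]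
  exact h j

theorem abs_lineInt_ringTail_zero_le (hB : 2 ≤ B) {φ p e : ℝ}
    (he : |lineInt (ringPiece N K 0) φ p| ≤ e) :
    |lineInt (ringTail B N K 0) φ p| ≤ 2 * e + 8 / B := by
  have he0 : 0 ≤ e := (abs_nonneg _).trans he
  refine abs_lineInt_ringTail_le_of_forall (by linarith) fun j => ?_
  cases j with
  | zero =>
    have : 0 ≤ 8 / B := by positivity
    simp only [tailCoeff, zero_le, if_true, div_self, pow_zero, div_one, one_mul, ne_eq,
      one_ne_zero, not_false_eq_true, OfNat.ofNat_ne_zero, zero_pow]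
    linarith
  | succ j =>
    have hpiece : |lineInt (ringPiece N K (j + 1)) φ p| ≤ 2 :=
      (norm_integral_le_integral_norm _).trans (integral_norm_ringPiece_le _ φ p)
    calc tailCoeff B 0 (j + 1) * |lineInt (ringPiece N K (j + 1)) φ p|
        ≤ (B ^ 0 ^ 2 * (1 / B) ^ (j + 1)) * 2 := by
          gcongr
          exact tailCoeff_le_geometric (by linarith) 0 (j + 1)
      _ = 2 / B * (1 / B) ^ j := by
          rw [zero_pow two_ne_zero, pow_zero, pow_succ]
          ring
      _ ≤ 2 / B * (1 / 2) ^ j := by gcongr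
      _ = 8 / B / 2 / 2 ^ (j + 1) := by
          rw [pow_succ, one_div_pow]
          ring
      _ ≤ (2 * e + 8 / B) / 2 / 2 ^ (j + 1) := by
          gcongr
          linarith

theorem tailCoeff_mul_oscillation_le (hB : 1 ≤ B) (hN : 1 ≤ N) {C : ℝ} (hC : 0 ≤ C) (L : ℕ)
    {k j : ℕ} (hkj : k ≤ j + 1 + 1) :
    tailCoeff B k (j + 1) * (C * (2 * (1 / 2) ^ (j + 1) / N) ^ (L + 1)) ≤
      C * 4 ^ (L + 1) / N * (B ^ 2 / 2 ^ L) ^ k / 2 / 2 ^ (j + 1) := by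
  have hN1 : (1 : ℝ) ≤ N := by exact_mod_cast hN
  have hNpow : (1 / N : ℝ) ^ (L + 1) ≤ 1 / N :=
    pow_le_of_le_one (by positivity) ((div_le_one (by linarith)).2 hN1) L.succ_ne_zero
  have hhalf : (1 / 2 : ℝ) ^ j ≤ 4 * (1 / 2) ^ k := by
    have := pow_le_pow_of_le_one (by norm_num : (0 : ℝ) ≤ 1 / 2) (by norm_num) hkj
    rw [pow_succ, pow_succ] at this
    linarith
  calc tailCoeff B k (j + 1) * (C * (2 * (1 / 2) ^ (j + 1) / N) ^ (L + 1))
      ≤ B ^ (2 * k) * (C * (2 * (1 / 2) ^ (j + 1) / N) ^ (L + 1)) := by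
        gcongr
        exact tailCoeff_le hB _ _
    _ = B ^ (2 * k) * C * ((1 / 2) ^ j) ^ L * (1 / 2) ^ j * (1 / N : ℝ) ^ (L + 1) := by
        rw [show 2 * (1 / 2 : ℝ) ^ (j + 1) / N = (1 / 2) ^ j * (1 / N) by ring]
        ring
    _ ≤ B ^ (2 * k) * C * (4 * (1 / 2) ^ k) ^ L * (1 / 2) ^ j * (1 / N) := by gcongr
    _ = C * 4 ^ (L + 1) / N * (B ^ 2 / 2 ^ L) ^ k / 2 / 2 ^ (j + 1) := by
        simp only [mul_pow, div_pow, one_pow, pow_succ, ← pow_mul]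
        rw [mul_comm L k, mul_comm 2 k, pow_mul B k 2]
        field_simp
        ring

theorem exists_abs_lineInt_ringTail_succ_le (L : ℕ) :
    ∃ X : ℝ, 0 ≤ X ∧ ∀ (B : ℝ) (N k : ℕ) (K φ p e : ℝ), 1 < B → 1 ≤ N → p ∈ scaleRange (k + 1) →
      |lineInt (ringPiece N K 0) φ p| ≤ e →
      |lineInt (ringTail B N K (k + 1)) φ p| ≤
        (2 ^ (L + 1) * e + X / N) * (B ^ 2 / 2 ^ L) ^ (k + 1) := by
  obtain ⟨C, hC, hosc⟩ := exists_abs_lineInt_succ_le (L + 1)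
  refine ⟨C * 4 ^ (L + 1), by positivity, fun B N k K φ p e hB hN hp he => ?_⟩
  have he0 : 0 ≤ e := (abs_nonneg _).trans he
  refine abs_lineInt_ringTail_le_of_forall hB fun j => ?_
  by_cases hkj : k + 1 ≤ j + 1
  swap
  · rw [tailCoeff, if_neg hkj, zero_mul]
    positivity
  cases j with
  | zero =>
    obtain rfl : k = 0 := by omega
    have hX : 0 ≤ C * 4 ^ (L + 1) / N := by positivity
    calc tailCoeff B (0 + 1) 0 * |lineInt (ringPiece N K 0) φ p|
        ≤ B ^ (2 * (0 + 1)) * e := by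
          gcongr
          exact tailCoeff_le hB.le _ _
      _ = 2 ^ (L + 1) * e * (B ^ 2 / 2 ^ L) ^ (0 + 1) / 2 / 2 ^ 0 := by
          rw [pow_succ 2 L, zero_add, mul_one, pow_one, pow_zero, div_one]
          field_simp
      _ ≤ _ := by
          gcongr
          linarith
  | succ j =>
    calc tailCoeff B (k + 1) (j + 1) * |lineInt (ringPiece N K (j + 1)) φ p|
        ≤ tailCoeff B (k + 1) (j + 1) * (C * (2 * (1 / 2) ^ (j + 1) / N) ^ (L + 1)) :=
          mul_le_mul_of_nonneg_left (hosc N j K φ p hN (half_le_abs_of_mem_scaleRange hp))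
            (tailCoeff_nonneg hB.le _ _)
      _ ≤ C * 4 ^ (L + 1) / N * (B ^ 2 / 2 ^ L) ^ (k + 1) / 2 / 2 ^ (j + 1) :=
          tailCoeff_mul_oscillation_le hB.le hN hC L hkj
      _ ≤ _ := by
          gcongr
          exact le_add_of_nonneg_left (by positivity)

theorem exists_abs_lineInt_ringTail_le (L : ℕ) :
    ∃ X : ℝ, 0 ≤ X ∧ ∀ (B : ℝ) (N k : ℕ) (K φ p e : ℝ), 2 ≤ B → 1 ≤ N → p ∈ scaleRange k →
      |lineInt (ringPiece N K 0) φ p| ≤ e →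
      |lineInt (ringTail B N K k) φ p| ≤
        (2 ^ (L + 1) * e + X / N + 8 / B) * (B ^ 2 / 2 ^ L) ^ k := by
  obtain ⟨X, hX, hsucc⟩ := exists_abs_lineInt_ringTail_succ_le L
  refine ⟨X, hX, fun B N k K φ p e hB hN hp he => ?_⟩
  have he0 : 0 ≤ e := (abs_nonneg _).trans he
  cases k with
  | zero =>
    have hL : 2 * e ≤ 2 ^ (L + 1) * e :=
      mul_le_mul_of_nonneg_right (le_self_pow₀ one_le_two L.succ_ne_zero) he0
    have hXN : 0 ≤ X / N := by positivity
    rw [pow_zero, mul_one]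
    linarith [abs_lineInt_ringTail_zero_le hB he]
  | succ k =>
    refine (hsucc B N k K φ p e (by linarith) hN hp he).trans ?_
    exact mul_le_mul_of_nonneg_right (le_add_of_nonneg_right (by positivity)) (by positivity)

theorem abs_lineInt_ringTail_rapidDecay (hB : 2 ≤ B) (hN : 1 ≤ N) {e : ℝ}
    (he : ∀ φ p, |lineInt (ringPiece N K 0) φ p| ≤ e) {r : ℝ} (hr : 0 < r) :
    ∃ C : ℝ, 0 ≤ C ∧ ∀ (k : ℕ) (φ : ℝ), ∀ p ∈ scaleRange k,
      |lineInt (ringTail B N K k) φ p| ≤ C * r ^ k := by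
  obtain ⟨L, hL⟩ := pow_unbounded_of_one_lt (B ^ 2 / r) (one_lt_two (α := ℝ))
  obtain ⟨X, hX, htail⟩ := exists_abs_lineInt_ringTail_le L
  have he0 : 0 ≤ e := (abs_nonneg _).trans (he 0 0)
  refine ⟨2 ^ (L + 1) * e + X / N + 8 / B, by positivity, fun k φ p hp =>
    (htail B N k K φ p e hB hN hp (he φ p)).trans ?_⟩
  gcongr
  rw [div_lt_iff₀ hr] at hL
  rw [div_le_iff₀ (by positivity), mul_comm]
  exact hL.le

theorem exists_ring_parameters :
    ∃ (B : ℝ) (N : ℕ) (K c : ℝ), 1 < B ∧ 0 < c ∧ RingLowerBound N K c ∧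
      (∀ (k : ℕ) (φ : ℝ), ∀ p ∈ scaleRange k,
        |lineInt (ringTail B N K k) φ p| ≤ 1 / 3 * (c / 2 ^ (k + 1))) ∧
      ∀ r : ℝ, 0 < r → ∃ C : ℝ, 0 ≤ C ∧ ∀ (k : ℕ) (φ : ℝ), ∀ p ∈ scaleRange k,
        |lineInt (ringTail B N K k) φ p| ≤ C * r ^ k := by
  obtain ⟨c, hc, N₀, K₀, hlow⟩ := exists_ringLowerBound
  obtain ⟨C₀, hzero⟩ := exists_abs_lineInt_zero_le
  set B : ℝ := max 2 (144 / c)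
  have hB2 : 2 ≤ B := le_max_left _ _
  have hBc : 8 / B ≤ c / 18 := by
    rw [div_le_div_iff₀ (by linarith) (by norm_num)]
    linarith [(div_le_iff₀ hc).1 (le_max_right 2 (144 / c))]
  obtain ⟨L, hL⟩ := pow_unbounded_of_one_lt (2 * B ^ 2) (one_lt_two (α := ℝ))
  obtain ⟨X, -, htail⟩ := exists_abs_lineInt_ringTail_le L
  obtain ⟨N, hN, hN0, hXN⟩ : ∃ N : ℕ, 1 ≤ N ∧ N₀ ≤ N ∧ X / N ≤ c / 18 :=
    ((Filter.eventually_ge_atTop 1).and ((Filter.eventually_ge_atTop N₀).and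
      ((tendsto_const_div_atTop_nhds_zero_nat X).eventually_le_const (by positivity)))).exists
  have hlim : Filter.Tendsto (fun K => 2 ^ (L + 1) * (C₀ / √K)) Filter.atTop (nhds 0) := by
    simpa using (tendsto_const_nhds.div_atTop Real.tendsto_sqrt_atTop).const_mul (2 ^ (L + 1))
  obtain ⟨K, hK, hK0, hCK⟩ : ∃ K : ℝ, 0 < K ∧ K₀ ≤ K ∧ 2 ^ (L + 1) * (C₀ / √K) ≤ c / 18 :=
    ((Filter.eventually_gt_atTop 0).and ((Filter.eventually_ge_atTop K₀).and
      (hlim.eventually_le_const (by positivity)))).exists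
  have he (φ p : ℝ) : |lineInt (ringPiece N K 0) φ p| ≤ C₀ / √K := hzero N K φ p hK
  refine ⟨B, N, K, c, by linarith, hc, hlow N K hN0 hK0, fun k φ p hp => ?_, fun r hr =>
    abs_lineInt_ringTail_rapidDecay hB2 hN he hr⟩
  have hratio : B ^ 2 / 2 ^ L ≤ 1 / 2 := by
    rw [div_le_div_iff₀ (by positivity) two_pos]
    linarith
  calc |lineInt (ringTail B N K k) φ p|
      ≤ (2 ^ (L + 1) * (C₀ / √K) + X / N + 8 / B) * (B ^ 2 / 2 ^ L) ^ k :=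
        htail B N k K φ p _ hB2 hN hp (he φ p)
    _ ≤ (c / 18 + c / 18 + c / 18) * (1 / 2) ^ k := by gcongr
    _ = 1 / 3 * (c / 2 ^ (k + 1)) := by
        rw [one_div_pow, pow_succ]
        ring

end Tails

section Cutoff

/-- A smooth step, from `0` for `s ≤ 5/4` to `1` for `3/2 ≤ s`. -/
noncomputable def scaleStep (s : ℝ) : ℝ := Real.smoothTransition (4 * (s - 5 / 4))

/-- The bump whose dyadic dilates `scaleCut (2 ^ k * s)` form a partition of unity of the
half line `0 < s`. -/
noncomputable def scaleCut (s : ℝ) : ℝ := scaleStep s - scaleStep (s / 2)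

theorem scaleStep_of_le {s : ℝ} (h : s ≤ 5 / 4) : scaleStep s = 0 :=
  Real.smoothTransition.zero_of_nonpos (by linarith)

theorem scaleStep_of_ge {s : ℝ} (h : 3 / 2 ≤ s) : scaleStep s = 1 :=
  Real.smoothTransition.one_of_one_le (by linarith)

theorem contDiff_scaleStep : ContDiff ℝ ∞ scaleStep :=
  Real.smoothTransition.contDiff.comp (contDiff_const.mul (contDiff_id.sub contDiff_const))

theorem contDiff_scaleCut : ContDiff ℝ ∞ scaleCut :=
  contDiff_scaleStep.sub (contDiff_scaleStep.comp (contDiff_id.div_const 2))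

theorem abs_scaleCut_le_one (s : ℝ) : |scaleCut s| ≤ 1 :=
  abs_sub_le_of_nonneg_of_le (Real.smoothTransition.nonneg _) (Real.smoothTransition.le_one _)
    (Real.smoothTransition.nonneg _) (Real.smoothTransition.le_one _)

theorem support_scaleCut_subset : Function.support scaleCut ⊆ Set.Icc (5 / 4) 3 := by
  intro s hs
  by_contra hs'
  refine hs ?_
  rw [Set.mem_Icc, not_and_or, not_le, not_le] at hs'
  rw [scaleCut, sub_eq_zero]
  rcases hs' with h | h
  · rw [scaleStep_of_le h.le]
    exact (Real.smoothTransition.zero_of_nonpos (by linarith)).symm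
  · rw [scaleStep_of_ge (by linarith), scaleStep_of_ge (by linarith)]

theorem hasCompactSupport_scaleCut : HasCompactSupport scaleCut :=
  .of_support_subset_isCompact isCompact_Icc support_scaleCut_subset

theorem mem_scaleRange_of_scaleCut_ne_zero {k : ℕ} {p : ℝ}
    (h : scaleCut (2 ^ (k + 1) * (1 - p ^ 2)) ≠ 0) : p ∈ scaleRange k :=
  support_scaleCut_subset h

theorem sum_scaleCut {s : ℝ} {n : ℕ} (hs : s ≤ 5 / 4) (hn : 3 / 2 ≤ 2 ^ n * s) :
    ∑ k ∈ Finset.range n, scaleCut (2 ^ (k + 1) * s) = 1 := by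
  have hterm (k : ℕ) :
      scaleCut (2 ^ (k + 1) * s) = scaleStep (2 ^ (k + 1) * s) - scaleStep (2 ^ k * s) := by
    rw [scaleCut, pow_succ]
    ring_nf
  simp_rw [hterm]
  rw [Finset.sum_range_sub fun k => scaleStep (2 ^ k * s), scaleStep_of_ge hn, pow_zero, one_mul,
    scaleStep_of_le hs, sub_zero]

theorem exists_forall_scaleCut_eq_zero {s : ℝ} (hs : 0 < s) :
    ∃ n : ℕ, 3 / 2 ≤ 2 ^ n * s ∧ ∀ k, n ≤ k → scaleCut (2 ^ (k + 1) * s) = 0 := by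
  obtain ⟨n, hn⟩ := pow_unbounded_of_one_lt (3 / 2 / s) (one_lt_two (α := ℝ))
  rw [div_lt_iff₀ hs] at hn
  refine ⟨n, hn.le, fun k hk => by_contra fun hne => ?_⟩
  have hpow : 2 ^ n * s ≤ 2 ^ k * s := by
    gcongr
    exact one_le_two
  have hle := (support_scaleCut_subset hne).2
  rw [pow_succ] at hle
  linarith

end Cutoff

section LineIntegrals

/-- The signed distance from the origin of the line through `z` with direction `e^{iφ}`, as a
function of `(z, φ)`. -/
noncomputable def lineHeight (x : ℂ × ℝ) : ℝ := (Complex.exp (-(x.2 * Complex.I)) * x.1).im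

/-- The integral of a function over a segment with center `z` and direction `e^{iφ}`. The segment
covers the chord of the unit disc through `z`, so that this is the integral over the line for
functions supported in the disc, but the bounded range makes it smooth in `(z, φ)`. -/
noncomputable def segInt (h : ℂ → ℝ) (x : ℂ × ℝ) : ℝ :=
  ∫ t in (-3 : ℝ)..3, h (x.1 + t * Complex.exp (x.2 * Complex.I))

theorem contDiff_lineHeight : ContDiff ℝ ∞ lineHeight := by
  have hexp : ContDiff ℝ ∞ fun x : ℂ × ℝ => Complex.exp (-(x.2 * Complex.I)) * x.1 :=
    ((((Complex.ofRealCLM.contDiff.comp contDiff_snd).mul contDiff_const).neg).cexp).mul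
      contDiff_fst
  exact Complex.imCLM.contDiff.comp hexp

theorem GeomBounded.segInt {S : Set (ℂ × ℝ)} (hS : IsCompact S) {h : ℕ → ℂ → ℝ}
    (hh : GeomBounded Set.univ h) : GeomBounded S (fun k x => segInt (h k) x) := by
  have hline : ContDiff ℝ ∞ fun y : (ℂ × ℝ) × ℝ =>
      y.1.1 + y.2 * Complex.exp (y.1.2 * Complex.I) :=
    (contDiff_fst.comp contDiff_fst).add ((Complex.ofRealCLM.contDiff.comp contDiff_snd).mul
      (((Complex.ofRealCLM.contDiff.comp (contDiff_snd.comp contDiff_fst)).mul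
        contDiff_const).cexp))
  exact .intervalIntegral (hh.comp (.const (hS.prod isCompact_uIcc) hline)
    fun _ => Set.mapsTo_univ _ _)

theorem linePt_lineHeight (x : ℂ × ℝ) (t : ℝ) :
    linePt x.2 (lineHeight x) (t + (Complex.exp (-(x.2 * Complex.I)) * x.1).re) =
      x.1 + t * Complex.exp (x.2 * Complex.I) := by
  have hcoord : ((t + (Complex.exp (-(x.2 * Complex.I)) * x.1).re : ℝ) : ℂ) +
      lineHeight x * Complex.I = t + Complex.exp (-(x.2 * Complex.I)) * x.1 := by
    rw [lineHeight, Complex.ofReal_add, add_assoc, Complex.re_add_im]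
  rw [linePt, hcoord, mul_add, ← mul_assoc, ← Complex.exp_add, add_neg_cancel, Complex.exp_zero,
    one_mul, mul_comm, add_comm]

theorem lineHeight_linePt (φ p t : ℝ) : lineHeight (linePt φ p t, φ) = p := by
  rw [lineHeight, linePt, ← mul_assoc, ← Complex.exp_add, neg_add_cancel, Complex.exp_zero,
    one_mul]
  simp

theorem segInt_eq_lineInt {h : ℂ → ℝ} (h0 : ∀ z, 1 ≤ ‖z‖ → h z = 0) {x : ℂ × ℝ}
    (hx : ‖x.1‖ ≤ 1) : segInt h x = lineInt h x.2 (lineHeight x) := by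
  rw [segInt, lineInt, intervalIntegral.integral_of_le (by norm_num),
    setIntegral_eq_integral_of_forall_compl_eq_zero,
    ← integral_add_right_eq_self (fun t => h (linePt x.2 (lineHeight x) t))
      (Complex.exp (-(x.2 * Complex.I)) * x.1).re]
  · simp_rw [linePt_lineHeight]
  · intro t ht
    have habs : 3 ≤ |t| := not_lt.1 fun hlt => ht ⟨(abs_lt.1 hlt).1, (abs_lt.1 hlt).2.le⟩
    have htri := norm_sub_le (x.1 + t * Complex.exp (x.2 * Complex.I)) x.1
    rw [add_sub_cancel_left, norm_mul, Complex.norm_exp_ofReal_mul_I, mul_one,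
      Complex.norm_real, Real.norm_eq_abs] at htri
    exact h0 _ (by linarith)

theorem segInt_congr_exp (h : ℂ → ℝ) (z : ℂ) {φ φ' : ℝ}
    (he : Complex.exp (φ * Complex.I) = Complex.exp (φ' * Complex.I)) :
    segInt h (z, φ) = segInt h (z, φ') := by
  simp only [segInt, he]

theorem lineHeight_congr_exp (z : ℂ) {φ φ' : ℝ}
    (he : Complex.exp (φ * Complex.I) = Complex.exp (φ' * Complex.I)) :
    lineHeight (z, φ) = lineHeight (z, φ') := by
  simp only [lineHeight, Complex.exp_neg, he]

theorem exp_add_int_mul_two_pi (φ : ℝ) (n : ℤ) :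
    Complex.exp ((φ + n * (2 * Real.pi) : ℝ) * Complex.I) = Complex.exp (φ * Complex.I) := by
  rw [Complex.exp_eq_exp_iff_exists_int]
  exact ⟨n, by push_cast; ring⟩

end LineIntegrals

section Correction

variable {B : ℝ} {N : ℕ} {K c : ℝ}

/-- The contribution of the lines of scale `k` to the deviation of the weight from a constant.
On the unit disc it is the cutoff to these lines, times `ringPiece k`, times the quotient of the
line integrals of `ringTail k` and `ringPiece k ^ 2`. -/
noncomputable def correctionTerm (B : ℝ) (N : ℕ) (K c : ℝ) (k : ℕ) (x : ℂ × ℝ) : ℝ :=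
  scaleCut (2 ^ (k + 1) * (1 - lineHeight x ^ 2)) * ringPiece N K k x.1 *
    segInt (ringTail B N K k) x *
      (2 ^ (k + 1) / c * invCut (2 ^ (k + 1) / c * segInt (fun z => ringPiece N K k z ^ 2) x))

theorem correctionTerm_eq_zero_of_one_le_norm (k : ℕ) {x : ℂ × ℝ} (hx : 1 ≤ ‖x.1‖) :
    correctionTerm B N K c k x = 0 := by
  rw [correctionTerm, ringPiece_eq_zero_of_one_le_norm k hx, mul_zero, zero_mul, zero_mul]

theorem correctionTerm_congr_exp (k : ℕ) (z : ℂ) {φ φ' : ℝ}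
    (he : Complex.exp (φ * Complex.I) = Complex.exp (φ' * Complex.I)) :
    correctionTerm B N K c k (z, φ) = correctionTerm B N K c k (z, φ') := by
  simp only [correctionTerm, segInt_congr_exp _ z he, lineHeight_congr_exp z he]

theorem GeomBounded.of_periodic {S : Set ℂ} {T : ℝ} (hT : 0 < T) {F : ℕ → ℂ × ℝ → ℝ}
    (hF : GeomBounded (S ×ˢ Set.Icc 0 T) F)
    (hp : ∀ k z (φ : ℝ) (n : ℤ), F k (z, φ + n * T) = F k (z, φ)) :
    GeomBounded (S ×ˢ Set.univ) F := by
  refine ⟨hF.smooth, fun m => ?_⟩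
  obtain ⟨R, hR, hb⟩ := hF.bound m
  refine ⟨R, hR, fun k x hx => ?_⟩
  obtain ⟨n, hn, -⟩ := existsUnique_add_zsmul_mem_Ico hT x.2 0
  rw [zsmul_eq_mul, zero_add] at hn
  have hshift : (fun y => F k (y + (0, n * T))) = F k := by
    ext ⟨z, φ⟩
    rw [Prod.mk_add_mk, add_zero, hp]
  rw [← hshift, iteratedFDeriv_comp_add_right]
  exact hb k _ ⟨by simpa using hx.1, Set.Ico_subset_Icc_self hn⟩

theorem abs_two_pow_div_le (c : ℝ) (k : ℕ) :
    |2 ^ (k + 1) / c| ≤ (2 * max |1 / c| 1) ^ (k + 1) := by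
  rw [mul_pow, div_eq_mul_one_div, abs_mul, abs_of_nonneg (by positivity : (0 : ℝ) ≤ 2 ^ (k + 1))]
  gcongr
  exact le_pow_succ_of_le (le_max_right _ _) (le_max_left _ _) k

theorem geomBounded_scaleCut_lineHeight {S : Set (ℂ × ℝ)} (hS : IsCompact S) :
    GeomBounded S fun k x => scaleCut (2 ^ (k + 1) * (1 - lineHeight x ^ 2)) :=
  (GeomBounded.const_of_hasCompactSupport contDiff_scaleCut hasCompactSupport_scaleCut).comp
    ((GeomBounded.const hS (contDiff_const.sub (contDiff_lineHeight.pow 2))).const_mul one_le_two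
      fun k => by rw [abs_of_nonneg (by positivity)]) fun _ => Set.mapsTo_univ _ _

theorem geomBounded_invCut_segInt_sq {S : Set (ℂ × ℝ)} (hS : IsCompact S) (N : ℕ) (K c : ℝ) :
    GeomBounded S fun k x => 2 ^ (k + 1) / c *
      invCut (2 ^ (k + 1) / c * segInt (fun z => ringPiece N K k z ^ 2) x) := by
  have hr : 1 ≤ 2 * max |1 / c| 1 := by linarith [le_max_right |1 / c| 1]
  have hsq : GeomBounded S fun k x => segInt (fun z => ringPiece N K k z ^ 2) x := by
    simpa only [pow_two] using ((geomBounded_ringPiece N K).mul (geomBounded_ringPiece N K)).segInt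
      hS
  have hinv : GeomBounded Set.univ fun _ : ℕ => invCut :=
    .const_of_bound contDiff_invCut fun m =>
      (exists_bound_iteratedFDeriv_invCut m).imp fun _ hC x _ => hC x
  exact (hinv.comp (hsq.const_mul hr (abs_two_pow_div_le c))
    fun _ => Set.mapsTo_univ _ _).const_mul hr (abs_two_pow_div_le c)

theorem geomBounded_correctionTerm (hB : 1 < B) :
    GeomBounded Set.univ (correctionTerm B N K c) := by
  have hS : IsCompact (closedBall (0 : ℂ) 1 ×ˢ Set.Icc 0 (2 * Real.pi)) :=
    (isCompact_closedBall _ _).prod isCompact_Icc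
  have hpiece : GeomBounded (closedBall (0 : ℂ) 1 ×ˢ Set.Icc 0 (2 * Real.pi))
      fun k x => ringPiece N K k x.1 :=
    (geomBounded_ringPiece N K).comp (.const hS contDiff_fst) fun _ => Set.mapsTo_univ _ _
  have hcompact : GeomBounded (closedBall (0 : ℂ) 1 ×ˢ Set.Icc 0 (2 * Real.pi))
      (correctionTerm B N K c) :=
    (((geomBounded_scaleCut_lineHeight hS).mul hpiece).mul
      ((geomBounded_ringTail hB).segInt hS)).mul (geomBounded_invCut_segInt_sq hS N K c)
  refine (hcompact.of_periodic Real.two_pi_pos fun k z φ n => correctionTerm_congr_exp k z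
    (exp_add_int_mul_two_pi φ n)).of_eventuallyEq_zero fun k x hx => ?_
  have hnorm : 1 < ‖x.1‖ := by simpa using hx
  filter_upwards [continuous_fst.norm.continuousAt.eventually_const_lt hnorm] with y hy
  exact correctionTerm_eq_zero_of_one_le_norm k hy.le

theorem lineInt_sq_pos (hc : 0 < c) (hlow : RingLowerBound N K c) {k : ℕ} {p : ℝ}
    (hp : p ∈ scaleRange k) (φ : ℝ) : 0 < lineInt (fun z => ringPiece N K k z ^ 2) φ p :=
  lt_of_lt_of_le (by positivity) (hlow k φ p hp)

theorem correctionTerm_eq (hc : 0 < c) (hlow : RingLowerBound N K c) (k : ℕ) {x : ℂ × ℝ}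
    (hx : ‖x.1‖ ≤ 1) :
    correctionTerm B N K c k x =
      scaleCut (2 ^ (k + 1) * (1 - lineHeight x ^ 2)) * ringPiece N K k x.1 *
        (lineInt (ringTail B N K k) x.2 (lineHeight x) /
          lineInt (fun z => ringPiece N K k z ^ 2) x.2 (lineHeight x)) := by
  have hsq0 (z : ℂ) (hz : 1 ≤ ‖z‖) : ringPiece N K k z ^ 2 = 0 := by
    rw [ringPiece_eq_zero_of_one_le_norm k hz, zero_pow two_ne_zero]
  rw [correctionTerm, segInt_eq_lineInt (fun _ => ringTail_eq_zero_of_one_le_norm k) hx,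
    segInt_eq_lineInt hsq0 hx]
  by_cases hcut : scaleCut (2 ^ (k + 1) * (1 - lineHeight x ^ 2)) = 0
  · simp only [hcut, zero_mul]
  have hp := mem_scaleRange_of_scaleCut_ne_zero hcut
  have hone : 1 ≤ 2 ^ (k + 1) / c *
      lineInt (fun z => ringPiece N K k z ^ 2) x.2 (lineHeight x) := by
    rw [← div_le_iff₀' (by positivity), one_div_div]
    exact hlow k x.2 _ hp
  have := (lineInt_sq_pos hc hlow hp x.2).ne'
  rw [invCut_of_one_le hone]
  field_simp

theorem abs_correctionTerm_le (hc : 0 < c) (hlow : RingLowerBound N K c) {k : ℕ} {a : ℝ}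
    (ha : 0 ≤ a) (hb : ∀ φ, ∀ p ∈ scaleRange k,
      |lineInt (ringTail B N K k) φ p| ≤ a * (c / 2 ^ (k + 1))) (x : ℂ × ℝ) :
    |correctionTerm B N K c k x| ≤ a := by
  rcases le_or_gt 1 ‖x.1‖ with hx | hx
  · rwa [correctionTerm_eq_zero_of_one_le_norm k hx, abs_zero]
  rw [correctionTerm_eq hc hlow k hx.le]
  by_cases hcut : scaleCut (2 ^ (k + 1) * (1 - lineHeight x ^ 2)) = 0
  · rwa [hcut, zero_mul, zero_mul, abs_zero]
  have hp := mem_scaleRange_of_scaleCut_ne_zero hcut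
  have hpos := lineInt_sq_pos hc hlow hp x.2
  have hquot : |lineInt (ringTail B N K k) x.2 (lineHeight x)| /
      lineInt (fun z => ringPiece N K k z ^ 2) x.2 (lineHeight x) ≤ a :=
    (div_le_iff₀ hpos).2 ((hb x.2 _ hp).trans
      (mul_le_mul_of_nonneg_left (hlow k x.2 _ hp) ha))
  rw [abs_mul, abs_mul, abs_div, abs_of_pos hpos]
  exact (mul_le_of_le_one_left (by positivity) (mul_le_one₀ (abs_scaleCut_le_one _) (abs_nonneg _)
    (abs_ringPiece_le_one _ _))).trans hquot

theorem abs_tsum_correctionTerm_le {a : ℝ} (ha : 0 ≤ a)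
    (hb : ∀ k x, |correctionTerm B N K c k x| ≤ a) (x : ℂ × ℝ) :
    |∑' k, correctionTerm B N K c k x| ≤ a := by
  by_cases h : ∃ k, ringPiece N K k x.1 ≠ 0
  · obtain ⟨k, hk⟩ := h
    rw [tsum_eq_single k fun j hj => ?_]
    · exact hb k x
    · have hj0 : ringPiece N K j x.1 = 0 := by_contra fun hne => hj (eq_of_ringPiece_ne_zero hne hk)
      rw [correctionTerm, hj0, mul_zero, zero_mul, zero_mul]
  · push Not at h
    simpa [correctionTerm, h] using ha

theorem correctionTerm_mul_ringTail_zero (hc : 0 < c) (hB : 1 < B) (hlow : RingLowerBound N K c)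
    (k : ℕ) (φ p t : ℝ) :
    correctionTerm B N K c k (linePt φ p t, φ) * ringTail B N K 0 (linePt φ p t) =
      scaleCut (2 ^ (k + 1) * (1 - p ^ 2)) *
        (lineInt (ringTail B N K 0) φ p / lineInt (fun z => ringPiece N K k z ^ 2) φ p) *
          ringPiece N K k (linePt φ p t) ^ 2 := by
  rcases le_or_gt 1 ‖linePt φ p t‖ with h | h
  · simp [ringTail_eq_zero_of_one_le_norm _ h, ringPiece_eq_zero_of_one_le_norm _ h]
  rw [correctionTerm_eq hc hlow k h.le]
  simp only [lineHeight_linePt]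
  by_cases hcut : scaleCut (2 ^ (k + 1) * (1 - p ^ 2)) = 0
  · simp only [hcut, zero_mul]
  have hpiece := ringPiece_mul_ringTail_zero (B := B) (N := N) (K := K) k (linePt φ p t)
  have : B ^ k ^ 2 ≠ 0 := by positivity
  rw [eq_div_iff this] at hpiece
  rw [lineInt_ringTail_eq (mem_scaleRange_of_scaleCut_ne_zero hcut), ← hpiece]
  ring

theorem integral_correctionTerm_mul (hc : 0 < c) (hB : 1 < B) (hlow : RingLowerBound N K c)
    (k : ℕ) (φ p : ℝ) :
    ∫ t, correctionTerm B N K c k (linePt φ p t, φ) * ringTail B N K 0 (linePt φ p t) =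
      scaleCut (2 ^ (k + 1) * (1 - p ^ 2)) * lineInt (ringTail B N K 0) φ p := by
  simp_rw [correctionTerm_mul_ringTail_zero hc hB hlow]
  rw [integral_const_mul, ← lineInt.eq_def (fun z => ringPiece N K k z ^ 2)]
  by_cases hcut : scaleCut (2 ^ (k + 1) * (1 - p ^ 2)) = 0
  · simp only [hcut, zero_mul]
  rw [mul_assoc, div_mul_cancel₀ _
    (lineInt_sq_pos hc hlow (mem_scaleRange_of_scaleCut_ne_zero hcut) φ).ne']

theorem integrable_correctionTerm_mul (hB : 1 < B) (k : ℕ) (φ p : ℝ) :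
    Integrable fun t =>
      correctionTerm B N K c k (linePt φ p t, φ) * ringTail B N K 0 (linePt φ p t) :=
  integrable_comp_linePt
    (h := fun z => correctionTerm B N K c k (z, φ) * ringTail B N K 0 z)
    ((((geomBounded_correctionTerm hB).smooth k).continuous.comp (by fun_prop)).mul
      ((geomBounded_ringTail hB).smooth 0).continuous)
    (fun z hz => by rw [ringTail_eq_zero_of_one_le_norm 0 hz, mul_zero]) φ p

theorem integral_tsum_correctionTerm_mul (hc : 0 < c) (hB : 1 < B)
    (hlow : RingLowerBound N K c) (φ : ℝ) {p : ℝ} (hp : p ^ 2 < 1) :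
    Integrable (fun t =>
      (∑' k, correctionTerm B N K c k (linePt φ p t, φ)) * ringTail B N K 0 (linePt φ p t)) ∧
    ∫ t, (∑' k, correctionTerm B N K c k (linePt φ p t, φ)) * ringTail B N K 0 (linePt φ p t) =
      lineInt (ringTail B N K 0) φ p := by
  obtain ⟨n, hn, hcut⟩ := exists_forall_scaleCut_eq_zero (sub_pos.2 hp)
  have hfin (t : ℝ) :
      (∑' k, correctionTerm B N K c k (linePt φ p t, φ)) * ringTail B N K 0 (linePt φ p t) =
        ∑ k ∈ Finset.range n,
          correctionTerm B N K c k (linePt φ p t, φ) * ringTail B N K 0 (linePt φ p t) := by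
    rw [← tsum_mul_right]
    refine tsum_eq_sum fun k hk => ?_
    rw [correctionTerm_mul_ringTail_zero hc hB hlow,
      hcut k (not_lt.1 fun h => hk (Finset.mem_range.2 h)), zero_mul, zero_mul]
  simp_rw [hfin]
  refine ⟨integrable_finsetSum _ fun k _ => integrable_correctionTerm_mul hB k φ p, ?_⟩
  rw [integral_finsetSum _ fun k _ => integrable_correctionTerm_mul hB k φ p]
  simp_rw [integral_correctionTerm_mul hc hB hlow]
  rw [← Finset.sum_mul, sum_scaleCut (by linarith [sq_nonneg p]) hn, one_mul]

theorem integral_one_sub_correction_mul_eq_zero (hc : 0 < c) (hB : 1 < B)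
    (hlow : RingLowerBound N K c) (φ p : ℝ) :
    ∫ t, (1 - ∑' k, correctionTerm B N K c k (linePt φ p t, φ)) *
      ringTail B N K 0 (linePt φ p t) = 0 := by
  rcases le_or_gt 1 (p ^ 2) with hp | hp
  · have hzero (t : ℝ) : ringTail B N K 0 (linePt φ p t) = 0 :=
      ringTail_eq_zero_of_one_le_norm 0 (one_le_norm_linePt φ (by linarith [sq_nonneg t]))
    simp_rw [hzero, mul_zero]
    exact integral_zero _ _
  obtain ⟨hint, heq⟩ := integral_tsum_correctionTerm_mul hc hB hlow φ hp
  simp_rw [sub_mul, one_mul]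
  rw [integral_sub (integrable_comp_linePt ((geomBounded_ringTail hB).smooth 0).continuous
    (fun _ => ringTail_eq_zero_of_one_le_norm 0) φ p) hint, heq, lineInt, sub_self]

theorem ringTail_zero_ne_zero (hc : 0 < c) (hlow : RingLowerBound N K c) :
    ringTail B N K 0 ≠ 0 := by
  intro h0
  have hsq (z : ℂ) : ringPiece N K 0 z ^ 2 = 0 := by
    simpa [h0] using (ringPiece_mul_ringTail_zero (B := B) (N := N) (K := K) 0 z).symm
  have hpos := lineInt_sq_pos hc hlow (k := 0) (p := 0) (by norm_num [scaleRange]) 0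
  simp_rw [lineInt, hsq, integral_zero] at hpos
  exact hpos.false

theorem exists_complex_boman_pair :
    ∃ (f : ℂ → ℝ) (G : ℂ × ℝ → ℝ), ContDiff ℝ ∞ f ∧ ContDiff ℝ ∞ G ∧ f ≠ 0 ∧
      (∀ z, 1 ≤ ‖z‖ → f z = 0) ∧ (∀ x, |G x| ≤ 1 / 3) ∧
      (∀ (z : ℂ) (φ φ' : ℝ), Complex.exp (φ * Complex.I) = Complex.exp (φ' * Complex.I) →
        G (z, φ) = G (z, φ')) ∧
      ∀ φ p : ℝ, ∫ t, (1 - G (linePt φ p t, φ)) * f (linePt φ p t) = 0 := by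
  obtain ⟨B, N, K, c, hB, hc, hlow, hthird, hrapid⟩ := exists_ring_parameters
  have hdecay : RapidDecay (correctionTerm B N K c) := by
    intro r hr
    obtain ⟨C, hC, hb⟩ := hrapid (r / 2) (by positivity)
    refine ⟨2 * C / c, by positivity, fun k => abs_correctionTerm_le hc hlow (by positivity)
      fun φ p hp => (hb k φ p hp).trans_eq ?_⟩
    rw [div_pow, pow_succ]
    field_simp
  exact ⟨ringTail B N K 0, fun x => ∑' k, correctionTerm B N K c k x,
    (geomBounded_ringTail hB).smooth 0, (geomBounded_correctionTerm hB).contDiff_tsum hdecay,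
    ringTail_zero_ne_zero hc hlow, fun _ => ringTail_eq_zero_of_one_le_norm 0,
    abs_tsum_correctionTerm_le (by norm_num) fun k =>
      abs_correctionTerm_le hc hlow (by norm_num) (hthird k),
    fun z φ φ' he => by simp_rw [correctionTerm_congr_exp _ z he],
    integral_one_sub_correction_mul_eq_zero hc hB hlow⟩

end Correction

section PlanarWeight

theorem contMDiff_coe_sph {n : ℕ} :
    ContMDiff (𝓡 (n + 1)) 𝓘(ℝ, Euc (n + 2)) ∞ (Subtype.val : Sph (n + 2) → Euc (n + 2)) := by
  have := Fact.mk (finrank_euclideanSpace_fin (𝕜 := ℝ) (n := n + 1 + 1))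
  exact contMDiff_coe_sphere (n := n + 1)

theorem exp_arg_mul_I {w : ℂ} (hw : w ≠ 0) : Complex.exp (w.arg * Complex.I) = w / ‖w‖ := by
  have hnorm : (‖w‖ : ℂ) ≠ 0 := by exact_mod_cast norm_ne_zero_iff.2 hw
  rw [eq_div_iff hnorm, mul_comm, Complex.norm_mul_exp_arg_mul_I]

theorem exp_arg_neg_add_pi_mul_I {w : ℂ} (hw : w ≠ 0) :
    Complex.exp (((-w).arg + Real.pi : ℝ) * Complex.I) = Complex.exp (w.arg * Complex.I) := by
  rw [Complex.ofReal_add, add_mul, Complex.exp_add, Complex.exp_pi_mul_I, exp_arg_mul_I hw,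
    exp_arg_mul_I (neg_ne_zero.2 hw), norm_neg]
  ring

theorem contDiffAt_arg {w : ℂ} (hw : w ∈ Complex.slitPlane) : ContDiffAt ℝ ∞ Complex.arg w := by
  have hlog : ContDiffAt ℝ ∞ Complex.log w := (Complex.contDiffAt_log hw).restrict_scalars ℝ
  exact (Complex.imCLM.contDiff.contDiffAt.comp w hlog).congr_of_eventuallyEq
    (.of_forall fun z => (Complex.log_im z).symm)

variable {E F : Type*} [NormedAddCommGroup E] [NormedSpace ℝ E] [NormedAddCommGroup F]
  [NormedSpace ℝ F] {G : E × ℝ → F}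

theorem contDiffAt_comp_arg (hG : ContDiff ℝ ∞ G)
    (hper : ∀ (z : E) (φ φ' : ℝ), Complex.exp (φ * Complex.I) = Complex.exp (φ' * Complex.I) →
      G (z, φ) = G (z, φ')) {x : E × ℂ} (hx : x.2 ≠ 0) :
    ContDiffAt ℝ ∞ (fun y : E × ℂ => G (y.1, Complex.arg y.2)) x := by
  by_cases h : x.2 ∈ Complex.slitPlane
  · exact hG.contDiffAt.comp x (contDiffAt_fst.prodMk ((contDiffAt_arg h).comp x contDiffAt_snd))
  -- Off the slit plane the branch `arg (-w) + π` of the argument is smooth.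
  have hbranch : ContDiffAt ℝ ∞ (fun y : E × ℂ => Complex.arg (-y.2) + Real.pi) x :=
    (ContDiffAt.comp (g := Complex.arg) x (contDiffAt_arg
      ((Complex.mem_slitPlane_or_neg_mem_slitPlane hx).resolve_left h))
      contDiffAt_snd.neg).add contDiffAt_const
  have hcomp : ContDiffAt ℝ ∞ (fun y : E × ℂ => G (y.1, Complex.arg (-y.2) + Real.pi)) x :=
    hG.contDiffAt.comp x (contDiffAt_fst.prodMk hbranch)
  refine hcomp.congr_of_eventuallyEq ?_
  filter_upwards [continuous_snd.continuousAt.eventually_ne hx] with y hy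
  exact hper _ _ _ (exp_arg_neg_add_pi_mul_I hy).symm

/-- The identification of `ℝ²` with the complex plane. -/
noncomputable def planeToComplex : Euc 2 ≃ₗᵢ[ℝ] ℂ := Complex.orthonormalBasisOneI.repr.symm

theorem planeToComplex_sph_ne_zero (θ : Sph 2) : planeToComplex θ ≠ 0 := by
  simpa using ne_zero_of_mem_unit_sphere θ

theorem exp_arg_planeToComplex (θ : Sph 2) :
    Complex.exp ((planeToComplex θ).arg * Complex.I) = planeToComplex θ := by
  rw [exp_arg_mul_I (planeToComplex_sph_ne_zero θ), planeToComplex.norm_map, norm_eq_of_mem_sphere,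
    Complex.ofReal_one, div_one]

/-- The planar weight given by a correction `G` of a point and the angle of a direction; the factor
`3 / 4` turns the bound `|G| ≤ 1 / 3` into values in `[1 / 2, 1]`. -/
noncomputable def angularWeight (G : ℂ × ℝ → ℝ) (x : Euc 2) (θ : Sph 2) : ℝ :=
  3 / 4 * (1 - G (planeToComplex x, (planeToComplex θ).arg))

variable {G : ℂ × ℝ → ℝ}

theorem angularWeight_bounds (hG : ∀ x, |G x| ≤ 1 / 3) (x : Euc 2) (θ : Sph 2) :
    1 / 2 ≤ angularWeight G x θ ∧ angularWeight G x θ ≤ 1 := by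
  have := abs_le.1 (hG (planeToComplex x, (planeToComplex θ).arg))
  simp only [angularWeight]
  constructor <;> linarith

theorem contMDiff_angularWeight (hG : ContDiff ℝ ∞ G)
    (hper : ∀ (z : ℂ) (φ φ' : ℝ), Complex.exp (φ * Complex.I) = Complex.exp (φ' * Complex.I) →
      G (z, φ) = G (z, φ')) :
    ContMDiff (𝓘(ℝ, Euc 2).prod (𝓡 1)) 𝓘(ℝ, ℝ) ∞ (Function.uncurry (angularWeight G)) := by
  intro y
  have hpoint : ContMDiff (𝓘(ℝ, Euc 2).prod (𝓡 1)) 𝓘(ℝ, ℂ × ℂ) ∞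
      (fun y : Euc 2 × Sph 2 => (planeToComplex y.1, planeToComplex y.2)) :=
    (planeToComplex.contDiff.contMDiff.comp contMDiff_fst).prodMk_space
      (planeToComplex.contDiff.contMDiff.comp (contMDiff_coe_sph.comp contMDiff_snd))
  have hval : ContDiffAt ℝ ∞ (fun z : ℂ × ℂ => 3 / 4 * (1 - G (z.1, z.2.arg)))
      (planeToComplex y.1, planeToComplex y.2) :=
    contDiffAt_const.mul (contDiffAt_const.sub
      (contDiffAt_comp_arg hG hper (planeToComplex_sph_ne_zero y.2)))
  exact ContMDiffAt.comp (g := fun z : ℂ × ℂ => 3 / 4 * (1 - G (z.1, z.2.arg))) y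
    hval.contMDiffAt (hpoint y)

theorem weightedRay_angularWeight_eq_zero {f : ℂ → ℝ}
    (hint : ∀ φ p, ∫ t, (1 - G (linePt φ p t, φ)) * f (linePt φ p t) = 0) (x : Euc 2) (θ : Sph 2) :
    weightedRay (angularWeight G) (fun x => f (planeToComplex x)) x θ = 0 := by
  set φ := (planeToComplex θ).arg with hφ
  set p := lineHeight (planeToComplex x, φ)
  have hline (t : ℝ) : planeToComplex (x + t • (θ : Euc 2)) =
      linePt φ p (t + (Complex.exp (-(φ * Complex.I)) * planeToComplex x).re) := by
    rw [linePt_lineHeight (planeToComplex x, φ), map_add, map_smul, exp_arg_planeToComplex,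
      Complex.real_smul]
  simp only [weightedRay, angularWeight, hline, ← hφ]
  rw [integral_add_right_eq_self fun t => 3 / 4 * (1 - G (linePt φ p t, φ)) * f (linePt φ p t)]
  simp_rw [mul_assoc]
  rw [integral_const_mul, hint, mul_zero]

theorem tsupport_comp_planeToComplex_subset {f : ℂ → ℝ} (hf : ∀ z, 1 ≤ ‖z‖ → f z = 0) :
    tsupport (fun x => f (planeToComplex x)) ⊆ closedBall 0 1 := by
  refine closure_minimal (fun x hx => ?_) isClosed_closedBall
  rw [mem_closedBall_zero_iff]
  by_contra! h
  exact hx (hf _ (by rw [planeToComplex.norm_map]; exact h.le))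

theorem exists_isBomanPair : ∃ w₀ f₀, IsBomanPair w₀ f₀ := by
  obtain ⟨f, G, hf, hG, hf0, hsupp, hbound, hper, hint⟩ := exists_complex_boman_pair
  refine ⟨angularWeight G, fun x => f (planeToComplex x), angularWeight_bounds hbound,
    contMDiff_angularWeight hG hper, hf.comp planeToComplex.contDiff, fun h => hf0 ?_,
    tsupport_comp_planeToComplex_subset hsupp,
    fun x θ _ => weightedRay_angularWeight_eq_zero hint x θ⟩
  funext z
  simpa using congrFun h (planeToComplex.symm z)

end PlanarWeight

section LineFubini

variable {H F : Type*} [NormedAddCommGroup H] [InnerProductSpace ℝ H] [FiniteDimensional ℝ H]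
  [MeasurableSpace H] [BorelSpace H] [NormedAddCommGroup F] [NormedSpace ℝ F] {a : H} {g : H → F}

/-- The isomorphism `(y, t) ↦ y + t a` of `a^⊥ × ℝ` with the whole space, for a unit vector `a`. -/
noncomputable def orthogonalLineEquiv (ha : ‖a‖ = 1) : (ℝ ∙ a)ᗮ × ℝ ≃ᵐ H :=
  MeasurableEquiv.prodComm.trans <|
    (((LinearIsometryEquiv.toSpanUnitSingleton a ha).toMeasurableEquiv.prodCongr
      (.refl _)).trans (MeasurableEquiv.toLp 2 _)).trans
        (ℝ ∙ a).orthogonalDecomposition.symm.toMeasurableEquiv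

theorem orthogonalLineEquiv_apply (ha : ‖a‖ = 1) (q : (ℝ ∙ a)ᗮ × ℝ) :
    orthogonalLineEquiv ha q = q.1 + q.2 • a := by
  exact add_comm (q.2 • a) (q.1 : H)

theorem measurePreserving_orthogonalLineEquiv (ha : ‖a‖ = 1) :
    MeasurePreserving (orthogonalLineEquiv ha) :=
  (ℝ ∙ a).orthogonalDecomposition.symm.measurePreserving.comp
    ((WithLp.volume_preserving_toLp _ _).comp
      (((LinearIsometryEquiv.toSpanUnitSingleton a ha).measurePreserving.prod
        (MeasurePreserving.id _)).comp Measure.measurePreserving_swap))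

theorem integral_eq_integral_integral_add_smul (hg : Integrable g) (ha : ‖a‖ = 1) :
    ∫ x, g x = ∫ y : (ℝ ∙ a)ᗮ, ∫ t : ℝ, g (y + t • a) := by
  have he := measurePreserving_orthogonalLineEquiv ha
  rw [← he.integral_comp', Measure.volume_eq_prod, integral_prod]
  · simp only [orthogonalLineEquiv_apply]
  · exact he.integrable_comp_of_integrable hg

theorem integral_eq_zero_of_integral_add_smul_eq_zero (ha : ‖a‖ = 1)
    (h : ∀ y, ∫ t : ℝ, g (y + t • a) = 0) : ∫ x, g x = 0 := by
  by_cases hg : Integrable g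
  · simp only [integral_eq_integral_integral_add_smul hg ha, h, integral_zero]
  · exact integral_undef hg

end LineFubini

section Coordinates

theorem stdVec_ne_zero {d : ℕ} (i : Fin d) : (stdVec i : Euc d) ≠ 0 := by
  simp [stdVec]

variable {n : ℕ}

theorem contDiff_headPart : ContDiff ℝ ∞ (headPart : Euc (n + 2) → Euc 2) := by
  refine contDiff_euclidean.2 fun i => ?_
  fin_cases i
  · exact (EuclideanSpace.proj (𝕜 := ℝ) (0 : Fin (n + 2))).contDiff
  · exact (EuclideanSpace.proj (𝕜 := ℝ) (1 : Fin (n + 2))).contDiff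

theorem contDiff_tailPart : ContDiff ℝ ∞ (tailPart : Euc (n + 2) → Euc n) :=
  contDiff_euclidean.2 fun i => (EuclideanSpace.proj (𝕜 := ℝ) i.succ.succ).contDiff

theorem norm_sq_eq_headPart_add_tailPart (x : Euc (n + 2)) :
    ‖x‖ ^ 2 = ‖headPart x‖ ^ 2 + ‖tailPart x‖ ^ 2 := by
  simp only [EuclideanSpace.norm_sq_eq, Fin.sum_univ_succ, ← add_assoc]
  simp [headPart, tailPart]

@[simp]
theorem planeVec_apply_zero (a : Euc 2) : (planeVec a : Euc (n + 2)) 0 = a 0 := by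
  simp [planeVec, stdVec]

@[simp]
theorem planeVec_apply_one (a : Euc 2) : (planeVec a : Euc (n + 2)) 1 = a 1 := by
  simp [planeVec, stdVec]

@[simp]
theorem planeVec_apply_succ_succ (a : Euc 2) (i : Fin n) :
    (planeVec a : Euc (n + 2)) i.succ.succ = 0 := by
  simp [planeVec, stdVec, Fin.ext_iff]

theorem headPart_add_smul_planeVec (x : Euc (n + 2)) (a : Euc 2) (t : ℝ) :
    headPart (x + t • planeVec a) = headPart x + t • a := by
  ext i
  fin_cases i <;> simp [headPart]

theorem tailPart_add_smul_planeVec (x : Euc (n + 2)) (a : Euc 2) (t : ℝ) :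
    tailPart (x + t • planeVec a) = tailPart x := by
  ext i
  simp [tailPart]

theorem headPart_planeVec (a : Euc 2) : headPart (planeVec a : Euc (n + 2)) = a := by
  ext i
  fin_cases i <;> simp [headPart]

theorem tailPart_planeVec (a : Euc 2) : tailPart (planeVec a : Euc (n + 2)) = 0 := by
  ext i
  simp [tailPart]

theorem norm_planeVec (a : Euc 2) : ‖(planeVec a : Euc (n + 2))‖ = ‖a‖ := by
  rw [← sq_eq_sq₀ (norm_nonneg _) (norm_nonneg _), norm_sq_eq_headPart_add_tailPart,
    headPart_planeVec, tailPart_planeVec, norm_zero, zero_pow two_ne_zero, add_zero]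

theorem inner_planeVec (a : Euc 2) (x : Euc (n + 2)) :
    ⟪(planeVec a : Euc (n + 2)), x⟫ = a 0 * x 0 + a 1 * x 1 := by
  simp [planeVec, stdVec, inner_add_left, inner_smul_left, EuclideanSpace.inner_single_left]

theorem det_cons_stdVec (w : Euc (n + 2)) :
    Matrix.det (Matrix.of fun i j : Fin (n + 1) =>
      (Fin.cons w fun k : Fin n => stdVec k.succ.succ : Fin (n + 1) → Euc (n + 2)) j i.succ) =
        w 1 := by
  rw [Matrix.det_of_isLowerTriangular]
  · simp [Fin.prod_univ_succ, stdVec]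
  · intro i j (hij : i < j)
    obtain ⟨k, rfl⟩ := Fin.exists_succ_eq.2 (Fin.ne_zero_of_lt hij)
    simp [stdVec, hij.ne]

theorem frameDet_eq (u v : Euc (n + 2)) : frameDet u v = u 0 * v 1 - u 1 * v 0 := by
  rw [frameDet, Matrix.det_succ_row_zero, Fin.sum_univ_succ, Fin.sum_univ_succ,
    ← det_cons_stdVec u, ← det_cons_stdVec v]
  have hminor : (Matrix.of fun i j : Fin (n + 2) =>
      (Fin.cons u (Fin.cons v fun k : Fin n => stdVec k.succ.succ) :
        Fin (n + 2) → Euc (n + 2)) j i).submatrix Fin.succ (Fin.succAbove (Fin.succ 0)) =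
      Matrix.of fun i j : Fin (n + 1) => (Fin.cons u fun k : Fin n => stdVec k.succ.succ :
        Fin (n + 1) → Euc (n + 2)) j i.succ := by
    ext i j
    refine Fin.cases ?_ (fun k => ?_) j <;> simp
  rw [hminor]
  simp [stdVec, Matrix.submatrix, Fin.ext_iff]
  ring

end Coordinates

section DirectionMap

variable {n : ℕ}

theorem isClosed_orthSphere {d : ℕ} (v₁ v₂ : Euc d) : IsClosed (orthSphere v₁ v₂) :=
  (isClosed_eq (by fun_prop) continuous_const).inter (isClosed_eq (by fun_prop) continuous_const)

theorem toSphere_orthSphere {d : ℕ} {v₁ : Euc d} (hv : v₁ ≠ 0) (v₂ : Euc d) :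
    (volume : Measure (Euc d)).toSphere (orthSphere v₁ v₂) = 0 := by
  rw [Measure.toSphere_apply' _ (isClosed_orthSphere _ _).measurableSet]
  refine mul_eq_zero_of_right _ (measure_mono_null (t := ((ℝ ∙ v₁)ᗮ : Set (Euc d))) ?_
    (Measure.addHaar_submodule volume _ fun h => hv ?_))
  · rintro _ ⟨r, -, _, ⟨θ, hθ, rfl⟩, rfl⟩
    exact Submodule.smul_mem _ r (Submodule.mem_orthogonal_singleton_iff_inner_left.2 hθ.1)
  · have hmem : v₁ ∈ (ℝ ∙ v₁)ᗮ := h ▸ Submodule.mem_top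
    exact inner_self_eq_zero.1 (Submodule.mem_orthogonal_singleton_iff_inner_left.1 hmem)

theorem mem_orthSphere_stdVec {θ : Sph (n + 2)} :
    θ ∈ orthSphere (stdVec 0 : Euc (n + 2)) (stdVec 1) ↔
      (θ : Euc (n + 2)) 0 = 0 ∧ (θ : Euc (n + 2)) 1 = 0 := by
  simp [orthSphere, stdVec, EuclideanSpace.inner_single_right]

/-- The vector `(θ₂, -θ₁)`, which spans the line in which `span (e₁, e₂)` meets the hyperplanes
orthogonal to `θ`. -/
noncomputable def rotatedHead (θ : Euc (n + 2)) : Euc 2 := !₂[θ 1, -θ 0]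

theorem contDiff_rotatedHead : ContDiff ℝ ∞ (rotatedHead : Euc (n + 2) → Euc 2) := by
  refine contDiff_euclidean.2 fun i => ?_
  fin_cases i
  · exact (EuclideanSpace.proj (𝕜 := ℝ) (1 : Fin (n + 2))).contDiff
  · exact (EuclideanSpace.proj (𝕜 := ℝ) (0 : Fin (n + 2))).contDiff.neg

theorem rotatedHead_eq_zero_iff {θ : Sph (n + 2)} :
    rotatedHead (θ : Euc (n + 2)) = 0 ↔ θ ∈ orthSphere (stdVec 0) (stdVec 1) := by
  simp [mem_orthSphere_stdVec, rotatedHead, and_comm]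

theorem inner_planeVec_eq_zero_and_frameDet_pos_iff {a : Euc 2} (ha : ‖a‖ = 1)
    {θ : Euc (n + 2)} (hθ : rotatedHead θ ≠ 0) :
    ⟪planeVec a, θ⟫ = 0 ∧ 0 < frameDet (planeVec a) θ ↔
      a = ‖rotatedHead θ‖⁻¹ • rotatedHead θ := by
  have hsq : a 0 ^ 2 + a 1 ^ 2 = 1 := by
    simpa [ha] using (EuclideanSpace.norm_sq_eq a).symm
  rw [inner_planeVec, frameDet_eq, planeVec_apply_zero, planeVec_apply_one]
  constructor
  · rintro ⟨horth, hpos⟩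
    have hrot : rotatedHead θ = (a 0 * θ 1 - a 1 * θ 0) • a := by
      ext i
      fin_cases i
      · change θ 1 = (a 0 * θ 1 - a 1 * θ 0) * a 0
        linear_combination (-θ 1) * hsq + a 1 * horth
      · change -θ 0 = (a 0 * θ 1 - a 1 * θ 0) * a 1
        linear_combination θ 0 * hsq - a 0 * horth
    rw [hrot, norm_smul, ha, mul_one, Real.norm_of_nonneg hpos.le, inv_smul_smul₀ hpos.ne']
  · intro h
    have hnorm : 0 < ‖rotatedHead θ‖ := norm_pos_iff.2 hθ
    rw [eq_inv_smul_iff₀ hnorm.ne'] at h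
    have h1 : ‖rotatedHead θ‖ * a 0 = θ 1 := congrArg (fun v : Euc 2 => v 0) h
    have h0 : ‖rotatedHead θ‖ * a 1 = -θ 0 := congrArg (fun v : Euc 2 => v 1) h
    refine ⟨by linear_combination a 0 * h0 - a 1 * h1, ?_⟩
    convert! hnorm using 1
    linear_combination ‖rotatedHead θ‖ * hsq - a 0 * h1 - a 1 * h0

theorem isDirectionMap_iff {α : Sph (n + 2) → Sph 2} :
    IsDirectionMap α ↔ ∀ θ ∉ orthSphere (stdVec 0) (stdVec 1),
      (α θ : Euc 2) = ‖rotatedHead (θ : Euc (n + 2))‖⁻¹ • rotatedHead (θ : Euc (n + 2)) :=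
  forall₂_congr fun _ hθ => inner_planeVec_eq_zero_and_frameDet_pos_iff (norm_eq_of_mem_sphere _)
    (mt rotatedHead_eq_zero_iff.1 hθ)

theorem exists_isDirectionMap (n : ℕ) : ∃ α : Sph (n + 2) → Sph 2, IsDirectionMap α := by
  have hunit (θ : Sph (n + 2)) : ∃ a : Sph 2, θ ∉ orthSphere (stdVec 0) (stdVec 1) →
      (a : Euc 2) = ‖rotatedHead (θ : Euc (n + 2))‖⁻¹ • rotatedHead (θ : Euc (n + 2)) := by
    by_cases hθ : θ ∈ orthSphere (stdVec 0) (stdVec 1)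
    · exact ⟨⟨stdVec 0, by simp [stdVec]⟩, fun h => absurd hθ h⟩
    · exact ⟨⟨_, by simpa using norm_smul_inv_norm (𝕜 := ℝ) (mt rotatedHead_eq_zero_iff.1 hθ)⟩,
        fun _ => rfl⟩
  choose α hα using hunit
  exact ⟨α, isDirectionMap_iff.2 hα⟩

variable {α : Sph (n + 2) → Sph 2}

theorem IsDirectionMap.inner_eq_zero (hα : IsDirectionMap α) (θ : Sph (n + 2)) :
    ⟪(planeVec (α θ : Euc 2) : Euc (n + 2)), (θ : Euc (n + 2))⟫ = 0 := by
  by_cases hθ : θ ∈ orthSphere (stdVec 0 : Euc (n + 2)) (stdVec 1)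
  · obtain ⟨h0, h1⟩ := mem_orthSphere_stdVec.1 hθ
    rw [inner_planeVec, h0, h1, mul_zero, mul_zero, add_zero]
  · exact (hα θ hθ).1

theorem contMDiffOn_inv_norm_smul_rotatedHead :
    ContMDiffOn (𝓡 (n + 1)) 𝓘(ℝ, Euc 2) ∞
      (fun θ : Sph (n + 2) =>
        ‖rotatedHead (θ : Euc (n + 2))‖⁻¹ • rotatedHead (θ : Euc (n + 2)))
      (orthSphere (stdVec 0) (stdVec 1))ᶜ := by
  intro θ hθ
  have hne := mt rotatedHead_eq_zero_iff.1 hθ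
  have hrot := contDiff_rotatedHead.contDiffAt (x := (θ : Euc (n + 2)))
  exact (ContMDiffAt.comp
    (g := fun x : Euc (n + 2) => ‖rotatedHead x‖⁻¹ • rotatedHead x) θ
    (((hrot.norm ℝ hne).inv (norm_ne_zero_iff.2 hne)).smul hrot).contMDiffAt
    (contMDiff_coe_sph θ)).contMDiffWithinAt

/-- The complement of `Θ(e₁, e₂)`, as an open submanifold of the sphere. -/
def orthSphereCompl (n : ℕ) : TopologicalSpace.Opens (Sph (n + 2)) :=
  ⟨(orthSphere (stdVec 0) (stdVec 1))ᶜ, (isClosed_orthSphere _ _).isOpen_compl⟩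

theorem IsDirectionMap.contMDiffOn (hα : IsDirectionMap α) :
    ContMDiffOn (𝓡 (n + 1)) (𝓡 1) ∞ α (orthSphere (stdVec 0) (stdVec 1))ᶜ := by
  have := Fact.mk (finrank_euclideanSpace_fin (𝕜 := ℝ) (n := 1 + 1))
  have hval : ContMDiff (𝓡 (n + 1)) 𝓘(ℝ, Euc 2) ∞
      (fun θ : orthSphereCompl n => (α θ : Euc 2)) := fun θ => by
    refine (contMDiffAt_subtype_iff (f := fun θ : Sph (n + 2) => (α θ : Euc 2))).2 ?_
    refine (contMDiffOn_inv_norm_smul_rotatedHead.congr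
      (isDirectionMap_iff.1 hα)).contMDiffAt ?_
    exact (isClosed_orthSphere _ _).isOpen_compl.mem_nhds θ.2
  intro θ hθ
  exact (contMDiffAt_subtype_iff (U := orthSphereCompl n) (f := α) (x := ⟨θ, hθ⟩)).1
    (hval.codRestrict_sphere (fun θ => (α θ).2) ⟨θ, hθ⟩) |>.contMDiffWithinAt

end DirectionMap

section Lift

theorem weightedRay_add_smul {d : ℕ} (w : Euc d → Sph d → ℝ) (f : Euc d → ℝ) (x : Euc d)
    (θ : Sph d) (r : ℝ) :
    weightedRay w f (x + r • (θ : Euc d)) θ = weightedRay w f x θ := by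
  simp only [weightedRay, add_assoc, ← add_smul]
  exact integral_add_left_eq_self
    (fun t => w (x + t • (θ : Euc d)) θ * f (x + t • (θ : Euc d))) r

theorem isCutoff_expNegInvGlue (n : ℕ) :
    IsCutoff (fun x : Euc n => expNegInvGlue (1 - ‖x‖ ^ 2)) := by
  have hlt (x : Euc n) : 0 < 1 - ‖x‖ ^ 2 ↔ x ∈ ball (0 : Euc n) 1 := by
    rw [mem_ball_zero_iff, sub_pos, sq_lt_one_iff₀ (norm_nonneg x)]
  refine ⟨expNegInvGlue.contDiff.comp (contDiff_const.sub (contDiff_norm_sq ℝ)), ?_,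
    fun x hx => expNegInvGlue.pos_of_pos ((hlt x).2 hx)⟩
  have hsupp : Function.support (fun x : Euc n => expNegInvGlue (1 - ‖x‖ ^ 2)) = ball 0 1 := by
    ext x
    rw [Function.mem_support, ne_eq, expNegInvGlue.zero_iff_nonpos, not_le, hlt]
  rw [tsupport, hsupp, closure_ball _ one_ne_zero]

variable {n : ℕ} {w₀ : Euc 2 → Sph 2 → ℝ} {f₀ : Euc 2 → ℝ} {ψ : Euc n → ℝ}
  {α : Sph (n + 2) → Sph 2}

theorem IsCutoff.eq_zero_of_one_lt_norm (hψ : IsCutoff ψ) {x : Euc n} (hx : 1 < ‖x‖) :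
    ψ x = 0 :=
  image_eq_zero_of_notMem_tsupport <| by simpa [hψ.support_eq] using hx

theorem IsBomanPair.eq_zero_of_one_lt_norm (h : IsBomanPair w₀ f₀) {x : Euc 2} (hx : 1 < ‖x‖) :
    f₀ x = 0 :=
  image_eq_zero_of_notMem_tsupport fun hm => hx.not_ge (by simpa using h.support_subset hm)

theorem IsBomanPair.weightedRay_eq_zero (h : IsBomanPair w₀ f₀) (x : Euc 2) (θ : Sph 2) :
    weightedRay w₀ f₀ x θ = 0 := by
  rw [← weightedRay_add_smul w₀ f₀ x θ (-⟪x, (θ : Euc 2)⟫)]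
  refine h.ray_eq_zero _ θ ?_
  rw [inner_add_left, real_inner_smul_left, real_inner_self_eq_norm_sq, norm_eq_of_mem_sphere]
  ring

theorem liftedFun_ne_zero (hf : f₀ ≠ 0) (hψ : IsCutoff ψ) : liftedFun ψ f₀ ≠ 0 := by
  obtain ⟨x, hx⟩ := Function.ne_iff.1 hf
  refine Function.ne_iff.2 ⟨planeVec x, ?_⟩
  rw [liftedFun, headPart_planeVec, tailPart_planeVec]
  exact mul_ne_zero (hψ.pos 0 (mem_ball_self one_pos)).ne' hx

theorem contDiff_liftedFun (hf : ContDiff ℝ ∞ f₀) (hψ : ContDiff ℝ ∞ ψ) :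
    ContDiff ℝ ∞ (liftedFun ψ f₀) :=
  (hψ.comp contDiff_tailPart).mul (hf.comp contDiff_headPart)

theorem hasCompactSupport_liftedFun (h : IsBomanPair w₀ f₀) (hψ : IsCutoff ψ) :
    HasCompactSupport (liftedFun ψ f₀) := by
  refine .intro (isCompact_closedBall 0 2) fun x hx => ?_
  rw [mem_closedBall_zero_iff, not_le] at hx
  rcases lt_or_ge 1 ‖headPart x‖ with hhead | hhead
  · rw [liftedFun, h.eq_zero_of_one_lt_norm hhead, mul_zero]
  · rw [liftedFun, hψ.eq_zero_of_one_lt_norm, zero_mul]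
    by_contra! htail
    nlinarith [norm_sq_eq_headPart_add_tailPart x, norm_nonneg (headPart x),
      norm_nonneg (tailPart x)]

theorem integrable_radonIntegrand {d : ℕ} {W : Euc d → Sph d → ℝ} {f : Euc d → ℝ} {θ : Sph d}
    (hW : Continuous fun x => W x θ) (hf : Continuous f) (hsupp : HasCompactSupport f) (s : ℝ) :
    Integrable (radonIntegrand W f s θ) := by
  have hpt : Topology.IsClosedEmbedding fun y : (ℝ ∙ (θ : Euc d))ᗮ =>
      s • (θ : Euc d) + (y : Euc d) :=
    (Homeomorph.addLeft (s • (θ : Euc d))).isClosedEmbedding.comp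
      (Submodule.isClosed_orthogonal _).isClosedEmbedding_subtypeVal
  exact ((hW.comp hpt.continuous).mul (hf.comp hpt.continuous)).integrable_of_hasCompactSupport
    (hsupp.comp_isClosedEmbedding hpt).mul_left

theorem integral_radonIntegrand_lifted_add_smul (h : IsBomanPair w₀ f₀) (s : ℝ) (θ : Sph (n + 2))
    (y a : (ℝ ∙ (θ : Euc (n + 2)))ᗮ) (ha : (a : Euc (n + 2)) = planeVec (α θ : Euc 2)) :
    ∫ t : ℝ, radonIntegrand (liftedWeight w₀ α) (liftedFun ψ f₀) s θ (y + t • a) = 0 := by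
  simp only [radonIntegrand, liftedWeight, liftedFun, Submodule.coe_add, Submodule.coe_smul, ha,
    ← add_assoc, headPart_add_smul_planeVec, tailPart_add_smul_planeVec, mul_left_comm _ (ψ _)]
  rw [integral_const_mul, ← weightedRay.eq_def w₀ f₀, h.weightedRay_eq_zero, mul_zero]

theorem IsDirectionMap.weightedRadon_lifted_eq_zero (hα : IsDirectionMap α)
    (h : IsBomanPair w₀ f₀) (ψ : Euc n → ℝ) (s : ℝ) (θ : Sph (n + 2)) :
    weightedRadon (liftedWeight w₀ α) (liftedFun ψ f₀) s θ = 0 :=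
  integral_eq_zero_of_integral_add_smul_eq_zero
    (a := ⟨planeVec (α θ : Euc 2),
      Submodule.mem_orthogonal_singleton_iff_inner_left.2 (hα.inner_eq_zero θ)⟩)
    (by rw [Submodule.coe_norm, norm_planeVec, norm_eq_of_mem_sphere])
    fun y => integral_radonIntegrand_lifted_add_smul h s θ y _ rfl

theorem continuous_liftedWeight (h : IsBomanPair w₀ f₀) (α : Sph (n + 2) → Sph 2)
    (θ : Sph (n + 2)) : Continuous fun x => liftedWeight w₀ α x θ :=
  (h.smooth_weight.continuous.comp (Continuous.prodMk_left (α θ))).comp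
    contDiff_headPart.continuous

theorem contMDiffOn_liftedWeight (h : IsBomanPair w₀ f₀) (hα : IsDirectionMap α) :
    ContMDiffOn (𝓘(ℝ, Euc (n + 2)).prod (𝓡 (n + 1))) 𝓘(ℝ, ℝ) ∞
      (Function.uncurry (liftedWeight w₀ α)) (Set.univ ×ˢ (orthSphere (stdVec 0) (stdVec 1))ᶜ) :=
  h.smooth_weight.comp_contMDiffOn <|
    (contDiff_headPart.contMDiff.comp contMDiff_fst).contMDiffOn.prodMk
      (hα.contMDiffOn.comp contMDiff_snd.contMDiffOn fun _ hy => hy.2)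

theorem isAdmissibleWeight_of_continuousOn {d : ℕ} {W : Euc d → Sph d → ℝ} {c C : ℝ} (hc : 0 < c)
    (hb : ∀ x θ, c ≤ W x θ ∧ W x θ ≤ C) {S : Set (Sph d)} (hS : IsClosed S)
    (hS0 : (volume : Measure (Euc d)).toSphere S = 0)
    (hW : ContinuousOn (Function.uncurry W) (Set.univ ×ˢ Sᶜ)) : IsAdmissibleWeight W := by
  refine ⟨⟨c, hc, fun x θ => (hb x θ).1⟩, memLp_top_of_bound ?_ C (.of_forall fun x => ?_)⟩
  · have hae : ∀ᵐ x ∂(volume : Measure (Euc d)).prod (volume : Measure (Euc d)).toSphere,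
        x ∈ (Set.univ : Set (Euc d)) ×ˢ Sᶜ := by
      simpa using Measure.quasiMeasurePreserving_snd.ae (measure_eq_zero_iff_ae_notMem.1 hS0)
    rw [← Measure.restrict_eq_self_of_ae_mem hae]
    exact hW.aestronglyMeasurable (MeasurableSet.univ.prod hS.measurableSet.compl)
  · obtain ⟨hlower, hupper⟩ := hb x.1 x.2
    rw [Function.uncurry, Real.norm_of_nonneg (hc.le.trans hlower)]
    exact hupper

end Lift

/-- The dimension is `d = n + 2`, so that `1 ≤ n` means `3 ≤ d`. -/
theorem theorem1 :
    ∃ (w₀ : Euc 2 → Sph 2 → ℝ) (f₀ : Euc 2 → ℝ), IsBomanPair w₀ f₀ ∧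
      ∀ n : ℕ, 1 ≤ n →
        (∃ ψ : Euc n → ℝ, IsCutoff ψ) ∧
        (∃ α : Sph (n + 2) → Sph 2, IsDirectionMap α) ∧
        (volume : Measure (Euc (n + 2))).toSphere (orthSphere (stdVec 0) (stdVec 1)) = 0 ∧
        ∀ (ψ : Euc n → ℝ) (α : Sph (n + 2) → Sph 2), IsCutoff ψ → IsDirectionMap α →
          ∃ (W : Euc (n + 2) → Sph (n + 2) → ℝ) (f : Euc (n + 2) → ℝ),
            W = liftedWeight w₀ α ∧ f = liftedFun ψ f₀ ∧
            (∀ (s : ℝ) (θ : Sph (n + 2)),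
              Integrable (radonIntegrand W f s θ) ∧ weightedRadon W f s θ = 0) ∧
            IsAdmissibleWeight W ∧
            ContDiff ℝ ∞ f ∧ HasCompactSupport f ∧ f ≠ 0 ∧
            (∀ x θ, 1 / 2 ≤ W x θ ∧ W x θ ≤ 1) ∧
            ContMDiffOn (𝓘(ℝ, Euc (n + 2)).prod (𝓡 (n + 1))) 𝓘(ℝ, ℝ) ∞ (Function.uncurry W)
              (Set.univ ×ˢ (orthSphere (stdVec 0) (stdVec 1))ᶜ) := by
  obtain ⟨w₀, f₀, h⟩ := exists_isBomanPair
  refine ⟨w₀, f₀, h, fun n _ => ?_⟩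
  have hnull := toSphere_orthSphere (stdVec_ne_zero (0 : Fin (n + 2))) (stdVec 1)
  refine ⟨⟨_, isCutoff_expNegInvGlue n⟩, exists_isDirectionMap n, hnull, fun ψ α hψ hα => ?_⟩
  have hbounds : ∀ x θ, 1 / 2 ≤ liftedWeight w₀ α x θ ∧ liftedWeight w₀ α x θ ≤ 1 :=
    fun _ _ => h.bounds _ _
  have hsmooth := contMDiffOn_liftedWeight h hα
  have hf := contDiff_liftedFun h.smooth_fun hψ.smooth
  have hcompact := hasCompactSupport_liftedFun h hψ
  exact ⟨_, _, rfl, rfl,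
    fun s θ => ⟨integrable_radonIntegrand (continuous_liftedWeight h α θ) hf.continuous hcompact s,
      hα.weightedRadon_lifted_eq_zero h ψ s θ⟩,
    isAdmissibleWeight_of_continuousOn one_half_pos hbounds (isClosed_orthSphere _ _) hnull
      hsmooth.continuousOn,
    hf, hcompact, liftedFun_ne_zero h.ne_zero hψ, hbounds, hsmooth⟩
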